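/- Let $n\ge 1$, let $k\ge 0$ be an integer, $0<\alpha\le 1$ and $\nu\in\mathbb R$, with $\nu\ge 0$ if $\alpha=1$. Let $D_1,\dots,D_n\subset\mathbb C$ be bounded domains with $C^{k+1,\alpha}$ boundary (near each boundary point, after a rotation and a translation, $D_j$ is the region above the graph of a $C^{k+1}$ function whose derivative of order $k+1$ is Hölder continuous with exponent $\alpha$), and let $\Omega=D_1\times\cdots\times D_n\subset\mathbb C^n\cong\mathbb R^{2n}$. Denote by $C^{k,L^\alpha Log^\nu L}(\Omega)$ the space of those $f\in C^k(\Omega)$, complex-valued, for which $$\|f\|_{C^{k,L^\alpha Log^\nu L}(\Omega)}:=\sum_{|\gamma|=0}^{k}\ \sup_{w\in\Omega}|D^\gamma f(w)|+\sum_{|\gamma|=k}\ \sup_{\substack{w,\,w+h\in\Omega\\ 0<|h|\le 1/2}}\frac{|D^\gamma f(w+h)-D^\gamma f(w)|}{|h|^\alpha\,|\ln|h||^\nu}<\infty ,$$ where $D^\gamma$ runs over the partial derivatives in the $2n$ real coordinates. For $j\in\{1,\dots,n\}$, $f\in C^{k,L^\alpha Log^\nu L}(\Omega)$ and $z\in\Omega$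 put $$T_jf(z):=-\frac1{2\pi i}\int_{D_j}\frac{f(z_1,\dots,z_{j-1},\zeta,z_{j+1},\dots,z_n)}{\zeta-z_j}\,d\bar\zeta\wedge d\zeta .$$ Then the integral converges absolutely for every $z\in\Omega$, and each $T_j$ is a bounded linear operator from $C^{k,L^\alpha Log^\nu L}(\Omega)$ into itself: there is a constant $C$, depending only on $\Omega,k,\alpha$ and $\nu$, such that for all $j\in\{1,\dots,n\}$ and all $f\in C^{k,L^\alpha Log^\nu L}(\Omega)$ one has $T_jf\in C^{k,L^\alpha Log^\nu L}(\Omega)$ and $$\|T_jf\|_{C^{k,L^\alpha Log^\nu L}(\Omega)}\le C\,\|f\|_{C^{k,L^\alpha Log^\nu L}(\Omega)} .$$ -/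

import Mathlib

open scoped ENNReal NNReal

noncomputable section

/-- `D ⊂ ℂ` is a bounded domain with `C^{m,α}` boundary (`m : ℕ`, `0 < α ≤ 1`): it is open, connected,
nonempty and bounded and, near each boundary point `p`, after the translation of `p` to `0` and a
rotation by a unit complex number `u`, it is the region strictly above the graph of a function
`φ : ℝ → ℝ` of class `C^m` whose `m`-th derivative is Hölder continuous of exponent `α`. -/
structure IsBoundedDomainWithHolderBoundary (m : ℕ) (α : ℝ) (D : Set ℂ) : Prop where
  isOpen : IsOpen D
  isConnected : IsConnected D
  isBounded : Bornology.IsBounded D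
  boundary : ∀ p ∈ frontier D, ∃ (u : ℂ) (r : ℝ) (φ : ℝ → ℝ) (K : ℝ),
    ‖u‖ = 1 ∧ 0 < r ∧ ContDiff ℝ m φ ∧
    (∀ s t : ℝ, |iteratedDeriv m φ s - iteratedDeriv m φ t| ≤ K * |s - t| ^ α) ∧
    ∀ z ∈ Metric.ball p r, z ∈ D ↔ φ (((z - p) / u).re) < ((z - p) / u).im

/-- The product domain `D_1 × ⋯ × D_n` in `ℂ^n` (with the Euclidean norm). -/
def productDomain {n : ℕ} (D : Fin n → Set ℂ) : Set (EuclideanSpace ℂ (Fin n)) :=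
  {z | ∀ j, z j ∈ D j}

/-- The list of the real coordinate directions of `ℂ^n = ℝ^{2n}` prescribed by a multi-index `γ`: the
`x_j`-direction `e_j` is repeated `γ (j, 0)` times and the `y_j`-direction `i e_j` is repeated
`γ (j, 1)` times. -/
def directions {n : ℕ} (γ : Fin n × Fin 2 → ℕ) : List (EuclideanSpace ℂ (Fin n)) :=
  (List.finRange n).flatMap fun j =>
    List.replicate (γ (j, 0)) (EuclideanSpace.single j (1 : ℂ)) ++
      List.replicate (γ (j, 1)) (EuclideanSpace.single j Complex.I)

/-- The real partial derivative `D^γ f` of order `|γ| = ∑ γ`, for a multi-index `γ` in the `2n` real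
coordinates `x_1, y_1, …, x_n, y_n` of `ℂ^n`. -/
def multiDeriv {n : ℕ} (γ : Fin n × Fin 2 → ℕ) (f : EuclideanSpace ℂ (Fin n) → ℂ)
    (w : EuclideanSpace ℂ (Fin n)) : ℂ :=
  iteratedFDeriv ℝ (directions γ).length f w (directions γ).get

/-- The multi-indices of order `m` in the `2n` real coordinates of `ℂ^n`. -/
def multiIndices (n m : ℕ) : Finset (Fin n × Fin 2 → ℕ) :=
  Finset.piAntidiag Finset.univ m

/-- `sup_{w ∈ Ω} |f(w)|`, with values in `[0, ∞]`. -/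
def supNormOn {n : ℕ} (Ω : Set (EuclideanSpace ℂ (Fin n)))
    (f : EuclideanSpace ℂ (Fin n) → ℂ) : ℝ≥0∞ :=
  ⨆ w ∈ Ω, ENNReal.ofReal ‖f w‖

/-- The Log-Hölder seminorm: the supremum in `[0, ∞]`, over `w, w + h ∈ Ω` with `0 < |h| ≤ 1/2`, of
`|f(w + h) - f(w)| / (|h|^α |ln |h||^ν)`. -/
def logHolderSeminorm {n : ℕ} (α ν : ℝ) (Ω : Set (EuclideanSpace ℂ (Fin n)))
    (f : EuclideanSpace ℂ (Fin n) → ℂ) : ℝ≥0∞ :=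
  ⨆ (w : EuclideanSpace ℂ (Fin n)) (h : EuclideanSpace ℂ (Fin n)) (_ : w ∈ Ω) (_ : w + h ∈ Ω)
    (_ : 0 < ‖h‖) (_ : ‖h‖ ≤ 1 / 2),
    ENNReal.ofReal (‖f (w + h) - f w‖ / (‖h‖ ^ α * |Real.log ‖h‖| ^ ν))

/-- The `C^{k, L^α Log^ν L}(Ω)` norm, with values in `[0, ∞]`. -/
def logHolderNorm {n : ℕ} (k : ℕ) (α ν : ℝ) (Ω : Set (EuclideanSpace ℂ (Fin n)))
    (f : EuclideanSpace ℂ (Fin n) → ℂ) : ℝ≥0∞ :=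
  (∑ m ∈ Finset.range (k + 1), ∑ γ ∈ multiIndices n m, supNormOn Ω (multiDeriv γ f)) +
    ∑ γ ∈ multiIndices n k, logHolderSeminorm α ν Ω (multiDeriv γ f)

/-- Membership in `C^{k, L^α Log^ν L}(Ω)`, for an open set `Ω`. Functions on `Ω` are represented by
functions on `ℂ^n`, whose values outside `Ω` play no role. -/
def MemLogHolder {n : ℕ} (k : ℕ) (α ν : ℝ) (Ω : Set (EuclideanSpace ℂ (Fin n)))
    (f : EuclideanSpace ℂ (Fin n) → ℂ) : Prop :=
  ContDiffOn ℝ k f Ω ∧ logHolderNorm k α ν Ω f < ∞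

/-- The point `(z_1, …, z_{j-1}, ζ, z_{j+1}, …, z_n)`. -/
def replaceCoord {n : ℕ} (z : EuclideanSpace ℂ (Fin n)) (j : Fin n) (ζ : ℂ) :
    EuclideanSpace ℂ (Fin n) :=
  WithLp.toLp 2 (Function.update (fun i => z i) j ζ)

/-- The integrand `f(z_1, …, ζ, …, z_n) / (ζ - z_j)` of the slice solid Cauchy integral. -/
def sliceCauchyIntegrand {n : ℕ} (j : Fin n) (f : EuclideanSpace ℂ (Fin n) → ℂ)
    (z : EuclideanSpace ℂ (Fin n)) (ζ : ℂ) : ℂ :=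
  f (replaceCoord z j ζ) / (ζ - z j)

/-- The slice Cauchy–Green operator
`T_j f(z) = -1/(2πi) ∫_{D_j} f(z_1, …, ζ, …, z_n) / (ζ - z_j) dζ̄ ∧ dζ`.
For `ζ = x + i y` one has `dζ̄ ∧ dζ = 2i dx ∧ dy`, which gives the factor `2i` in front of the
integral for the Lebesgue measure of `ℂ`. -/
def sliceCauchyGreen {n : ℕ} (D : Fin n → Set ℂ) (j : Fin n)
    (f : EuclideanSpace ℂ (Fin n) → ℂ) (z : EuclideanSpace ℂ (Fin n)) : ℂ :=
  -(1 / (2 * Real.pi * Complex.I)) * (2 * Complex.I * ∫ ζ in D j, sliceCauchyIntegrand j f z ζ)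

end

/-!
The slice operator `T g(z) = ∫_V g(z + ι(ζ - π z)) / (π z - ζ)`, which up to the factor `1 / π` is
the operator of the theorem, integrates against a kernel which is locally integrable in the plane.
For this reason it does no harm in the coordinates that are left fixed, and in the coordinate
which is integrated it gains almost one derivative. Both facts are used, in the form of one
estimate: if `ω` is the modulus of continuity of the space and `ε = α / 2`, then `T` maps
functions whose derivatives of order `m` have modulus `ω |z - w| + |π z - π w| ^ ε` to functions
whose derivatives of order `m` have modulus `ω |z - w|` (`IsSlicing.exists_regOn_sliceTransform`).
The gain from `ε` to `ω` in the slice direction is not needed for the theorem itself, but it makes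
the induction on `m` work with a coefficient `b` whose derivatives are merely Hölder continuous.

*Order zero* (`IsSlicing.exists_regOn_zero_sliceTransform`). In the other directions, the modulus
passes under the integral. In the slice direction one subtracts `g z`: the integrand
`(g(ζ) - g(z)) (1 / (z - ζ) - 1 / (w - ζ))` is integrable with integral `O(|z - w|)`, since `g` is
Hölder continuous, and what remains is `g z` times a difference of the Cauchy transform of the
characteristic function of `V`. The latter is Lipschitz
(`IsBoundedDomainWithHolderBoundary.exists_lipschitz_cauchyTransform`). Indeed its derivative is a
truncated singular integral of `1 / (z - ζ) ^ 2`; near the boundary one multiplies it by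
`W z = W ζ + (W z - W ζ)`, where `W` is a Hölder continuous field tangent to the boundary. The
first term is a derivative along `W`, and integrates to something bounded without a boundary term,
while the second one weakens the singularity.

*Higher order* (`IsSlicing.exists_hasFDerivAt`). Derivatives in the other directions commute with
`T`. In the slice direction, `∂̄ T g = π g` is the Cauchy–Pompeiu formula. For `∂` take a function
`b` of class `C^{k,ε}` such that `∂ + b ∂̄` is tangent to the boundary; then the integration by
parts `∂ T g = T (∂g + ∂̄(b g)) - π b g` has no boundary term. The induction on `m` follows,
because one spare derivative of `g` and `b g` can be traded for the modulus of continuity. This is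
where the boundary of class `C^{k+1,α}` enters: the tangent fields of its graph charts are of
class `C^{k,α}`, and `b` is obtained by patching the quotients `conj W / W`
(`IsBoundedDomainWithHolderBoundary.exists_isTangentialOn`). The trade is possible since a domain
with Lipschitz boundary is quasiconvex, so that a bounded derivative gives a Lipschitz bound
(`IsBoundedDomainWithHolderBoundary.exists_lipschitz`).

The hypothesis on `ν` is used only to see that the Log-Hölder modulus is not smaller than a
multiple of `t` (`exists_isModulus_logHolderModulus`): a function with bounded derivative has to
satisfy it.
-/

open MeasureTheory Metric Set

noncomputable section

/-! ### Integrals of the Cauchy kernel -/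

theorem integrableOn_ball_norm_sub_rpow {s : ℝ} (hs : s < 2) (z : ℂ) (d : ℝ) :
    IntegrableOn (fun ζ : ℂ => ‖z - ζ‖ ^ (-s)) (ball z d) := by
  rcases le_or_gt d 0 with hd | hd
  · simp [ball_eq_empty.2 hd]
  have h0 : IntegrableOn (fun ζ : ℂ => ‖ζ‖ ^ (-s)) (ball 0 d) := by
    refine (integrableOn_fun_norm_addHaar (volume : Measure ℂ) (f := fun y : ℝ => y ^ (-s))).2 ?_
    have h1 : IntegrableOn (fun y : ℝ => y ^ (1 - s)) (Ioo 0 d) :=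
      (intervalIntegral.integrableOn_Ioo_rpow_iff hd).2 (by linarith)
    refine h1.congr_fun (fun y hy => ?_) measurableSet_Ioo
    simp only [Complex.finrank_real_complex, smul_eq_mul]
    rw [show (1 - s) = 1 + -s by ring, Real.rpow_add hy.1, Real.rpow_one]
    norm_num
  have hmp : MeasurePreserving (fun ζ : ℂ => z - ζ) volume volume :=
    Measure.measurePreserving_sub_left volume z
  have hpre : (fun ζ : ℂ => z - ζ) ⁻¹' (ball 0 d) = ball z d := by
    ext ζ; simp [dist_eq_norm, norm_sub_rev]
  have := (hmp.integrableOn_comp_preimage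
    (MeasurableEquiv.subLeft z).measurableEmbedding (s := ball 0 d)).2 h0
  rwa [hpre] at this

/-- The bound is uniform in `z`: the singularity contributes at most the integral over the unit
disc about `z`, and the integrand is at most `1` off that disc. -/
theorem exists_setIntegral_norm_sub_rpow_le {V : Set ℂ}
    (hb : Bornology.IsBounded V) {s : ℝ} (hs0 : 0 ≤ s) (hs : s < 2) :
    ∃ C : ℝ, 0 ≤ C ∧ ∀ z : ℂ, IntegrableOn (fun ζ : ℂ => ‖z - ζ‖ ^ (-s)) V ∧
      ∫ ζ in V, ‖z - ζ‖ ^ (-s) ≤ C := by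
  have hVfin : volume V < ∞ := hb.measure_lt_top
  set A : ℝ := ∫ ζ in ball (0 : ℂ) 1, ‖(0 : ℂ) - ζ‖ ^ (-s) with hA
  have hind : ∀ z : ℂ, Integrable ((ball z 1).indicator fun ζ : ℂ => ‖z - ζ‖ ^ (-s)) :=
    fun z => (integrable_indicator_iff measurableSet_ball).2 (integrableOn_ball_norm_sub_rpow hs z 1)
  have hAz : ∀ z : ℂ, ∫ ζ, (ball z 1).indicator (fun ζ : ℂ => ‖z - ζ‖ ^ (-s)) ζ = A := by
    intro z
    rw [hA, ← integral_indicator measurableSet_ball, ← integral_sub_right_eq_self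
      ((ball (0 : ℂ) 1).indicator fun ζ : ℂ => ‖(0 : ℂ) - ζ‖ ^ (-s)) z]
    refine integral_congr_ae (Filter.Eventually.of_forall fun ζ => ?_)
    simp [indicator, dist_eq_norm, norm_sub_rev]
  have hbd : ∀ z ζ : ℂ, ‖z - ζ‖ ^ (-s) ≤
      (ball z 1).indicator (fun ζ : ℂ => ‖z - ζ‖ ^ (-s)) ζ + 1 := by
    intro z ζ
    by_cases h : ζ ∈ ball z 1
    · rw [indicator_of_mem h]; linarith
    · rw [indicator_of_notMem h, zero_add]
      refine Real.rpow_le_one_of_one_le_of_nonpos ?_ (by linarith)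
      simpa [dist_eq_norm, norm_sub_rev] using h
  have hint : ∀ z : ℂ, IntegrableOn (fun ζ : ℂ => (ball z 1).indicator
      (fun ζ : ℂ => ‖z - ζ‖ ^ (-s)) ζ + 1) V := fun z =>
    (hind z).integrableOn.add (integrableOn_const hVfin.ne)
  have hI : ∀ z : ℂ, IntegrableOn (fun ζ : ℂ => ‖z - ζ‖ ^ (-s)) V := by
    intro z
    refine (hint z).mono' (by
      exact ((continuous_const.sub continuous_id).norm.measurable.pow_const _).aestronglyMeasurable)
      (Filter.Eventually.of_forall fun ζ => ?_)
    rw [Real.norm_of_nonneg (by positivity)]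
    exact hbd z ζ
  refine ⟨A + volume.real V, by positivity, fun z => ⟨hI z, ?_⟩⟩
  calc ∫ ζ in V, ‖z - ζ‖ ^ (-s)
      ≤ ∫ ζ in V, ((ball z 1).indicator (fun ζ : ℂ => ‖z - ζ‖ ^ (-s)) ζ + 1) :=
        integral_mono (hI z) (hint z) fun ζ => hbd z ζ
    _ = (∫ ζ in V, (ball z 1).indicator (fun ζ : ℂ => ‖z - ζ‖ ^ (-s)) ζ) + volume.real V := by
        rw [integral_add (hind z).integrableOn (integrableOn_const hVfin.ne)]
        simp
    _ ≤ A + volume.real V := by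
        gcongr
        rw [← hAz z]
        exact setIntegral_le_integral (hind z) (Filter.Eventually.of_forall fun ζ =>
          indicator_nonneg (fun _ _ => by positivity) _)

theorem exists_setIntegral_norm_sub_inv_le {V : Set ℂ}
    (hb : Bornology.IsBounded V) :
    ∃ C : ℝ, 0 ≤ C ∧ ∀ z : ℂ, IntegrableOn (fun ζ : ℂ => ‖z - ζ‖⁻¹) V ∧
      ∫ ζ in V, ‖z - ζ‖⁻¹ ≤ C := by
  simpa only [Real.rpow_neg_one] using
    exists_setIntegral_norm_sub_rpow_le hb (s := 1) zero_le_one one_lt_two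

theorem integrableOn_ball_norm_sub_inv (z : ℂ) (d : ℝ) :
    IntegrableOn (fun ζ : ℂ => ‖z - ζ‖⁻¹) (ball z d) := by
  simpa only [Real.rpow_neg_one] using integrableOn_ball_norm_sub_rpow one_lt_two z d

/-- The Cauchy kernel is scale invariant: its integral over a disc of radius `d` about its
singularity is proportional to `d`. -/
theorem setIntegral_ball_norm_sub_inv (z : ℂ) {d : ℝ} (hd : 0 ≤ d) :
    ∫ ζ in ball z d, ‖z - ζ‖⁻¹ = 2 * Real.pi * d := by
  have h1 : ∫ ζ in ball z d, ‖z - ζ‖⁻¹ = ∫ ζ : ℂ, (Iio d).indicator (fun y : ℝ => y⁻¹) ‖ζ‖ := by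
    rw [← integral_indicator measurableSet_ball,
      ← integral_sub_right_eq_self (fun ζ : ℂ => (Iio d).indicator (fun y : ℝ => y⁻¹) ‖ζ‖) z]
    refine integral_congr_ae (Filter.Eventually.of_forall fun ζ => ?_)
    simp [indicator, dist_eq_norm, norm_sub_rev]
  rw [h1, integral_fun_norm_addHaar (volume : Measure ℂ) ((Iio d).indicator fun y : ℝ => y⁻¹)]
  have h2 : ∫ y in Ioi (0 : ℝ), y ^ (Module.finrank ℝ ℂ - 1) • (Iio d).indicator
      (fun y : ℝ => y⁻¹) y = d := by
    have : ∫ y in Ioi (0 : ℝ), y ^ (Module.finrank ℝ ℂ - 1) • (Iio d).indicator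
        (fun y : ℝ => y⁻¹) y = ∫ y in Ioi (0 : ℝ), (Iio d).indicator (fun _ => (1 : ℝ)) y := by
      refine setIntegral_congr_fun measurableSet_Ioi fun y hy => ?_
      have hy' : y ≠ 0 := (mem_Ioi.1 hy).ne'
      by_cases hyd : y < d <;> simp [indicator, hyd, hy']
    rw [this, setIntegral_indicator measurableSet_Iio, Ioi_inter_Iio]
    simp [hd]
  rw [h2]
  simp [Measure.real, Complex.volume_ball]
  ring

/-- The difference of two Cauchy kernels, damped at one of the two singularities as by a Hölder
continuous density, is `O(|z - w|)` with an integrable factor. -/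
theorem norm_inv_sub_inv_mul_rpow_le {ε : ℝ} (hε1 : ε ≤ 1) {z w ζ : ℂ} (hz : ζ ≠ z) (hw : ζ ≠ w) :
    ‖1 / (z - ζ) - 1 / (w - ζ)‖ * ‖z - ζ‖ ^ ε ≤
      ‖z - w‖ * (‖z - ζ‖ ^ (-(2 - ε)) + ‖w - ζ‖ ^ (-(2 - ε))) := by
  have ha : 0 < ‖z - ζ‖ := norm_pos_iff.2 (sub_ne_zero.2 hz.symm)
  have hb : 0 < ‖w - ζ‖ := norm_pos_iff.2 (sub_ne_zero.2 hw.symm)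
  have h1 : 1 / (z - ζ) - 1 / (w - ζ) = (w - z) / ((z - ζ) * (w - ζ)) := by
    rw [div_sub_div _ _ (sub_ne_zero.2 hz.symm) (sub_ne_zero.2 hw.symm)]; ring
  rw [h1, norm_div, norm_mul, norm_sub_rev w z]
  set a := ‖z - ζ‖
  set b := ‖w - ζ‖
  have key : (a * b)⁻¹ * a ^ ε ≤ a ^ (-(2 - ε)) + b ^ (-(2 - ε)) := by
    have e1 : ∀ x : ℝ, 0 < x → x ^ (-(2 - ε)) = x⁻¹ * (x⁻¹ * x ^ ε) := by
      intro x hx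
      rw [show -(2 - ε) = (-1) + ((-1) + ε) by ring, Real.rpow_add hx, Real.rpow_add hx,
        Real.rpow_neg_one]
    have hae : 0 ≤ a ^ ε := by positivity
    rcases le_total a b with hab | hab
    · have hba : b⁻¹ ≤ a⁻¹ := inv_anti₀ ha hab
      calc (a * b)⁻¹ * a ^ ε = b⁻¹ * (a⁻¹ * a ^ ε) := by rw [mul_inv]; ring
        _ ≤ a⁻¹ * (a⁻¹ * a ^ ε) := by gcongr
        _ = a ^ (-(2 - ε)) := (e1 a ha).symm
        _ ≤ _ := by linarith [Real.rpow_nonneg hb.le (-(2 - ε))]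
    · have h2 : a⁻¹ * a ^ ε ≤ b⁻¹ * b ^ ε := by
        have : ∀ x : ℝ, 0 < x → x⁻¹ * x ^ ε = x ^ (ε - 1) := fun x hx => by
          rw [Real.rpow_sub_one hx.ne', div_eq_inv_mul]
        rw [this a ha, this b hb]
        exact Real.rpow_le_rpow_of_nonpos hb hab (by linarith)
      calc (a * b)⁻¹ * a ^ ε = b⁻¹ * (a⁻¹ * a ^ ε) := by rw [mul_inv]; ring
        _ ≤ b⁻¹ * (b⁻¹ * b ^ ε) := by gcongr
        _ = b ^ (-(2 - ε)) := (e1 b hb).symm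
        _ ≤ _ := by linarith [Real.rpow_nonneg ha.le (-(2 - ε))]
  calc ‖z - w‖ / (a * b) * a ^ ε = ‖z - w‖ * ((a * b)⁻¹ * a ^ ε) := by ring
    _ ≤ _ := by gcongr

/-! ### Wirtinger coefficients and the Cauchy–Pompeiu formula -/

/-- The coefficient of `c` in the decomposition `A c = a * c + b * conj c` of a real-linear map:
for `A = df` it is `∂f`. -/
def holPart (A : ℂ →L[ℝ] ℂ) : ℂ := (A 1 - Complex.I * A Complex.I) / 2

/-- The coefficient of `conj c` in the decomposition `A c = a * c + b * conj c` of a real-linear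
map: for `A = df` it is `∂̄f`. -/
def antiPart (A : ℂ →L[ℝ] ℂ) : ℂ := (A 1 + Complex.I * A Complex.I) / 2

theorem clm_apply_eq_holPart_add_antiPart (A : ℂ →L[ℝ] ℂ) (c : ℂ) :
    A c = holPart A * c + antiPart A * (starRingEnd ℂ) c := by
  have h : A c = c.re * A 1 + c.im * A Complex.I := by
    conv_lhs => rw [show c = c.re • (1 : ℂ) + c.im • Complex.I by
      simp [Complex.re_add_im]]
    rw [map_add, map_smul, map_smul]; simp
  rw [h, holPart, antiPart]
  apply Complex.ext <;> simp <;> ring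

theorem norm_holPart_le (A : ℂ →L[ℝ] ℂ) : ‖holPart A‖ ≤ ‖A‖ := by
  have h1 : ‖A 1‖ ≤ ‖A‖ := by simpa using A.le_opNorm 1
  have h2 : ‖A Complex.I‖ ≤ ‖A‖ := by simpa using A.le_opNorm Complex.I
  have h3 := norm_sub_le (A 1) (Complex.I * A Complex.I)
  rw [norm_mul, Complex.norm_I, one_mul] at h3
  rw [holPart, norm_div, Complex.norm_ofNat]
  linarith

theorem norm_antiPart_le (A : ℂ →L[ℝ] ℂ) : ‖antiPart A‖ ≤ ‖A‖ := by
  have h1 : ‖A 1‖ ≤ ‖A‖ := by simpa using A.le_opNorm 1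
  have h2 : ‖A Complex.I‖ ≤ ‖A‖ := by simpa using A.le_opNorm Complex.I
  have h3 := norm_add_le (A 1) (Complex.I * A Complex.I)
  rw [norm_mul, Complex.norm_I, one_mul] at h3
  rw [antiPart, norm_div, Complex.norm_ofNat]
  linarith

/-- The Cauchy–Pompeiu formula for a compactly supported function. In polar coordinates around `z`
one has `2 ∂̄u = e^{iθ} (∂_r + (i / r) ∂_θ) u`, so the kernel cancels the Jacobian, and the two
terms integrate to boundary values. -/
theorem integral_antiPart_fderiv_div {u : ℂ → ℂ} (hu : ContDiff ℝ 1 u) (hc : HasCompactSupport u)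
    (z : ℂ) : ∫ ζ, antiPart (fderiv ℝ u ζ) / (z - ζ) = Real.pi * u z := by
  set e : ℝ → ℂ := fun θ => Real.cos θ + Real.sin θ * Complex.I with he
  have hene : ∀ θ, ‖e θ‖ = 1 := fun θ => by
    have : e θ = Complex.exp (θ * Complex.I) := by
      rw [Complex.exp_mul_I, he]; simp
    rw [this, Complex.norm_exp_ofReal_mul_I]
  have hec : Continuous e := by rw [he]; fun_prop
  have hconj : ∀ θ, (starRingEnd ℂ) (e θ) * e θ = 1 := fun θ => by
    rw [← Complex.normSq_eq_conj_mul_self, Complex.normSq_eq_norm_sq, hene]; simp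
  have hde : ∀ θ, HasDerivAt e (Complex.I * e θ) θ := fun θ => by
    have h1 := (Real.hasDerivAt_cos θ).ofReal_comp
    have h2 := ((Real.hasDerivAt_sin θ).ofReal_comp).mul_const Complex.I
    refine (h1.add h2).congr_deriv ?_
    simp only [he]
    apply Complex.ext <;> simp
  have hud : Differentiable ℝ u := hu.differentiable one_ne_zero
  have hfc : Continuous (fderiv ℝ u) := hu.continuous_fderiv one_ne_zero
  obtain ⟨B, hB⟩ : ∃ B, ∀ ζ, ‖fderiv ℝ u ζ‖ ≤ B :=
    (hc.fderiv ℝ).exists_bound_of_continuous hfc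
  obtain ⟨R, hR0, hR⟩ : ∃ R : ℝ, 0 < R ∧ ∀ (r θ : ℝ), R ≤ r → z + r * e θ ∉ tsupport u := by
    obtain ⟨R, hR⟩ := hc.isCompact.isBounded.subset_ball z
    refine ⟨max R 1, by positivity, fun r θ hr h => ?_⟩
    have := hR h
    have hr0 : 0 ≤ r := le_trans (by positivity) hr
    rw [mem_ball, dist_eq_norm, add_sub_cancel_left, norm_mul, hene, mul_one, Complex.norm_real,
      Real.norm_of_nonneg hr0] at this
    exact absurd (le_trans (le_max_left _ _) hr) (not_le.2 this)
  set P : ℝ → ℝ → ℂ := fun r θ => fderiv ℝ u (z + r * e θ) (e θ) with hP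
  set Q : ℝ → ℝ → ℂ := fun r θ => Complex.I * fderiv ℝ u (z + r * e θ) (Complex.I * e θ) with hQ
  have hPc : Continuous (fun p : ℝ × ℝ => P p.1 p.2) := by
    simp only [hP]
    refine Continuous.clm_apply (hfc.comp ?_) (by fun_prop)
    fun_prop
  have hQc : Continuous (fun p : ℝ × ℝ => Q p.1 p.2) := by
    simp only [hQ]
    refine continuous_const.mul (Continuous.clm_apply (hfc.comp ?_) (by fun_prop))
    fun_prop
  have hzero : ∀ r θ, R ≤ r → fderiv ℝ u (z + r * e θ) = 0 := fun r θ hr =>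
    image_eq_zero_of_notMem_tsupport fun h => hR r θ hr (tsupport_fderiv_subset ℝ h)
  have hint : ∀ F : ℝ × ℝ → ℂ, Continuous F → (∀ r θ, R ≤ r → F (r, θ) = 0) →
      IntegrableOn F (Ioi 0 ×ˢ Ioo (-Real.pi) Real.pi) (volume.prod volume) := by
    intro F hF h0
    have h1 : IntegrableOn F (Icc 0 R ×ˢ Icc (-Real.pi) Real.pi) (volume.prod volume) :=
      hF.continuousOn.integrableOn_compact (isCompact_Icc.prod isCompact_Icc)
    refine h1.of_forall_sdiff_eq_zero (measurableSet_Ioi.prod measurableSet_Ioo) ?_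
    rintro ⟨r, θ⟩ ⟨⟨hr, hθ⟩, hn⟩
    refine h0 r θ (le_of_not_ge fun hrR => hn ⟨⟨le_of_lt hr, hrR⟩, hθ.1.le, hθ.2.le⟩)
  have hPi := hint _ hPc (fun r θ hr => by simp [hP, hzero r θ hr])
  have hQi := hint _ hQc (fun r θ hr => by simp [hQ, hzero r θ hr])
  -- the radial part
  have hPint : ∫ p in Ioi (0 : ℝ) ×ˢ Ioo (-Real.pi) Real.pi, P p.1 p.2 ∂(volume.prod volume) =
      -(2 * Real.pi * u z) := by
    rw [← setIntegral_prod_swap]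
    refine (setIntegral_prod _ hPi.swap).trans ?_
    have : ∀ θ : ℝ, ∫ r in Ioi (0 : ℝ), P r θ = -u z := by
      intro θ
      have hd : ∀ r : ℝ, HasDerivAt (fun r : ℝ => u (z + r * e θ)) (P r θ) r := by
        intro r
        have h1 : HasDerivAt (fun r : ℝ => z + r * e θ) (e θ) r := by
          simpa using ((hasDerivAt_id r).ofReal_comp.mul_const (e θ)).const_add z
        exact (hud (z + r * e θ)).hasFDerivAt.comp_hasDerivAt r h1
      have h2 := integral_Ioi_of_hasDerivAt_of_tendsto (a := 0) (m := 0)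
        (f := fun r : ℝ => u (z + r * e θ)) (f' := fun r => P r θ)
        (hd 0).continuousAt.continuousWithinAt (fun r _ => hd r) ?_ ?_
      · simpa using h2
      · have hc1 : Continuous (fun r => P r θ) := hPc.comp (by fun_prop : Continuous fun r : ℝ => (r, θ))
        refine (hc1.continuousOn.integrableOn_compact
          (isCompact_Icc (a := 0) (b := R))).of_forall_sdiff_eq_zero measurableSet_Ioi ?_
        rintro r ⟨hr, hn⟩
        have : R ≤ r := le_of_not_ge fun h => hn ⟨le_of_lt hr, h⟩
        simp [hP, hzero r θ this]
      · refine tendsto_const_nhds.congr' ?_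
        filter_upwards [Filter.eventually_ge_atTop R] with r hr
        exact (image_eq_zero_of_notMem_tsupport (hR r θ hr)).symm
    refine (setIntegral_congr_fun measurableSet_Ioo (fun θ _ => this θ)).trans ?_
    simp [Real.pi_pos.le]
    left; ring
  -- the angular part
  have hQint : ∫ p in Ioi (0 : ℝ) ×ˢ Ioo (-Real.pi) Real.pi, Q p.1 p.2 ∂(volume.prod volume) = 0 := by
    rw [setIntegral_prod _ hQi]
    have : ∀ r ∈ Ioi (0 : ℝ), ∫ θ in Ioo (-Real.pi) Real.pi, Q r θ = 0 := by
      intro r hr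
      have hr' : (r : ℂ) ≠ 0 := by exact_mod_cast (mem_Ioi.1 hr).ne'
      rw [← integral_Ioc_eq_integral_Ioo, ← intervalIntegral.integral_of_le
        (by linarith [Real.pi_pos])]
      have hd : ∀ θ : ℝ, HasDerivAt (fun θ : ℝ => Complex.I / r * u (z + r * e θ)) (Q r θ) θ := by
        intro θ
        have h1 : HasDerivAt (fun θ : ℝ => z + r * e θ) (r * (Complex.I * e θ)) θ :=
          ((hde θ).const_mul (r : ℂ)).const_add z
        have h2 := ((hud (z + r * e θ)).hasFDerivAt.comp_hasDerivAt θ h1).const_mul (Complex.I / r)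
        refine h2.congr_deriv ?_
        rw [show (r : ℂ) * (Complex.I * e θ) = r • (Complex.I * e θ) from rfl, map_smul,
          Complex.real_smul]
        simp only [hQ]
        field_simp
      rw [intervalIntegral.integral_eq_sub_of_hasDerivAt (fun θ _ => hd θ)]
      · simp [he]
      · exact (hQc.comp (by fun_prop : Continuous fun θ : ℝ => (r, θ))).intervalIntegrable _ _
    rw [setIntegral_congr_fun measurableSet_Ioi this]
    simp
  rw [← integral_add_right_eq_self _ z, ← Complex.integral_comp_polarCoord_symm,
    polarCoord_target]
  have hcongr : ∀ p ∈ Ioi (0 : ℝ) ×ˢ Ioo (-Real.pi) Real.pi,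
      p.1 • (antiPart (fderiv ℝ u (Complex.polarCoord.symm p + z)) /
        (z - (Complex.polarCoord.symm p + z))) = -(1 / 2) * (P p.1 p.2 + Q p.1 p.2) := by
    rintro ⟨r, θ⟩ ⟨hr, -⟩
    have hr' : (r : ℂ) ≠ 0 := by exact_mod_cast (mem_Ioi.1 hr).ne'
    have he0 : e θ ≠ 0 := fun h => by simpa [h] using hene θ
    have hpol : Complex.polarCoord.symm (r, θ) = r * e θ := by
      rw [Complex.polarCoord_symm_apply]
    rw [hpol, add_comm (r * e θ) z]
    simp only [hP, hQ]
    rw [clm_apply_eq_holPart_add_antiPart _ (e θ),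
      clm_apply_eq_holPart_add_antiPart _ (Complex.I * e θ)]
    simp only [map_mul, Complex.conj_I, Complex.real_smul]
    have hce : (starRingEnd ℂ) (e θ) = (e θ)⁻¹ := eq_inv_of_mul_eq_one_left (hconj θ)
    rw [hce]
    field_simp
    ring_nf
    simp only [Complex.I_sq]
    ring
  rw [setIntegral_congr_fun (measurableSet_Ioi.prod measurableSet_Ioo) hcongr,
    integral_const_mul]
  have : ∫ p in Ioi (0 : ℝ) ×ˢ Ioo (-Real.pi) Real.pi, (P p.1 p.2 + Q p.1 p.2) =
    -(2 * Real.pi * u z) + 0 := by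
    rw [← hPint, ← hQint]
    exact integral_add hPi hQi
  rw [this]; ring

/-! ### The slice transform and its differentiability -/

/-- A set `Ω` fibred over `V ⊂ ℂ` by the coordinate `π`, with `ι` the inclusion of the coordinate
axis: with every point, `Ω` contains the whole slice `V` in the direction of that coordinate. The
cases of interest are a product domain with one of its coordinates, and `Ω = V` with `π = ι = id`.
-/
structure IsSlicing {E : Type*} [NormedAddCommGroup E] [NormedSpace ℝ E] (π : E →L[ℝ] ℂ)
    (ι : ℂ →L[ℝ] E) (V : Set ℂ) (Ω : Set E) : Prop where
  proj_incl : ∀ c, π (ι c) = c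
  isOpen_base : IsOpen V
  isBounded_base : Bornology.IsBounded V
  isOpen_total : IsOpen Ω
  proj_mem : ∀ z ∈ Ω, π z ∈ V
  slice_mem : ∀ z ∈ Ω, ∀ ζ ∈ V, z + ι (ζ - π z) ∈ Ω

/-- `g` is of class `C^1` on `Ω`, and `g` and its derivative are bounded by `M` there. -/
structure IsBddC1On {E : Type*} [NormedAddCommGroup E] [NormedSpace ℝ E] (M : ℝ) (g : E → ℂ)
    (Ω : Set E) : Prop where
  contDiffOn : ContDiffOn ℝ 1 g Ω
  norm_le : ∀ z ∈ Ω, ‖g z‖ ≤ M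
  norm_fderiv_le : ∀ z ∈ Ω, ‖fderiv ℝ g z‖ ≤ M

/-- The Cauchy transform in the slice direction, `z ↦ ∫_V g(z + ι(ζ - π z)) / (π z - ζ)`. -/
def sliceTransform {E : Type*} [NormedAddCommGroup E] [NormedSpace ℝ E] (π : E →L[ℝ] ℂ)
    (ι : ℂ →L[ℝ] E) (V : Set ℂ) (g : E → ℂ) (z : E) : ℂ :=
  ∫ ζ in V, g (z + ι (ζ - π z)) / (π z - ζ)

theorem aestronglyMeasurable_div {μ : Measure ℂ} {q k : ℂ → ℂ} (hq : AEStronglyMeasurable q μ)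
    (hk : Measurable k) : AEStronglyMeasurable (fun ζ => q ζ / k ζ) μ := by
  simp only [div_eq_mul_inv]
  exact hq.mul hk.inv.aestronglyMeasurable

theorem integrableOn_div_sub {V : Set ℂ} (hV : MeasurableSet V) (hb : Bornology.IsBounded V)
    {q : ℂ → ℂ} {M : ℝ} (hq : AEStronglyMeasurable q (volume.restrict V))
    (hM : ∀ ζ ∈ V, ‖q ζ‖ ≤ M) (z : ℂ) : IntegrableOn (fun ζ => q ζ / (z - ζ)) V := by
  obtain ⟨C, -, hC⟩ := exists_setIntegral_norm_sub_inv_le hb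
  refine ((hC z).1.const_mul M).mono' (aestronglyMeasurable_div hq (by fun_prop)) ?_
  filter_upwards [ae_restrict_mem hV] with ζ hζ
  rw [norm_div, div_eq_mul_inv]
  exact mul_le_mul_of_nonneg_right (hM ζ hζ) (by positivity)

section
variable {E : Type*} [NormedAddCommGroup E] [NormedSpace ℝ E] {π : E →L[ℝ] ℂ}
  {ι : ℂ →L[ℝ] E} {V : Set ℂ} {Ω : Set E}

theorem IsSlicing.continuousOn_slice (h : IsSlicing π ι V Ω) {F : Type*} [TopologicalSpace F]
    {g : E → F} (hg : ContinuousOn g Ω) {z : E} (hz : z ∈ Ω) :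
    ContinuousOn (fun ζ => g (z + ι (ζ - π z))) V :=
  hg.comp (by fun_prop) fun ζ hζ => h.slice_mem z hz ζ hζ

theorem IsSlicing.aestronglyMeasurable_slice (h : IsSlicing π ι V Ω) {F : Type*}
    [TopologicalSpace F] [TopologicalSpace.PseudoMetrizableSpace F] {g : E → F}
    (hg : ContinuousOn g Ω) {z : E} (hz : z ∈ Ω) :
    AEStronglyMeasurable (fun ζ => g (z + ι (ζ - π z))) (volume.restrict V) :=
  (h.continuousOn_slice hg hz).aestronglyMeasurable h.isOpen_base.measurableSet

theorem IsSlicing.integrableOn (h : IsSlicing π ι V Ω) {g : E → ℂ} {M : ℝ}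
    (hg : ContinuousOn g Ω) (hM : ∀ z ∈ Ω, ‖g z‖ ≤ M) {z : E} (hz : z ∈ Ω) (w : ℂ) :
    IntegrableOn (fun ζ => g (z + ι (ζ - π z)) / (w - ζ)) V :=
  integrableOn_div_sub h.isOpen_base.measurableSet h.isBounded_base
    (h.aestronglyMeasurable_slice hg hz) (fun ζ hζ => hM _ (h.slice_mem z hz ζ hζ)) w

/-- A cutoff in the slice coordinate extends `g` by zero to whole lines in the slice direction. -/
theorem IsSlicing.contDiffAt_cutoff_mul (h : IsSlicing π ι V Ω) {g : E → ℂ}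
    (hg : ContDiffOn ℝ 1 g Ω) {η : ℂ → ℂ} (hη : ContDiff ℝ 1 η) (hηV : tsupport η ⊆ V)
    {z : E} (hz : z ∈ Ω) (c : ℂ) : ContDiffAt ℝ 1 (fun z => η (π z) * g z) (z + ι c) := by
  by_cases hc : π z + c ∈ V
  · have hmem : z + ι c ∈ Ω := by simpa using h.slice_mem z hz _ hc
    exact (hη.comp π.contDiff).contDiffAt.mul (hg.contDiffAt (h.isOpen_total.mem_nhds hmem))
  · have hn : π (z + ι c) ∉ tsupport η := fun hh => hc (by
      have := hηV hh
      rwa [map_add, h.proj_incl] at this)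
    have h0 : (fun z => η (π z) * g z) =ᶠ[nhds (z + ι c)] fun _ => 0 := by
      have : ∀ᶠ w in nhds (z + ι c), π w ∉ tsupport η :=
        π.continuous.continuousAt.eventually ((isClosed_tsupport η).isOpen_compl.mem_nhds hn)
      filter_upwards [this] with w hw
      rw [image_eq_zero_of_notMem_tsupport hw, zero_mul]
    exact contDiffAt_const.congr_of_eventuallyEq h0

theorem fderiv_cutoff_mul_of_notMem {g : E → ℂ} {η : ℂ → ℂ} {w : E} (hn : π w ∉ tsupport η) :
    fderiv ℝ (fun z => η (π z) * g z) w = 0 := by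
  have h0 : (fun z => η (π z) * g z) =ᶠ[nhds w] fun _ => 0 := by
    have : ∀ᶠ w in nhds w, π w ∉ tsupport η :=
      π.continuous.continuousAt.eventually ((isClosed_tsupport η).isOpen_compl.mem_nhds hn)
    filter_upwards [this] with w hw
    rw [image_eq_zero_of_notMem_tsupport hw, zero_mul]
  rw [h0.fderiv_eq]; simp

theorem IsBddC1On.hasFDerivAt {M : ℝ} {g : E → ℂ} (hg : IsBddC1On M g Ω) (hΩ : IsOpen Ω) {z : E}
    (hz : z ∈ Ω) : HasFDerivAt g (fderiv ℝ g z) z :=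
  ((hg.contDiffOn.contDiffAt (hΩ.mem_nhds hz)).differentiableAt one_ne_zero).hasFDerivAt

theorem hasFDerivAt_cutoff_mul {g : E → ℂ} {η : ℂ → ℂ} {z : E} (hη : DifferentiableAt ℝ η (π z))
    (hg : DifferentiableAt ℝ g z) : HasFDerivAt (fun z => η (π z) * g z)
      (η (π z) • fderiv ℝ g z + g z • (fderiv ℝ η (π z)).comp π) z :=
  (hη.hasFDerivAt.comp z π.hasFDerivAt).mul hg.hasFDerivAt

/-- The part of the slice transform near the singularity is a convolution with the integrable
kernel `1 / ξ`, so it may be differentiated under the integral, the derivative falling on the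
density. -/
theorem IsSlicing.hasFDerivAt_near (h : IsSlicing π ι V Ω) {g : E → ℂ} {M : ℝ}
    (hg : IsBddC1On M g Ω) {η : ℂ → ℂ} (hη : ContDiff ℝ 1 η) (hηV : tsupport η ⊆ V)
    (hηc : HasCompactSupport η) {z₀ : E} (hz₀ : z₀ ∈ Ω) :
    ∃ L : E →L[ℝ] ℂ,
      HasFDerivAt (fun z => ∫ ζ in V, η ζ * g (z + ι (ζ - π z)) / (π z - ζ)) L z₀ ∧
      ∀ v, L v = ∫ ζ in V, fderiv ℝ (fun z => η (π z) * g z) (z₀ + ι (ζ - π z₀)) v /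
        (π z₀ - ζ) := by
  set F : E → ℂ := fun z => η (π z) * g z with hF
  obtain ⟨B₀, hB₀⟩ := hηc.exists_bound_of_continuous hη.continuous
  obtain ⟨B₁, hB₁⟩ := (hηc.fderiv ℝ).exists_bound_of_continuous (hη.continuous_fderiv one_ne_zero)
  have hM : 0 ≤ M := (norm_nonneg _).trans (hg.norm_le z₀ hz₀)
  have hB₀0 : 0 ≤ B₀ := (norm_nonneg _).trans (hB₀ 0)
  have hB₁0 : 0 ≤ B₁ := (norm_nonneg _).trans (hB₁ 0)
  obtain ⟨R, hR0, hR⟩ := h.isBounded_base.subset_ball_lt 0 0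
  set K : ℝ := B₀ * M + M * (B₁ * ‖π‖) with hK
  have hK0 : 0 ≤ K := by positivity
  have hzero : ∀ z ∈ Ω, ∀ ξ, 2 * R ≤ ‖ξ‖ → π (z - ι ξ) ∉ tsupport η := by
    intro z hz ξ hξ hmem
    have h1 := hR (hηV hmem)
    have h2 := hR (h.proj_mem z hz)
    rw [map_sub, h.proj_incl] at h1
    rw [mem_ball_zero_iff] at h1 h2
    have : ‖ξ‖ ≤ ‖π z‖ + ‖π z - ξ‖ := by
      simpa using norm_sub_le (π z) (π z - ξ)
    linarith
  have hsub : ∀ z ξ, z - ι ξ = z + ι (-ξ) := fun z ξ => by rw [map_neg, sub_eq_add_neg]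
  have hcd : ∀ z ∈ Ω, ∀ ξ, ContDiffAt ℝ 1 F (z - ι ξ) := fun z hz ξ => by
    rw [hsub]; exact h.contDiffAt_cutoff_mul hg.contDiffOn hη hηV hz _
  have hfd : ∀ z ∈ Ω, ∀ ξ, ‖fderiv ℝ F (z - ι ξ)‖ ≤ K := by
    intro z hz ξ
    by_cases hs : π (z - ι ξ) ∈ tsupport η
    · have hmem : z - ι ξ ∈ Ω := by
        have h1 := h.slice_mem z hz _ (hηV hs)
        rw [map_sub π, h.proj_incl, sub_sub_cancel_left, map_neg, ← sub_eq_add_neg] at h1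
        exact h1
      rw [(hasFDerivAt_cutoff_mul (hη.differentiable one_ne_zero _)
        (hg.hasFDerivAt h.isOpen_total hmem).differentiableAt).fderiv]
      refine (norm_add_le _ _).trans ?_
      rw [norm_smul, norm_smul]
      exact add_le_add (mul_le_mul (hB₀ _) (hg.norm_fderiv_le _ hmem) (norm_nonneg _) hB₀0)
        (mul_le_mul (hg.norm_le _ hmem) ((ContinuousLinearMap.opNorm_comp_le _ _).trans
          (mul_le_mul_of_nonneg_right (hB₁ _) (norm_nonneg _))) (norm_nonneg _) hM)
    · rw [fderiv_cutoff_mul_of_notMem hs]; simpa using hK0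
  have hcont : ∀ z ∈ Ω, Continuous fun ξ => F (z - ι ξ) := fun z hz =>
    continuous_iff_continuousAt.2 fun ξ =>
      (hcd z hz ξ).continuousAt.comp (f := fun ξ => z - ι ξ) (by fun_prop)
  have hcont' : ∀ z ∈ Ω, Continuous fun ξ => fderiv ℝ F (z - ι ξ) := fun z hz =>
    continuous_iff_continuousAt.2 fun ξ =>
      ((hcd z hz ξ).fderiv_right (m := 0) (by norm_num)).continuousAt.comp
        (f := fun ξ => z - ι ξ) (by fun_prop)
  set F' : E → ℂ → E →L[ℝ] ℂ := fun z ξ => ξ⁻¹ • fderiv ℝ F (z - ι ξ) with hF'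
  have hbound : ∀ z ∈ Ω, ∀ ξ, ‖F' z ξ‖ ≤
      (ball (0 : ℂ) (2 * R)).indicator (fun ξ => K * ‖(0 : ℂ) - ξ‖⁻¹) ξ := by
    intro z hz ξ
    by_cases hξ : ξ ∈ ball (0 : ℂ) (2 * R)
    · rw [indicator_of_mem hξ, zero_sub, norm_neg, hF', norm_smul, norm_inv, mul_comm]
      gcongr
      exact hfd z hz ξ
    · rw [indicator_of_notMem hξ]
      simp only [hF', hF]
      rw [norm_smul, fderiv_cutoff_mul_of_notMem (hzero z hz ξ (by simpa using hξ)), norm_zero,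
        mul_zero]
  have hF'm : AEStronglyMeasurable (F' z₀) volume :=
    measurable_inv.aestronglyMeasurable.smul (hcont' z₀ hz₀).aestronglyMeasurable
  have hKint : Integrable ((ball (0 : ℂ) (2 * R)).indicator fun ξ => K * ‖(0 : ℂ) - ξ‖⁻¹) :=
    (integrable_indicator_iff measurableSet_ball).2
      ((integrableOn_ball_norm_sub_inv 0 (2 * R)).const_mul K)
  have hkey := hasFDerivAt_integral_of_dominated_of_fderiv_le (μ := (volume : Measure ℂ))
    (F := fun z ξ => F (z - ι ξ) / ξ) (F' := F') (x₀ := z₀)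
    (bound := (ball (0 : ℂ) (2 * R)).indicator fun ξ => K * ‖(0 : ℂ) - ξ‖⁻¹)
    (h.isOpen_total.mem_nhds hz₀) ?_ ?_ hF'm
    (Filter.Eventually.of_forall fun ξ z hz => hbound z hz ξ) hKint ?_
  rotate_left
  · filter_upwards [h.isOpen_total.mem_nhds hz₀] with z hz
    exact aestronglyMeasurable_div (hcont z hz).aestronglyMeasurable measurable_id
  · obtain ⟨B, hB⟩ : ∃ B, ∀ ξ, ‖F (z₀ - ι ξ)‖ ≤ B := by
      refine HasCompactSupport.exists_bound_of_continuous ?_ (hcont z₀ hz₀)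
      refine HasCompactSupport.intro (isCompact_closedBall (0 : ℂ) (2 * R)) fun ξ hξ => ?_
      rw [hF]
      simp only
      rw [image_eq_zero_of_notMem_tsupport (hzero z₀ hz₀ ξ (by
        rw [mem_closedBall_zero_iff, not_le] at hξ; exact hξ.le)), zero_mul]
    have hi : Integrable ((ball (0 : ℂ) (2 * R)).indicator fun ξ => B * ‖(0 : ℂ) - ξ‖⁻¹) :=
      (integrable_indicator_iff measurableSet_ball).2
        ((integrableOn_ball_norm_sub_inv 0 (2 * R)).const_mul B)
    refine hi.mono' (aestronglyMeasurable_div (hcont z₀ hz₀).aestronglyMeasurable measurable_id)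
      (Filter.Eventually.of_forall fun ξ => ?_)
    by_cases hξ : ξ ∈ ball (0 : ℂ) (2 * R)
    · rw [indicator_of_mem hξ, norm_div, zero_sub, norm_neg, div_eq_mul_inv]
      gcongr
      exact hB ξ
    · rw [indicator_of_notMem hξ, hF]
      simp only
      rw [image_eq_zero_of_notMem_tsupport (hzero z₀ hz₀ ξ (by simpa using hξ))]
      simp
  · refine Filter.Eventually.of_forall fun ξ z hz => ?_
    have h1 := ((hcd z hz ξ).differentiableAt one_ne_zero).hasFDerivAt
    have h2 : HasFDerivAt (fun z => F (z - ι ξ)) (fderiv ℝ F (z - ι ξ)) z := by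
      exact h1.comp z ((hasFDerivAt_id z).sub_const (ι ξ))
    simpa [hF', div_eq_mul_inv] using h2.mul_const ξ⁻¹
  -- undo the substitution `ξ = π z - ζ`, which made the kernel independent of `z`
  have hslice : ∀ (z : E) (ζ : ℂ), z - ι (π z - ζ) = z + ι (ζ - π z) := fun z ζ => by
    rw [hsub, neg_sub]
  refine ⟨_, hkey.congr_of_eventuallyEq ?_, fun v => ?_⟩
  · filter_upwards [h.isOpen_total.mem_nhds hz₀] with z hz
    rw [← integral_sub_left_eq_self _ volume (π z)]
    simp only [hslice]
    refine Eq.trans ?_ (setIntegral_eq_integral_of_forall_compl_eq_zero (s := V) ?_)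
    · refine setIntegral_congr_fun h.isOpen_base.measurableSet fun ζ hζ => ?_
      simp [hF, h.proj_incl]
    · intro ζ hζ
      rw [hF]
      simp only
      rw [map_add, h.proj_incl, add_sub_cancel,
        image_eq_zero_of_notMem_tsupport fun hh => hζ (hηV hh)]
      simp
  · have hint : Integrable (F' z₀) :=
      hKint.mono' hF'm (Filter.Eventually.of_forall fun ξ => hbound z₀ hz₀ ξ)
    rw [ContinuousLinearMap.integral_apply hint, ← integral_sub_left_eq_self _ volume (π z₀)]
    simp only [hF', hslice]
    refine (setIntegral_eq_integral_of_forall_compl_eq_zero (s := V) ?_).symm.trans ?_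
    rotate_left
    · refine setIntegral_congr_fun h.isOpen_base.measurableSet fun ζ hζ => ?_
      simp [div_eq_inv_mul]
    · intro ζ hζ
      rw [fderiv_cutoff_mul_of_notMem]
      · simp
      · rw [map_add, h.proj_incl, add_sub_cancel]
        exact fun hh => hζ (hηV hh)
end

section
variable {E : Type*} [NormedAddCommGroup E] [NormedSpace ℝ E] {π : E →L[ℝ] ℂ}
  {ι : ℂ →L[ℝ] E} {V : Set ℂ} {Ω : Set E}

/-- Away from the singularity the derivative of the slice transform falls on the kernel as far as
the slice coordinate is concerned, and on the density for the other coordinates. -/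
theorem IsSlicing.hasFDerivAt_far (h : IsSlicing π ι V Ω) {g : E → ℂ} {M : ℝ}
    (hg : IsBddC1On M g Ω) {η : ℂ → ℂ} (hη : ContDiff ℝ 1 η) (hηc : HasCompactSupport η)
    {z₀ : E} (hz₀ : z₀ ∈ Ω) (hη1 : ∀ᶠ ζ in nhds (π z₀), η ζ = 1) :
    ∃ L : E →L[ℝ] ℂ,
      HasFDerivAt (fun z => ∫ ζ in V, (1 - η ζ) * (g (z + ι (ζ - π z)) / (π z - ζ))) L z₀ ∧
      ∀ v, L v = ∫ ζ in V, (1 - η ζ) * (fderiv ℝ g (z₀ + ι (ζ - π z₀)) (v - ι (π v)) /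
        (π z₀ - ζ) - g (z₀ + ι (ζ - π z₀)) * π v / (π z₀ - ζ) ^ 2) := by
  obtain ⟨B₀, hB₀⟩ := hηc.exists_bound_of_continuous hη.continuous
  have hM : 0 ≤ M := (norm_nonneg _).trans (hg.norm_le z₀ hz₀)
  have hB₀0 : 0 ≤ B₀ := (norm_nonneg _).trans (hB₀ 0)
  obtain ⟨δ, hδ, hδη⟩ := Metric.eventually_nhds_iff_ball.1 hη1
  have hVm := h.isOpen_base.measurableSet
  set δ' : ℝ := δ / 2 with hδ'
  have hδ'0 : 0 < δ' := by positivity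
  set s : Set E := Ω ∩ π ⁻¹' ball (π z₀) δ' with hs
  have hs_nhds : s ∈ nhds z₀ :=
    Filter.inter_mem (h.isOpen_total.mem_nhds hz₀)
      (π.continuous.continuousAt.preimage_mem_nhds (ball_mem_nhds _ hδ'0))
  have hfar : ∀ z ∈ s, ∀ ζ, ζ ∉ ball (π z₀) δ → δ' ≤ ‖π z - ζ‖ := by
    intro z hz ζ hζ
    have h1 : ‖π z - π z₀‖ < δ' := by simpa [dist_eq_norm] using hz.2
    have h2 : δ ≤ ‖ζ - π z₀‖ := by simpa [dist_eq_norm] using hζ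
    have h3 : ‖ζ - π z₀‖ ≤ ‖π z - ζ‖ + ‖π z - π z₀‖ := by
      rw [← norm_neg (π z - ζ)]
      refine le_trans (le_of_eq ?_) (norm_add_le _ _)
      congr 1; ring
    have : δ = δ' + δ' := by rw [hδ']; ring
    linarith
  -- the slice point `z + ι (ζ - π z)` depends on `z` through `P z` only
  set P : E →L[ℝ] E := ContinuousLinearMap.id ℝ E - ι.comp π with hP
  set G' : E → ℂ → E →L[ℝ] ℂ := fun z ζ => (1 - η ζ) •
    ((π z - ζ)⁻¹ • (fderiv ℝ g (z + ι (ζ - π z))).comp P -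
      (g (z + ι (ζ - π z)) / (π z - ζ) ^ 2) • π) with hG'
  set K : ℝ := (1 + B₀) * (δ'⁻¹ * (M * ‖P‖) + M / δ' ^ 2 * ‖π‖) with hK
  have hK0 : 0 ≤ K := by positivity
  have hG'0 : ∀ z, ∀ ζ ∈ ball (π z₀) δ, G' z ζ = 0 := fun z ζ hζ => by
    ext v
    simp [hG', hδη ζ hζ]
  have hbd : ∀ z ∈ s, ∀ ζ ∈ V, ‖G' z ζ‖ ≤ K := by
    intro z hz ζ hζ
    by_cases hζδ : ζ ∈ ball (π z₀) δ
    · rw [hG'0 z ζ hζδ, norm_zero]; exact hK0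
    · have hd := hfar z hz ζ hζδ
      have hm := h.slice_mem z hz.1 ζ hζ
      simp only [hG']
      rw [norm_smul]
      refine mul_le_mul ?_ ?_ (norm_nonneg _) (by positivity)
      · refine (norm_sub_le _ _).trans ?_
        rw [norm_one]; linarith [hB₀ ζ]
      refine (norm_sub_le _ _).trans ?_
      rw [norm_smul, norm_smul, norm_inv, norm_div, norm_pow]
      refine add_le_add (mul_le_mul (inv_anti₀ hδ'0 hd) ?_ (norm_nonneg _) (by positivity)) ?_
      · exact (ContinuousLinearMap.opNorm_comp_le _ _).trans
          (mul_le_mul_of_nonneg_right (hg.norm_fderiv_le _ hm) (norm_nonneg _))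
      · refine mul_le_mul_of_nonneg_right ?_ (norm_nonneg _)
        exact div_le_div₀ hM (hg.norm_le _ hm) (by positivity)
          (pow_le_pow_left₀ hδ'0.le hd 2)
  have hgc : ContinuousOn g Ω := hg.contDiffOn.continuousOn
  have hg'c : ContinuousOn (fderiv ℝ g) Ω :=
    hg.contDiffOn.continuousOn_fderiv_of_isOpen h.isOpen_total le_rfl
  have hηm : AEStronglyMeasurable (fun ζ => 1 - η ζ) (volume.restrict V) :=
    (continuous_const.sub hη.continuous).aestronglyMeasurable
  have hG'm : AEStronglyMeasurable (G' z₀) (volume.restrict V) := by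
    have hk : Measurable fun ζ : ℂ => (π z₀ - ζ)⁻¹ := (measurable_const.sub measurable_id).inv
    have h1 : AEStronglyMeasurable (fun ζ => (fderiv ℝ g (z₀ + ι (ζ - π z₀))).comp P)
        (volume.restrict V) :=
      h.aestronglyMeasurable_slice (g := fun z => (fderiv ℝ g z).comp P)
        (hg'c.clm_comp continuousOn_const) hz₀
    have h2 : AEStronglyMeasurable (fun ζ => g (z₀ + ι (ζ - π z₀)) / (π z₀ - ζ) ^ 2)
        (volume.restrict V) :=
      aestronglyMeasurable_div (h.aestronglyMeasurable_slice hgc hz₀) (by fun_prop)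
    exact hηm.smul ((hk.aestronglyMeasurable.smul h1).sub (h2.smul aestronglyMeasurable_const))
  have hKint : Integrable (fun _ : ℂ => K) (volume.restrict V) :=
    integrableOn_const h.isBounded_base.measure_lt_top.ne
  have hkey := hasFDerivAt_integral_of_dominated_of_fderiv_le (μ := volume.restrict V)
    (F := fun z ζ => (1 - η ζ) * (g (z + ι (ζ - π z)) / (π z - ζ))) (F' := G') (x₀ := z₀)
    (bound := fun _ => K) hs_nhds ?_ ?_ hG'm ?_ hKint ?_
  rotate_left
  · filter_upwards [h.isOpen_total.mem_nhds hz₀] with z hz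
    exact hηm.mul (aestronglyMeasurable_div (h.aestronglyMeasurable_slice hgc hz) (by fun_prop))
  · refine (h.integrableOn hgc hg.norm_le hz₀ (π z₀)).bdd_mul (c := 1 + B₀) hηm
      (Filter.Eventually.of_forall fun ζ => ?_)
    refine (norm_sub_le _ _).trans ?_
    rw [norm_one]; linarith [hB₀ ζ]
  · filter_upwards [ae_restrict_mem hVm] with ζ hζ z hz
    exact hbd z hz ζ hζ
  · filter_upwards [ae_restrict_mem hVm] with ζ hζ z hz
    by_cases hζδ : ζ ∈ ball (π z₀) δ
    · rw [hG'0 z ζ hζδ, hδη ζ hζδ]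
      simpa using hasFDerivAt_const (0 : ℂ) z
    · have hd := hfar z hz ζ hζδ
      have hm := h.slice_mem z hz.1 ζ hζ
      have hne : π z - ζ ≠ 0 := norm_pos_iff.1 (hδ'0.trans_le hd)
      have h1 : HasFDerivAt (fun z => z + ι (ζ - π z)) P z := by
        have := (hasFDerivAt_id (𝕜 := ℝ) z).add
          (ι.hasFDerivAt.comp z (π.hasFDerivAt.const_sub ζ))
        refine this.congr_fderiv ?_
        ext v; simp [hP, sub_eq_add_neg]
      have h2 : HasFDerivAt (fun z => g (z + ι (ζ - π z)))
          ((fderiv ℝ g (z + ι (ζ - π z))).comp P) z :=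
        HasFDerivAt.comp (f := fun z => z + ι (ζ - π z)) z (hg.hasFDerivAt h.isOpen_total hm) h1
      have h3 : HasFDerivAt (fun z => (π z - ζ)⁻¹) (-((π z - ζ) ^ 2)⁻¹ • π) z := by
        have h4 : HasDerivAt (fun w : ℂ => (w - ζ)⁻¹) (-((π z - ζ) ^ 2)⁻¹) (π z) := by
          have := (((hasDerivAt_id (π z)).sub_const ζ).inv hne)
          refine this.congr_deriv ?_
          simp [div_eq_mul_inv]
        exact h4.comp_hasFDerivAt_of_eq z π.hasFDerivAt rfl |>.congr_fderiv rfl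
      have h5 := (h2.mul h3).const_mul (1 - η ζ)
      refine (h5.congr_fderiv ?_).congr_of_eventuallyEq
        (Filter.Eventually.of_forall fun w => by simp [div_eq_mul_inv])
      simp only [hG']
      ext v
      simp
      ring_nf
  refine ⟨_, hkey, fun v => ?_⟩
  have hint : Integrable (G' z₀) (volume.restrict V) := by
    refine hKint.mono' hG'm ?_
    filter_upwards [ae_restrict_mem hVm] with ζ hζ
    exact hbd z₀ (mem_of_mem_nhds hs_nhds) ζ hζ
  rw [ContinuousLinearMap.integral_apply hint]
  refine setIntegral_congr_fun hVm fun ζ _ => ?_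
  simp [hG', hP]
  left; ring

/-- The derivative of the slice transform, by splitting the density with a cutoff `η` into a part
near the singularity and a part away from it. -/
theorem IsSlicing.hasFDerivAt (h : IsSlicing π ι V Ω) {g : E → ℂ} {M : ℝ}
    (hg : IsBddC1On M g Ω) {η : ℂ → ℂ} (hη : ContDiff ℝ 1 η) (hηV : tsupport η ⊆ V)
    (hηc : HasCompactSupport η) {z₀ : E} (hz₀ : z₀ ∈ Ω)
    (hη1 : ∀ᶠ ζ in nhds (π z₀), η ζ = 1) :
    ∃ L : E →L[ℝ] ℂ, HasFDerivAt (sliceTransform π ι V g) L z₀ ∧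
      ∀ v, L v = (∫ ζ in V, fderiv ℝ (fun z => η (π z) * g z) (z₀ + ι (ζ - π z₀)) v /
        (π z₀ - ζ)) + ∫ ζ in V, (1 - η ζ) * (fderiv ℝ g (z₀ + ι (ζ - π z₀)) (v - ι (π v)) /
        (π z₀ - ζ) - g (z₀ + ι (ζ - π z₀)) * π v / (π z₀ - ζ) ^ 2) := by
  obtain ⟨L₁, hL₁, hL₁v⟩ := h.hasFDerivAt_near hg hη hηV hηc hz₀
  obtain ⟨L₂, hL₂, hL₂v⟩ := h.hasFDerivAt_far hg hη hηc hz₀ hη1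
  refine ⟨L₁ + L₂, (hL₁.add hL₂).congr_of_eventuallyEq ?_, fun v => by
    rw [add_apply, hL₁v, hL₂v]⟩
  obtain ⟨B₀, hB₀⟩ := hηc.exists_bound_of_continuous hη.continuous
  filter_upwards [h.isOpen_total.mem_nhds hz₀] with z hz
  have hi := h.integrableOn hg.contDiffOn.continuousOn hg.norm_le hz (π z)
  have h1 : IntegrableOn (fun ζ => η ζ * g (z + ι (ζ - π z)) / (π z - ζ)) V := by
    simp only [mul_div_assoc]
    exact hi.bdd_mul (c := B₀) hη.continuous.aestronglyMeasurable
      (Filter.Eventually.of_forall fun ζ => hB₀ ζ)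
  have h2 : IntegrableOn (fun ζ => (1 - η ζ) * (g (z + ι (ζ - π z)) / (π z - ζ))) V := by
    have := hi.sub h1
    refine this.congr (Filter.Eventually.of_forall fun ζ => ?_)
    simp only [Pi.sub_apply]; ring
  simp only [Pi.add_apply]
  rw [← integral_add h1 h2, sliceTransform]
  refine integral_congr_ae (Filter.Eventually.of_forall fun ζ => ?_)
  simp only; ring
end

/-! ### First derivatives of the slice transform -/

/-- A function `b` is *tangential* on `V` if the field `∂ + b ∂̄` is tangent to the boundary of
`V` in the weak sense: the divergence theorem for it, `∫_V ∂u + ∂̄(bu) = 0`, has no boundary term.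
-/
def IsTangentialOn (b : ℂ → ℂ) (V : Set ℂ) : Prop :=
  ∀ (M : ℝ) (u : ℂ → ℂ), IsBddC1On M u V →
    ∫ ζ in V, (holPart (fderiv ℝ u ζ) + antiPart (fderiv ℝ (fun ζ => b ζ * u ζ) ζ)) = 0

theorem holPart_sub (A B : ℂ →L[ℝ] ℂ) : holPart (A - B) = holPart A - holPart B := by
  simp [holPart]; ring

theorem antiPart_sub (A B : ℂ →L[ℝ] ℂ) : antiPart (A - B) = antiPart A - antiPart B := by
  simp [antiPart]; ring

theorem continuous_holPart : Continuous holPart := by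
  unfold holPart; fun_prop

theorem continuous_antiPart : Continuous antiPart := by
  unfold antiPart; fun_prop

theorem isSlicing_id {V : Set ℂ} (hV : IsOpen V) (hb : Bornology.IsBounded V) :
    IsSlicing (ContinuousLinearMap.id ℝ ℂ) (ContinuousLinearMap.id ℝ ℂ) V V where
  proj_incl c := rfl
  isOpen_base := hV
  isBounded_base := hb
  isOpen_total := hV
  proj_mem z hz := hz
  slice_mem z _ ζ hζ := by simpa using hζ

theorem IsBddC1On.smooth_mul {V : Set ℂ} (hV : IsOpen V) (hb : Bornology.IsBounded V) {q h : ℂ → ℂ}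
    (hq : ContDiff ℝ 1 q) {M : ℝ} (hh : IsBddC1On M h V) :
    ∃ M', IsBddC1On M' (fun ζ => q ζ * h ζ) V := by
  rcases V.eq_empty_or_nonempty with rfl | ⟨w, hw⟩
  · exact ⟨0, by simp [contDiffOn_empty], by simp, by simp⟩
  have hM : 0 ≤ M := (norm_nonneg _).trans (hh.norm_le w hw)
  have hcpt : IsCompact (closure V) := hb.isCompact_closure
  obtain ⟨B₀, hB₀⟩ := hcpt.exists_bound_of_continuousOn hq.continuous.continuousOn
  obtain ⟨B₁, hB₁⟩ := hcpt.exists_bound_of_continuousOn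
    (hq.continuous_fderiv one_ne_zero).continuousOn
  have hB₀0 : 0 ≤ B₀ := (norm_nonneg _).trans (hB₀ w (subset_closure hw))
  have hB₁0 : 0 ≤ B₁ := (norm_nonneg _).trans (hB₁ w (subset_closure hw))
  refine ⟨B₀ * M + M * B₁, hq.contDiffOn.mul hh.contDiffOn, fun z hz => ?_, fun z hz => ?_⟩
  · rw [norm_mul]
    have := mul_le_mul (hB₀ z (subset_closure hz)) (hh.norm_le z hz) (norm_nonneg _) hB₀0
    nlinarith
  · rw [(show HasFDerivAt (fun ζ => q ζ * h ζ) _ z from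
      (hq.differentiable one_ne_zero z).hasFDerivAt.mul (hh.hasFDerivAt hV hz)).fderiv]
    refine (norm_add_le _ _).trans ?_
    rw [norm_smul, norm_smul]
    exact add_le_add
      (mul_le_mul (hB₀ z (subset_closure hz)) (hh.norm_fderiv_le z hz) (norm_nonneg _) hB₀0)
      (mul_le_mul (hh.norm_le z hz) (hB₁ z (subset_closure hz)) (norm_nonneg _) hM)

/-- The Cauchy kernel is holomorphic, so only `∂` sees its derivative. -/
theorem holPart_antiPart_fderiv_mul_inv_sub {p : ℂ → ℂ} {w ζ : ℂ} (hζ : w - ζ ≠ 0)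
    (hp : DifferentiableAt ℝ p ζ) :
    holPart (fderiv ℝ (fun ζ => p ζ * (w - ζ)⁻¹) ζ) =
      holPart (fderiv ℝ p ζ) * (w - ζ)⁻¹ + p ζ * ((w - ζ) ^ 2)⁻¹ ∧
    antiPart (fderiv ℝ (fun ζ => p ζ * (w - ζ)⁻¹) ζ) =
      antiPart (fderiv ℝ p ζ) * (w - ζ)⁻¹ := by
  have h4 : HasDerivAt (fun ζ : ℂ => (w - ζ)⁻¹) (((w - ζ) ^ 2)⁻¹) ζ := by
    have := ((hasDerivAt_id ζ).const_sub w).inv hζ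
    refine this.congr_deriv ?_
    simp [div_eq_mul_inv]
  have h : HasFDerivAt (fun ζ => p ζ * (w - ζ)⁻¹) _ ζ :=
    hp.hasFDerivAt.mul (h4.hasFDerivAt.restrictScalars ℝ)
  rw [h.fderiv]
  constructor
  · simp [holPart]; ring_nf; simp; ring
  · simp [antiPart]; ring_nf; simp

theorem exists_cutoff {V : Set ℂ} (hV : IsOpen V) {w : ℂ} (hw : w ∈ V) :
    ∃ η : ℂ → ℂ, ContDiff ℝ 1 η ∧ tsupport η ⊆ V ∧ HasCompactSupport η ∧
      ∀ᶠ ζ in nhds w, η ζ = 1 := by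
  obtain ⟨r, hr, hrV⟩ := Metric.isOpen_iff.1 hV w hw
  let f : ContDiffBump w := ⟨r / 4, r / 2, by positivity, by linarith⟩
  have hts : tsupport (fun ζ => (f ζ : ℂ)) ⊆ tsupport f :=
    closure_mono fun ζ hζ => by
      simpa using hζ
  refine ⟨fun ζ => (f ζ : ℂ), Complex.ofRealCLM.contDiff.comp f.contDiff, ?_, ?_, ?_⟩
  · refine hts.trans ?_
    rw [f.tsupport_eq]
    exact (closedBall_subset_ball (by simp [f]; linarith)).trans hrV
  · exact f.hasCompactSupport.mono' (subset_tsupport _ |>.trans hts)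
  · filter_upwards [f.eventuallyEq_one] with ζ hζ
    rw [hζ]; simp

/-- The one-variable derivative formulas. Near the singularity `∂̄` is computed by the
Cauchy–Pompeiu formula; away from it the derivative of the kernel is moved to the density along
the tangential field `∂ + b ∂̄`, which also moves a multiple of `∂̄` and so picks up the term
`-π b h`. -/
theorem IsBddC1On.exists_hasFDerivAt_sliceTransform {V : Set ℂ} (hV : IsOpen V)
    (hb : Bornology.IsBounded V) {h : ℂ → ℂ} {M : ℝ} (hh : IsBddC1On M h V) {w : ℂ} (hw : w ∈ V) :
    ∃ L : ℂ →L[ℝ] ℂ,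
      HasFDerivAt (fun z => ∫ ζ in V, h ζ / (z - ζ)) L w ∧
      antiPart L = Real.pi * h w ∧
      ∀ b : ℂ → ℂ, ContDiff ℝ 1 b → IsTangentialOn b V →
        holPart L = (∫ ζ in V, (holPart (fderiv ℝ h ζ) +
          antiPart (fderiv ℝ (fun ζ => b ζ * h ζ) ζ)) / (w - ζ)) - Real.pi * b w * h w := by
  obtain ⟨η, hη, hηV, hηc, hη1⟩ := exists_cutoff hV hw
  obtain ⟨L, hL, hLv⟩ := (isSlicing_id hV hb).hasFDerivAt hh hη hηV hηc hw hη1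
  obtain ⟨δ, hδ, hδη⟩ := Metric.eventually_nhds_iff_ball.1 hη1
  have hηw : η w = 1 := hδη w (mem_ball_self hδ)
  have hVm := hV.measurableSet
  simp only [ContinuousLinearMap.coe_id', id, add_sub_cancel, sub_self, map_zero, zero_div,
    zero_sub] at hLv
  -- the kernel with its singularity removed
  set κ : ℂ → ℂ := fun ζ => (1 - η ζ) * (w - ζ)⁻¹ with hκ
  have hκd : ContDiff ℝ 1 κ := by
    refine contDiff_iff_contDiffAt.2 fun ζ => ?_
    by_cases hζ : ζ = w
    · subst hζ
      refine (contDiffAt_const (c := (0 : ℂ))).congr_of_eventuallyEq ?_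
      filter_upwards [hη1] with ξ hξ
      simp [hκ, hξ]
    · refine (contDiffAt_const.sub hη.contDiffAt).mul ?_
      exact (contDiffAt_const.sub contDiffAt_id).inv (sub_ne_zero.2 fun h => hζ h.symm)
  obtain ⟨M₁, hM₁⟩ := hh.smooth_mul hV hb hη
  obtain ⟨M₂, hM₂⟩ := hh.smooth_mul hV hb hκd
  have hηh : ContDiff ℝ 1 fun ζ => η ζ * h ζ := by
    refine contDiff_iff_contDiffAt.2 fun ζ => ?_
    by_cases hζ : ζ ∈ V
    · exact hM₁.contDiffOn.contDiffAt (hV.mem_nhds hζ)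
    · have := (isSlicing_id hV hb).contDiffAt_cutoff_mul hh.contDiffOn hη hηV hw (ζ - w)
      simpa using this
  have hηhc : HasCompactSupport fun ζ => η ζ * h ζ := hηc.mul_right
  have hcont1 : ContinuousOn (fderiv ℝ fun ζ => η ζ * h ζ) V :=
    (hηh.continuous_fderiv one_ne_zero).continuousOn
  have hcomp : ∀ {F : Type} [TopologicalSpace F] [TopologicalSpace.PseudoMetrizableSpace F]
      {q : ℂ → F}, ContinuousOn q V → AEStronglyMeasurable q (volume.restrict V) :=
    fun hq => hq.aestronglyMeasurable hVm
  have hI : ∀ (Q : (ℂ →L[ℝ] ℂ) → ℂ), Continuous Q → (∀ A, ‖Q A‖ ≤ ‖A‖) → ∀ {M : ℝ} {u : ℂ → ℂ},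
      IsBddC1On M u V → IntegrableOn (fun ζ => Q (fderiv ℝ u ζ) / (w - ζ)) V := by
    intro Q hQ hQn M u hu
    refine integrableOn_div_sub hVm hb
      (hcomp (hQ.comp_continuousOn (hu.contDiffOn.continuousOn_fderiv_of_isOpen hV le_rfl)))
      (M := M) (fun ζ hζ => (hQn _).trans (hu.norm_fderiv_le ζ hζ)) w
  have hev : ∀ c : ℂ, ‖c‖ = 1 → ∀ {M : ℝ} {u : ℂ → ℂ},
      IsBddC1On M u V → IntegrableOn (fun ζ => fderiv ℝ u ζ c / (w - ζ)) V := by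
    intro c hc M u hu
    refine hI (fun A => A c) (by fun_prop) (fun A => ?_) hu
    simpa [hc] using A.le_opNorm c
  -- the kernel is holomorphic: its derivative contributes a multiple of `c` and none of `conj c`
  set N : ℂ := ∫ ζ in V, κ ζ * h ζ * (w - ζ)⁻¹ with hN
  have hLc : ∀ c, L c = (∫ ζ in V, fderiv ℝ (fun ζ => η ζ * h ζ) ζ c / (w - ζ)) - N * c := by
    intro c
    rw [hLv c, sub_eq_add_neg, hN, ← integral_mul_const, ← integral_neg]
    congr 1
    refine integral_congr_ae (Filter.Eventually.of_forall fun ζ => ?_)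
    simp only [hκ, div_eq_mul_inv, ← inv_pow]
    ring
  have hIm : ‖Complex.I‖ = 1 := Complex.norm_I
  have hanti : antiPart L = ∫ ζ in V, antiPart (fderiv ℝ (fun ζ => η ζ * h ζ) ζ) / (w - ζ) := by
    rw [antiPart, hLc, hLc]
    have e : ∀ ζ, antiPart (fderiv ℝ (fun ζ => η ζ * h ζ) ζ) / (w - ζ) =
        (fderiv ℝ (fun ζ => η ζ * h ζ) ζ 1 / (w - ζ) +
          Complex.I * (fderiv ℝ (fun ζ => η ζ * h ζ) ζ Complex.I / (w - ζ))) / 2 := by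
      intro ζ; rw [antiPart]; ring
    simp only [e]
    rw [integral_div, integral_add (hev 1 norm_one hM₁) ((hev _ hIm hM₁).const_mul _),
      integral_const_mul]
    ring_nf
    simp only [Complex.I_sq]
    ring
  have hhol : holPart L =
      (∫ ζ in V, holPart (fderiv ℝ (fun ζ => η ζ * h ζ) ζ) / (w - ζ)) - N := by
    rw [holPart, hLc, hLc]
    have e : ∀ ζ, holPart (fderiv ℝ (fun ζ => η ζ * h ζ) ζ) / (w - ζ) =
        (fderiv ℝ (fun ζ => η ζ * h ζ) ζ 1 / (w - ζ) -
          Complex.I * (fderiv ℝ (fun ζ => η ζ * h ζ) ζ Complex.I / (w - ζ))) / 2 := by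
      intro ζ; rw [holPart]; ring
    simp only [e]
    rw [integral_div, integral_sub (hev 1 norm_one hM₁) ((hev _ hIm hM₁).const_mul _),
      integral_const_mul]
    ring_nf
    simp only [Complex.I_sq]
    ring
  have hzero : ∀ (b : ℂ → ℂ), ∀ ζ, ζ ∉ V → fderiv ℝ (fun ζ => b ζ * (η ζ * h ζ)) ζ = 0 := by
    intro b ζ hζ
    refine image_eq_zero_of_notMem_tsupport fun hmem => hζ (hηV ?_)
    have h1 := tsupport_fderiv_subset ℝ hmem
    exact closure_mono (fun ξ hξ => by
      simp only [Function.mem_support] at hξ ⊢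
      exact fun h0 => hξ (by rw [h0]; ring)) h1
  have hpompeiu : ∀ b : ℂ → ℂ, ContDiff ℝ 1 b →
      ∫ ζ in V, antiPart (fderiv ℝ (fun ζ => b ζ * (η ζ * h ζ)) ζ) / (w - ζ) =
        Real.pi * b w * h w := by
    intro b hbd
    rw [setIntegral_eq_integral_of_forall_compl_eq_zero, integral_antiPart_fderiv_div
      (hbd.mul hηh) hηhc.mul_left w, hηw]
    · ring
    · intro ζ hζ
      rw [hzero b ζ hζ]; simp [antiPart]
  refine ⟨L, ?_, ?_, fun b hbd hbt => ?_⟩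
  · refine hL.congr_of_eventuallyEq (Filter.Eventually.of_forall fun z => ?_)
    simp [sliceTransform]
  · have := hpompeiu (fun _ => 1) contDiff_const
    simp only [one_mul, mul_one] at this
    rw [hanti, this]
  · obtain ⟨M₃, hM₃⟩ := hM₁.smooth_mul hV hb hbd
    obtain ⟨M₄, hM₄⟩ := hh.smooth_mul hV hb hbd
    -- no boundary term for the density `κ h`, whose derivative contains the integrand of `N`
    have hp := hbt _ _ hM₂
    have hpt : ∀ ζ ∈ V, ζ ≠ w →
        holPart (fderiv ℝ (fun ζ => κ ζ * h ζ) ζ) +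
          antiPart (fderiv ℝ (fun ζ => b ζ * (κ ζ * h ζ)) ζ) =
        ((holPart (fderiv ℝ h ζ) + antiPart (fderiv ℝ (fun ζ => b ζ * h ζ) ζ)) / (w - ζ) -
          holPart (fderiv ℝ (fun ζ => η ζ * h ζ) ζ) / (w - ζ) -
          antiPart (fderiv ℝ (fun ζ => b ζ * (η ζ * h ζ)) ζ) / (w - ζ)) +
          κ ζ * h ζ * (w - ζ)⁻¹ := by
      intro ζ hζ hζw
      have hne : w - ζ ≠ 0 := sub_ne_zero.2 hζw.symm
      have d1 := (hh.hasFDerivAt hV hζ).differentiableAt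
      have d2 := (hM₁.hasFDerivAt hV hζ).differentiableAt
      have d3 := (hM₃.hasFDerivAt hV hζ).differentiableAt
      have d4 := (hM₄.hasFDerivAt hV hζ).differentiableAt
      have e1 : (fun ζ => κ ζ * h ζ) = fun ζ => (h ζ - η ζ * h ζ) * (w - ζ)⁻¹ := by
        funext ξ; simp only [hκ]; ring
      have e2 : (fun ζ => b ζ * (κ ζ * h ζ)) =
          fun ζ => (b ζ * h ζ - b ζ * (η ζ * h ζ)) * (w - ζ)⁻¹ := by
        funext ξ; simp only [hκ]; ring
      rw [e2, (holPart_antiPart_fderiv_mul_inv_sub hne (d4.fun_sub d3)).2, e1,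
        (holPart_antiPart_fderiv_mul_inv_sub hne (d1.fun_sub d2)).1, fderiv_fun_sub d1 d2,
        fderiv_fun_sub d4 d3,
        holPart_sub, antiPart_sub]
      simp only [hκ, div_eq_mul_inv, ← inv_pow]
      ring
    have hae : ∀ᵐ ζ ∂(volume.restrict V), ζ ≠ w :=
      ae_restrict_of_ae (by simp [ae_iff, measure_singleton])
    have i1 : IntegrableOn (fun ζ => (holPart (fderiv ℝ h ζ) +
        antiPart (fderiv ℝ (fun ζ => b ζ * h ζ) ζ)) / (w - ζ)) V := by
      simp only [add_div]
      exact (hI _ continuous_holPart norm_holPart_le hh).add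
        (hI _ continuous_antiPart norm_antiPart_le hM₄)
    have i2 := hI _ continuous_holPart norm_holPart_le hM₁
    have i3 := hI _ continuous_antiPart norm_antiPart_le hM₃
    have i4 : IntegrableOn (fun ζ => κ ζ * h ζ * (w - ζ)⁻¹) V := by
      simp only [← div_eq_mul_inv]
      exact integrableOn_div_sub hVm hb (hcomp hM₂.contDiffOn.continuousOn) hM₂.norm_le w
    have hsplit : ∀ f₁ f₂ f₃ f₄ : ℂ → ℂ, IntegrableOn f₁ V → IntegrableOn f₂ V →
        IntegrableOn f₃ V → IntegrableOn f₄ V →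
        (∫ ζ in V, f₁ ζ) - (∫ ζ in V, f₂ ζ) - (∫ ζ in V, f₃ ζ) + (∫ ζ in V, f₄ ζ) =
          ∫ ζ in V, (f₁ ζ - f₂ ζ - f₃ ζ + f₄ ζ) := by
      intro f₁ f₂ f₃ f₄ h₁ h₂ h₃ h₄
      rw [integral_add (f := fun ζ => f₁ ζ - f₂ ζ - f₃ ζ) ((h₁.sub h₂).sub h₃) h₄,
        integral_sub (f := fun ζ => f₁ ζ - f₂ ζ) (h₁.sub h₂) h₃, integral_sub h₁ h₂]
    have htot : (∫ ζ in V, (holPart (fderiv ℝ h ζ) +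
        antiPart (fderiv ℝ (fun ζ => b ζ * h ζ) ζ)) / (w - ζ)) -
        (∫ ζ in V, holPart (fderiv ℝ (fun ζ => η ζ * h ζ) ζ) / (w - ζ)) -
        (∫ ζ in V, antiPart (fderiv ℝ (fun ζ => b ζ * (η ζ * h ζ)) ζ) / (w - ζ)) + N = 0 := by
      rw [hN, hsplit _ _ _ _ i1 i2 i3 i4, ← hp]
      refine integral_congr_ae ?_
      filter_upwards [hae, ae_restrict_mem hVm] with ζ hζw hζ
      rw [hpt ζ hζ hζw]
    rw [hpompeiu b hbd] at htot
    rw [hhol]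
    linear_combination -htot

section
variable {E : Type*} [NormedAddCommGroup E] [NormedSpace ℝ E] {π : E →L[ℝ] ℂ}
  {ι : ℂ →L[ℝ] E} {V : Set ℂ} {Ω : Set E}

theorem IsSlicing.isBddC1On_slice (h : IsSlicing π ι V Ω) {g : E → ℂ} {M : ℝ}
    (hg : IsBddC1On M g Ω) {z : E} (hz : z ∈ Ω) :
    IsBddC1On (M + M * ‖ι‖) (fun ζ => g (z + ι (ζ - π z))) V ∧
      ∀ ζ ∈ V, fderiv ℝ (fun ζ => g (z + ι (ζ - π z))) ζ =
        (fderiv ℝ g (z + ι (ζ - π z))).comp ι := by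
  have hM : 0 ≤ M := (norm_nonneg _).trans (hg.norm_le z hz)
  have hd : ∀ ζ ∈ V, HasFDerivAt (fun ζ => g (z + ι (ζ - π z)))
      ((fderiv ℝ g (z + ι (ζ - π z))).comp ι) ζ := by
    intro ζ hζ
    have h1 : HasFDerivAt (fun ζ => z + ι (ζ - π z)) ι ζ :=
      (ι.hasFDerivAt.comp ζ ((hasFDerivAt_id ζ).sub_const (π z))).const_add z
    exact HasFDerivAt.comp (f := fun ζ => z + ι (ζ - π z)) ζ
      (hg.hasFDerivAt h.isOpen_total (h.slice_mem z hz ζ hζ)) h1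
  refine ⟨⟨?_, fun ζ hζ => ?_, fun ζ hζ => ?_⟩, fun ζ hζ => (hd ζ hζ).fderiv⟩
  · refine hg.contDiffOn.comp (f := fun ζ => z + ι (ζ - π z)) ?_
      fun ζ hζ => h.slice_mem z hz ζ hζ
    exact (contDiff_const.add (ι.contDiff.comp (contDiff_id.sub contDiff_const))).contDiffOn
  · have := hg.norm_le _ (h.slice_mem z hz ζ hζ)
    have h2 : 0 ≤ M * ‖ι‖ := by positivity
    linarith
  · rw [(hd ζ hζ).fderiv]
    refine (ContinuousLinearMap.opNorm_comp_le _ _).trans ?_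
    have := mul_le_mul_of_nonneg_right (hg.norm_fderiv_le _ (h.slice_mem z hz ζ hζ))
      (norm_nonneg ι)
    linarith

/-- The first derivatives of the slice transform: it commutes with differentiation in the other
directions, `∂̄` inverts it up to the factor `π`, and a tangential field expresses `∂` through the
slice transform of first derivatives. -/
theorem IsSlicing.exists_hasFDerivAt (h : IsSlicing π ι V Ω) {g : E → ℂ} {M : ℝ}
    (hg : IsBddC1On M g Ω) {z₀ : E} (hz₀ : z₀ ∈ Ω) :
    ∃ L : E →L[ℝ] ℂ, HasFDerivAt (sliceTransform π ι V g) L z₀ ∧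
      (∀ v, π v = 0 → L v = sliceTransform π ι V (fun z => fderiv ℝ g z v) z₀) ∧
      antiPart (L.comp ι) = Real.pi * g z₀ ∧
      ∀ b : ℂ → ℂ, ContDiff ℝ 1 b → IsTangentialOn b V →
        holPart (L.comp ι) = sliceTransform π ι V (fun z => holPart ((fderiv ℝ g z).comp ι) +
          antiPart ((fderiv ℝ (fun z => b (π z) * g z) z).comp ι)) z₀ -
          Real.pi * b (π z₀) * g z₀ := by
  have hV := h.isOpen_base
  have hw := h.proj_mem z₀ hz₀
  obtain ⟨η, hη, hηV, hηc, hη1⟩ := exists_cutoff hV hw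
  obtain ⟨L, hL, hLv⟩ := h.hasFDerivAt hg hη hηV hηc hz₀ hη1
  obtain ⟨hs, hsd⟩ := h.isBddC1On_slice hg hz₀
  obtain ⟨L₁, hL₁, hanti, hhol⟩ := hs.exists_hasFDerivAt_sliceTransform hV h.isBounded_base hw
  -- along a slice, the slice transform is the Cauchy transform of the restriction of `g`
  have hLι : L.comp ι = L₁ := by
    have h1 : HasFDerivAt (fun c : ℂ => z₀ + ι (c - π z₀)) ι (π z₀) :=
      (ι.hasFDerivAt.comp (π z₀) ((hasFDerivAt_id (π z₀)).sub_const (π z₀))).const_add z₀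
    have h2 : HasFDerivAt (fun c : ℂ => sliceTransform π ι V g (z₀ + ι (c - π z₀))) (L.comp ι)
        (π z₀) := by
      refine HasFDerivAt.comp (f := fun c : ℂ => z₀ + ι (c - π z₀)) (g := sliceTransform π ι V g)
        (π z₀) ?_ h1
      simpa using hL
    refine (h2.congr_of_eventuallyEq (Filter.Eventually.of_forall fun c => ?_)).unique hL₁
    simp only [sliceTransform, map_add, h.proj_incl]
    refine integral_congr_ae (Filter.Eventually.of_forall fun ζ => ?_)
    have : z₀ + ι (c - π z₀) + ι (ζ - (π z₀ + (c - π z₀))) = z₀ + ι (ζ - π z₀) := by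
      rw [add_assoc, ← map_add]; congr 2; ring
    simp only [this]
    congr 2; ring
  refine ⟨L, hL, fun v hv => ?_, ?_, fun b hb hbt => ?_⟩
  -- when `π v = 0`, neither the kernel nor the cutoff is differentiated
  · rw [hLv v, sliceTransform]
    have hg'c : ContinuousOn (fun z => fderiv ℝ g z v) Ω :=
      (hg.contDiffOn.continuousOn_fderiv_of_isOpen h.isOpen_total le_rfl).clm_apply
        continuousOn_const
    have hi := h.integrableOn hg'c (M := M * ‖v‖) (fun z hz =>
      ((fderiv ℝ g z).le_opNorm v).trans
        (mul_le_mul_of_nonneg_right (hg.norm_fderiv_le z hz) (norm_nonneg _))) hz₀ (π z₀)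
    have hηi : IntegrableOn (fun ζ => η ζ * (fderiv ℝ g (z₀ + ι (ζ - π z₀)) v / (π z₀ - ζ))) V := by
      obtain ⟨B₀, hB₀⟩ := hηc.exists_bound_of_continuous hη.continuous
      exact hi.bdd_mul (c := B₀) hη.continuous.aestronglyMeasurable
        (Filter.Eventually.of_forall fun ζ => hB₀ ζ)
    have e1 : ∫ ζ in V, fderiv ℝ (fun z => η (π z) * g z) (z₀ + ι (ζ - π z₀)) v / (π z₀ - ζ) =
        ∫ ζ in V, η ζ * (fderiv ℝ g (z₀ + ι (ζ - π z₀)) v / (π z₀ - ζ)) := by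
      refine setIntegral_congr_fun hV.measurableSet fun ζ hζ => ?_
      rw [(hasFDerivAt_cutoff_mul (hη.differentiable one_ne_zero _)
        (hg.hasFDerivAt h.isOpen_total (h.slice_mem z₀ hz₀ ζ hζ)).differentiableAt).fderiv]
      simp [hv, h.proj_incl]
      ring
    have e2 : ∫ ζ in V, (1 - η ζ) * (fderiv ℝ g (z₀ + ι (ζ - π z₀)) (v - ι (π v)) /
        (π z₀ - ζ) - g (z₀ + ι (ζ - π z₀)) * π v / (π z₀ - ζ) ^ 2) =
        (∫ ζ in V, fderiv ℝ g (z₀ + ι (ζ - π z₀)) v / (π z₀ - ζ)) -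
        ∫ ζ in V, η ζ * (fderiv ℝ g (z₀ + ι (ζ - π z₀)) v / (π z₀ - ζ)) := by
      rw [← integral_sub hi hηi]
      refine integral_congr_ae (Filter.Eventually.of_forall fun ζ => ?_)
      simp [hv]
      ring
    rw [e1, e2]; ring
  · rw [hLι, hanti]; simp
  · rw [hLι, hhol b hb hbt]
    simp only [sub_self, map_zero, add_zero]
    congr 1
    refine setIntegral_congr_fun hV.measurableSet fun ζ hζ => ?_
    simp only
    have hb' : DifferentiableAt ℝ b ζ := hb.differentiable one_ne_zero ζ
    have hg' := (hg.hasFDerivAt h.isOpen_total (h.slice_mem z₀ hz₀ ζ hζ))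
    have hs' := hs.hasFDerivAt hV hζ
    have hbs : HasFDerivAt (fun z => b (π z) * g z) _ (z₀ + ι (ζ - π z₀)) :=
      hasFDerivAt_cutoff_mul (by simpa [h.proj_incl] using hb') hg'.differentiableAt
    rw [hsd ζ hζ, hbs.fderiv, (show HasFDerivAt (fun ζ => b ζ * g (z₀ + ι (ζ - π z₀))) _ ζ from
      hb'.hasFDerivAt.mul hs').fderiv, hsd ζ hζ]
    congr 3
    ext c
    simp [h.proj_incl]
end

/-! ### Quantitative regularity of finite order -/

/-- Quantitative `C^m` regularity on `Ω`, by recursion on `m`: the function is bounded by `M`, its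
derivatives in the directions `v ∈ 𝓥` are regular of order `m - 1`, and at order `0` it is
continuous with modulus of continuity `M * d z w`. -/
def RegOn {E : Type*} [NormedAddCommGroup E] [NormedSpace ℝ E] (𝓥 : Set E) (d : E → E → ℝ)
    (Ω : Set E) : ℕ → ℝ → (E → ℂ) → Prop
  | 0, M, f => ContinuousOn f Ω ∧ (∀ z ∈ Ω, ‖f z‖ ≤ M) ∧
      ∀ z ∈ Ω, ∀ w ∈ Ω, ‖f z - f w‖ ≤ M * d z w
  | m + 1, M, f => DifferentiableOn ℝ f Ω ∧ (∀ z ∈ Ω, ‖f z‖ ≤ M) ∧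
      ∀ v ∈ 𝓥, RegOn 𝓥 d Ω m M (fun z => fderiv ℝ f z v)

/-- On `Ω`, a bounded function with bounded derivatives in the directions `𝓥` has modulus of
continuity `d`, up to the factor `Λ`. -/
def LipBound {E : Type*} [NormedAddCommGroup E] [NormedSpace ℝ E] (𝓥 : Set E) (d : E → E → ℝ)
    (Ω : Set E) (Λ : ℝ) : Prop :=
  ∀ (f : E → ℂ) (M : ℝ), DifferentiableOn ℝ f Ω → (∀ z ∈ Ω, ‖f z‖ ≤ M) →
    (∀ v ∈ 𝓥, ∀ z ∈ Ω, ‖fderiv ℝ f z v‖ ≤ M) → ∀ z ∈ Ω, ∀ w ∈ Ω, ‖f z - f w‖ ≤ Λ * M * d z w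

namespace RegOn
variable {E : Type*} [NormedAddCommGroup E] [NormedSpace ℝ E] {𝓥 : Set E} {d d' : E → E → ℝ}
  {Ω Ω' : Set E} {m : ℕ} {M M' : ℝ} {f g : E → ℂ}

theorem norm_le (h : RegOn 𝓥 d Ω m M f) : ∀ z ∈ Ω, ‖f z‖ ≤ M := by
  cases m with
  | zero => exact h.2.1
  | succ m => exact h.2.1

theorem continuousOn (h : RegOn 𝓥 d Ω m M f) : ContinuousOn f Ω := by
  cases m with
  | zero => exact h.1
  | succ m => exact h.1.continuousOn

theorem mono (hd : ∀ z w, d z w ≤ d' z w) (hd0 : ∀ z w, 0 ≤ d z w) (hM : M ≤ M') :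
    ∀ {m : ℕ} {f : E → ℂ}, RegOn 𝓥 d Ω m M f → RegOn 𝓥 d' Ω m M' f
  | 0, _, h => ⟨h.1, fun z hz => (h.2.1 z hz).trans hM, fun z hz w hw =>
      (h.2.2 z hz w hw).trans (mul_le_mul hM (hd z w) (hd0 z w)
        ((norm_nonneg _).trans ((h.2.1 z hz).trans hM)))⟩
  | _ + 1, _, h => ⟨h.1, fun z hz => (h.2.1 z hz).trans hM, fun v hv =>
      mono hd hd0 hM (h.2.2 v hv)⟩

theorem subset (hΩ : Ω' ⊆ Ω) : ∀ {m : ℕ} {f : E → ℂ}, RegOn 𝓥 d Ω m M f → RegOn 𝓥 d Ω' m M f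
  | 0, _, h => ⟨h.1.mono hΩ, fun z hz => h.2.1 z (hΩ hz), fun z hz w hw =>
      h.2.2 z (hΩ hz) w (hΩ hw)⟩
  | _ + 1, _, h => ⟨h.1.mono hΩ, fun z hz => h.2.1 z (hΩ hz), fun v hv => subset hΩ (h.2.2 v hv)⟩

theorem congr (hΩ : IsOpen Ω) : ∀ {m : ℕ} {f g : E → ℂ}, EqOn f g Ω → RegOn 𝓥 d Ω m M f →
    RegOn 𝓥 d Ω m M g
  | 0, _, _, hfg, h => ⟨h.1.congr hfg.symm, fun z hz => by rw [← hfg hz]; exact h.2.1 z hz,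
      fun z hz w hw => by rw [← hfg hz, ← hfg hw]; exact h.2.2 z hz w hw⟩
  | _ + 1, _, _, hfg, h => ⟨h.1.congr hfg.symm, fun z hz => by rw [← hfg hz]; exact h.2.1 z hz,
      fun v hv => congr hΩ (fun z hz => by
        rw [(hfg.eventuallyEq_of_mem (hΩ.mem_nhds hz)).fderiv_eq]) (h.2.2 v hv)⟩

theorem differentiableAt (hΩ : IsOpen Ω) (h : RegOn 𝓥 d Ω (m + 1) M f) {z : E} (hz : z ∈ Ω) :
    DifferentiableAt ℝ f z := h.1.differentiableAt (hΩ.mem_nhds hz)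

theorem add (hΩ : IsOpen Ω) : ∀ {m : ℕ} {f g : E → ℂ}, RegOn 𝓥 d Ω m M f → RegOn 𝓥 d Ω m M' g →
    RegOn 𝓥 d Ω m (M + M') (fun z => f z + g z)
  | 0, f, g, hf, hg => by
      refine ⟨hf.1.add hg.1, fun z hz => (norm_add_le _ _).trans
        (add_le_add (hf.2.1 z hz) (hg.2.1 z hz)), fun z hz w hw => ?_⟩
      rw [add_mul, show f z + g z - (f w + g w) = (f z - f w) + (g z - g w) by ring]
      exact (norm_add_le _ _).trans (add_le_add (hf.2.2 z hz w hw) (hg.2.2 z hz w hw))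
  | m + 1, f, g, hf, hg => by
      refine ⟨hf.1.add hg.1, fun z hz => (norm_add_le _ _).trans
        (add_le_add (hf.2.1 z hz) (hg.2.1 z hz)), fun v hv => ?_⟩
      refine congr hΩ (fun z hz => ?_) (add hΩ (hf.2.2 v hv) (hg.2.2 v hv))
      rw [fderiv_fun_add (hf.differentiableAt hΩ hz) (hg.differentiableAt hΩ hz)]
      rfl

/-- Regularity is preserved by composition with a continuous real-linear map of the target. -/
theorem clm_comp (hΩ : IsOpen Ω) (A : ℂ →L[ℝ] ℂ) {K : ℝ} (hA : ∀ c, ‖A c‖ ≤ K * ‖c‖)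
    (hK : 0 ≤ K) : ∀ {m : ℕ} {f : E → ℂ}, RegOn 𝓥 d Ω m M f →
    RegOn 𝓥 d Ω m (K * M) (fun z => A (f z))
  | 0, f, h => by
      refine ⟨A.continuous.comp_continuousOn h.1, fun z hz => (hA _).trans
        (mul_le_mul_of_nonneg_left (h.2.1 z hz) hK), fun z hz w hw => ?_⟩
      rw [← map_sub, mul_assoc]
      exact (hA _).trans (mul_le_mul_of_nonneg_left (h.2.2 z hz w hw) hK)
  | m + 1, f, h => by
      refine ⟨A.differentiable.comp_differentiableOn h.1, fun z hz => (hA _).trans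
        (mul_le_mul_of_nonneg_left (h.2.1 z hz) hK), fun v hv => ?_⟩
      refine congr hΩ (fun z hz => ?_) (clm_comp hΩ A hA hK (h.2.2 v hv))
      have h1 : HasFDerivAt (fun z => A (f z)) (A.comp (fderiv ℝ f z)) z :=
        A.hasFDerivAt.comp z (h.differentiableAt hΩ hz).hasFDerivAt
      rw [h1.fderiv]
      rfl

theorem const_mul (hΩ : IsOpen Ω) (c : ℂ) (h : RegOn 𝓥 d Ω m M f) :
    RegOn 𝓥 d Ω m (‖c‖ * M) (fun z => c * f z) :=
  h.clm_comp hΩ ((ContinuousLinearMap.mul ℝ ℂ) c) (fun x => by simp) (norm_nonneg c)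

theorem conj (hΩ : IsOpen Ω) (h : RegOn 𝓥 d Ω m M f) :
    RegOn 𝓥 d Ω m M (fun z => (starRingEnd ℂ) (f z)) := by
  have := h.clm_comp hΩ (K := 1) Complex.conjCLE.toContinuousLinearMap
    (fun c => by simp) zero_le_one
  simpa using this

theorem sub (hΩ : IsOpen Ω) (hf : RegOn 𝓥 d Ω m M f) (hg : RegOn 𝓥 d Ω m M' g) :
    RegOn 𝓥 d Ω m (M + M') (fun z => f z - g z) := by
  have := hf.add hΩ (hg.const_mul hΩ (-1))
  simpa [sub_eq_add_neg] using this

theorem const (hd0 : ∀ z w, 0 ≤ d z w) : ∀ (m : ℕ) (c : ℂ), ‖c‖ ≤ M → RegOn 𝓥 d Ω m M (fun _ => c)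
  | 0, c, hM => ⟨continuousOn_const, fun _ _ => hM, fun z _ w _ => by
      rw [sub_self, norm_zero]
      exact mul_nonneg ((norm_nonneg c).trans hM) (hd0 z w)⟩
  | m + 1, c, hM => ⟨differentiableOn_const c, fun _ _ => hM, fun v _ => by
      have := const hd0 m 0 (by
        rw [norm_zero]; exact (norm_nonneg c).trans hM)
      simpa using this⟩

/-- One derivative more than needed may be traded for the modulus of continuity. -/
theorem of_succ {Λ : ℝ} (hΛ : 1 ≤ Λ) (hL : LipBound 𝓥 d' Ω Λ) :
    ∀ {m : ℕ} {f : E → ℂ}, RegOn 𝓥 d Ω (m + 1) M f → RegOn 𝓥 d' Ω m (Λ * M) f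
  | 0, f, h => ⟨h.continuousOn, fun z hz => (h.2.1 z hz).trans
      (le_mul_of_one_le_left ((norm_nonneg _).trans (h.2.1 z hz)) hΛ),
      hL f M h.1 h.2.1 fun v hv z hz => (h.2.2 v hv).2.1 z hz⟩
  | _ + 1, _, h => ⟨h.1, fun z hz => (h.2.1 z hz).trans
      (le_mul_of_one_le_left ((norm_nonneg _).trans (h.2.1 z hz)) hΛ), fun v hv =>
      of_succ hΛ hL (h.2.2 v hv)⟩

/-- Leibniz rule. At each step the undifferentiated factor has a derivative to spare, which is
traded for the modulus of continuity. -/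
theorem mul (hΩ : IsOpen Ω) (hd0 : ∀ z w, 0 ≤ d z w) {Λ : ℝ} (hΛ : 1 ≤ Λ)
    (hL : LipBound 𝓥 d Ω Λ) (m : ℕ) : ∃ C : ℝ, 1 ≤ C ∧ ∀ (f g : E → ℂ) (M M' : ℝ),
      RegOn 𝓥 d Ω m M f → RegOn 𝓥 d Ω m M' g → RegOn 𝓥 d Ω m (C * (M * M')) (fun z => f z * g z) := by
  induction m with
  | zero =>
    refine ⟨2, by norm_num, fun f g M M' hf hg => ⟨hf.1.mul hg.1, fun z hz => ?_,
      fun z hz w hw => ?_⟩⟩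
    · have h1 := mul_le_mul (hf.2.1 z hz) (hg.2.1 z hz) (norm_nonneg _)
        ((norm_nonneg _).trans (hf.2.1 z hz))
      rw [norm_mul]
      nlinarith [norm_nonneg (f z), norm_nonneg (g z), mul_nonneg (norm_nonneg (f z)) (norm_nonneg (g z))]
    · rw [show f z * g z - f w * g w = f z * (g z - g w) + (f z - f w) * g w by ring]
      refine (norm_add_le _ _).trans ?_
      rw [norm_mul, norm_mul]
      have hM : 0 ≤ M := (norm_nonneg _).trans (hf.2.1 z hz)
      have hM' : 0 ≤ M' := (norm_nonneg _).trans (hg.2.1 z hz)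
      have h1 := mul_le_mul (hf.2.1 z hz) (hg.2.2 z hz w hw) (norm_nonneg _) hM
      have h2 := mul_le_mul (hf.2.2 z hz w hw) (hg.2.1 w hw) (norm_nonneg _)
        (mul_nonneg hM (hd0 z w))
      linarith
  | succ m ih =>
    obtain ⟨C, hC, ih⟩ := ih
    refine ⟨2 * Λ * C, by nlinarith, fun f g M M' hf hg => ⟨hf.1.mul hg.1, fun z hz => ?_,
      fun v hv => ?_⟩⟩
    · have hM : 0 ≤ M := (norm_nonneg _).trans (hf.2.1 z hz)
      have hM' : 0 ≤ M' := (norm_nonneg _).trans (hg.2.1 z hz)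
      rw [norm_mul]
      refine (mul_le_mul (hf.2.1 z hz) (hg.2.1 z hz) (norm_nonneg _) hM).trans ?_
      exact le_mul_of_one_le_left (mul_nonneg hM hM') (by nlinarith)
    · have h1 := ih _ _ _ _ (hf.of_succ hΛ hL) (hg.2.2 v hv)
      have h2 := ih _ _ _ _ (hf.2.2 v hv) (hg.of_succ hΛ hL)
      have h3 := h1.add hΩ h2
      rw [show C * (Λ * M * M') + C * (M * (Λ * M')) = 2 * Λ * C * (M * M') by ring] at h3
      refine congr hΩ (fun z hz => ?_) h3
      rw [fderiv_fun_mul (hf.differentiableAt hΩ hz) (hg.differentiableAt hΩ hz)]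
      simp [mul_comm]

/-- The derivative of `1 / f` is `-(∂f) / f ^ 2`, so this follows from the case of products by
induction. -/
theorem inv (hΩ : IsOpen Ω) (hd0 : ∀ z w, 0 ≤ d z w) {Λ : ℝ} (hΛ : 1 ≤ Λ)
    (hL : LipBound 𝓥 d Ω Λ) (hf1 : ∀ z ∈ Ω, 1 ≤ ‖f z‖) (m : ℕ) :
    ∀ M, RegOn 𝓥 d Ω m M f → ∃ M', RegOn 𝓥 d Ω m M' (fun z => (f z)⁻¹) := by
  have hne : ∀ z ∈ Ω, f z ≠ 0 := fun z hz => norm_pos_iff.1 (zero_lt_one.trans_le (hf1 z hz))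
  have hbd : ∀ z ∈ Ω, ‖(f z)⁻¹‖ ≤ 1 := fun z hz => by
    rw [norm_inv]; exact inv_le_one_of_one_le₀ (hf1 z hz)
  induction m with
  | zero =>
    intro M h
    have hM0 : ∀ z ∈ Ω, 0 ≤ M := fun z hz => (norm_nonneg _).trans (h.2.1 z hz)
    refine ⟨1 + M, h.1.inv₀ hne, fun z hz => (hbd z hz).trans (by linarith [hM0 z hz]),
      fun z hz w hw => ?_⟩
    rw [inv_sub_inv (hne z hz) (hne w hw), norm_div, norm_sub_rev]
    refine (div_le_self (norm_nonneg _) ?_).trans ((h.2.2 z hz w hw).trans ?_)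
    · rw [norm_mul]; nlinarith [hf1 z hz, hf1 w hw]
    · nlinarith [hd0 z w]
  | succ m ih =>
    intro M h
    obtain ⟨M₁, hM₁⟩ := ih _ (h.of_succ hΛ hL)
    obtain ⟨C, hC, hmul⟩ := mul (𝓥 := 𝓥) hΩ hd0 hΛ hL m
    have hsq := hmul _ _ _ _ hM₁ hM₁
    set M₂ : ℝ := ‖(-1 : ℂ)‖ * (C * (M * (C * (M₁ * M₁)))) with hM₂
    refine ⟨max 1 M₂, h.1.fun_inv hne, fun z hz => (hbd z hz).trans (le_max_left _ _),
      fun v hv => ?_⟩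
    have h1 := (hmul _ _ _ _ (h.2.2 v hv) hsq).const_mul hΩ (-1)
    refine congr hΩ (fun z hz => ?_) (h1.mono (fun _ _ => le_rfl) hd0 (le_max_right 1 M₂))
    have h2 : HasFDerivAt (fun z => (f z)⁻¹) (-((f z) ^ 2)⁻¹ • fderiv ℝ f z) z :=
      ((hasDerivAt_inv (hne z hz)).comp_hasFDerivAt_of_eq z
        (h.differentiableAt hΩ hz).hasFDerivAt rfl)
    rw [h2.fderiv]
    simp
    ring

/-- A function of one coordinate is as regular as a function of that coordinate. -/
theorem comp_proj {π : E →L[ℝ] ℂ} {𝓤 : Set ℂ} {δ : ℂ → ℂ → ℝ} {V : Set ℂ} (hV : IsOpen V)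
    (hΩ : IsOpen Ω) (hπ : ∀ z ∈ Ω, π z ∈ V) (h𝓥 : ∀ v ∈ 𝓥, π v ∈ 𝓤 ∨ π v = 0)
    (hδ : ∀ z w, δ (π z) (π w) ≤ d z w) (hd0 : ∀ z w, 0 ≤ d z w) (hM : 0 ≤ M) :
    ∀ {m : ℕ} {b : ℂ → ℂ}, RegOn 𝓤 δ V m M b → RegOn 𝓥 d Ω m M (fun z => b (π z))
  | 0, b, h => ⟨h.1.comp π.continuous.continuousOn hπ, fun z hz => h.2.1 _ (hπ z hz),
      fun z hz w hw => (h.2.2 _ (hπ z hz) _ (hπ w hw)).trans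
        (mul_le_mul_of_nonneg_left (hδ z w) hM)⟩
  | m + 1, b, h => by
      have hfd : ∀ z ∈ Ω, HasFDerivAt (fun z => b (π z)) ((fderiv ℝ b (π z)).comp π) z :=
        fun z hz => (h.differentiableAt hV (hπ z hz)).hasFDerivAt.comp z π.hasFDerivAt
      refine ⟨fun z hz => (hfd z hz).differentiableAt.differentiableWithinAt,
        fun z hz => h.2.1 _ (hπ z hz), fun v hv => ?_⟩
      rcases h𝓥 v hv with hv' | hv'
      · refine congr hΩ (fun z hz => ?_) (comp_proj hV hΩ hπ h𝓥 hδ hd0 hM (h.2.2 _ hv'))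
        rw [(hfd z hz).fderiv]; rfl
      · refine congr hΩ (fun z hz => ?_) (const hd0 m 0 (by simpa using hM))
        rw [(hfd z hz).fderiv]; simp [hv']

theorem sum (hΩ : IsOpen Ω) (hd0 : ∀ z w, 0 ≤ d z w) {ι : Type*} (s : Finset ι) {F : ι → E → ℂ}
    (h : ∀ i ∈ s, ∃ M, RegOn 𝓥 d Ω m M (F i)) : ∃ M, RegOn 𝓥 d Ω m M (fun z => ∑ i ∈ s, F i z) := by
  classical
  induction s using Finset.induction_on with
  | empty => exact ⟨0, by simpa using const hd0 m 0 (by simp)⟩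
  | insert a s ha ih =>
    obtain ⟨M₁, h₁⟩ := h a (Finset.mem_insert_self a s)
    obtain ⟨M₂, h₂⟩ := ih fun i hi => h i (Finset.mem_insert_of_mem hi)
    exact ⟨M₁ + M₂, by simpa [Finset.sum_insert ha] using h₁.add hΩ h₂⟩

/-- Directional derivatives in a spanning set of directions suffice for `C^m` regularity. -/
theorem contDiffOn [FiniteDimensional ℝ E] (hΩ : IsOpen Ω) (h𝓥 : Submodule.span ℝ 𝓥 = ⊤) :
    ∀ {m : ℕ} {f : E → ℂ}, RegOn 𝓥 d Ω m M f → ContDiffOn ℝ m f Ω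
  | 0, f, h => by simpa using (contDiffOn_zero (𝕜 := ℝ)).2 h.1
  | m + 1, f, h => by
      rw [show ((m + 1 : ℕ) : WithTop ℕ∞) = (m : WithTop ℕ∞) + 1 by push_cast; rfl,
        contDiffOn_succ_iff_fderiv_of_isOpen hΩ]
      refine ⟨h.1, by simp, (contDiffOn_clm_apply (𝕜 := ℝ)).2 fun y => ?_⟩
      have hy : y ∈ Submodule.span ℝ 𝓥 := h𝓥 ▸ Submodule.mem_top
      induction hy using Submodule.span_induction with
      | mem v hv => exact contDiffOn hΩ h𝓥 (h.2.2 v hv)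
      | zero => simpa using contDiffOn_const (c := (0 : ℂ))
      | add x y _ _ hx hy => simpa using hx.add hy
      | smul a x _ hx => simp only [map_smul]; exact hx.const_smul a
end RegOn

/-- The directions of the two real coordinates of `ℂ`. -/
def coordDirections : Set ℂ := {1, Complex.I}

theorem norm_clm_le_of_coordDirections {A : ℂ →L[ℝ] ℂ} {M : ℝ}
    (hA : ∀ v ∈ coordDirections, ‖A v‖ ≤ M) : ‖A‖ ≤ 2 * M := by
  have h1 := hA 1 (by simp [coordDirections])
  have h2 := hA Complex.I (by simp [coordDirections])
  have hM : 0 ≤ M := (norm_nonneg _).trans h1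
  refine A.opNorm_le_bound (by positivity) fun c => ?_
  have h : A c = c.re • A 1 + c.im • A Complex.I := by
    rw [← map_smul, ← map_smul, ← map_add]
    congr 1
    simp [Complex.re_add_im]
  rw [h]
  refine (norm_add_le _ _).trans ?_
  rw [norm_smul, norm_smul, Real.norm_eq_abs, Real.norm_eq_abs]
  have h3 := mul_le_mul (Complex.abs_re_le_norm c) h1 (norm_nonneg _) (norm_nonneg c)
  have h4 := mul_le_mul (Complex.abs_im_le_norm c) h2 (norm_nonneg _) (norm_nonneg c)
  linarith

theorem norm_sub_le_rpow {R ε : ℝ} (hε0 : 0 ≤ ε) (hε1 : ε ≤ 1) {z w : ℂ} (hz : z ∈ ball (0 : ℂ) R)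
    (hw : w ∈ ball (0 : ℂ) R) : ‖z - w‖ ≤ (1 + 2 * R) * ‖z - w‖ ^ ε := by
  have hR : ‖z - w‖ ≤ 2 * R := by
    rw [mem_ball_zero_iff] at hz hw
    linarith [norm_sub_le z w]
  rcases (norm_nonneg (z - w)).eq_or_lt with h0 | h0
  · rw [← h0]
    rw [← h0] at hR
    positivity
  rcases le_total ‖z - w‖ 1 with h | h
  · have h1 : ‖z - w‖ ≤ ‖z - w‖ ^ ε := by
      simpa using Real.rpow_le_rpow_of_exponent_ge h0 h hε1
    nlinarith
  · have h1 : 1 ≤ ‖z - w‖ ^ ε := Real.one_le_rpow h hε0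
    nlinarith

/-- A disc is convex, so the mean value inequality applies. -/
theorem lipBound_ball {R ε : ℝ} (hε0 : 0 ≤ ε) (hε1 : ε ≤ 1) :
    LipBound coordDirections (fun z w : ℂ => ‖z - w‖ ^ ε) (ball 0 R) (2 * (1 + 2 * R)) := by
  intro f M hf hM hv z hz w hw
  have hM0 : 0 ≤ M := (norm_nonneg _).trans (hM z hz)
  have h1 : ‖f z - f w‖ ≤ 2 * M * ‖z - w‖ :=
    (convex_ball (0 : ℂ) R).norm_image_sub_le_of_norm_fderiv_le
      (fun x hx => hf.differentiableAt (isOpen_ball.mem_nhds hx))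
      (fun x hx => norm_clm_le_of_coordDirections fun v hv' => hv v hv' x hx) hw hz
  have h2 := mul_le_mul_of_nonneg_left (norm_sub_le_rpow hε0 hε1 hz hw) (by positivity : 0 ≤ 2 * M)
  linarith

theorem ContDiff.exists_regOn_ball {R ε : ℝ} (hR : 0 < R) (hε0 : 0 ≤ ε) (hε1 : ε ≤ 1) (m : ℕ) :
    ∀ f : ℂ → ℂ, ContDiff ℝ (m + 1 : ℕ) f →
      ∃ M, RegOn coordDirections (fun z w : ℂ => ‖z - w‖ ^ ε) (ball 0 R) m M f := by
  have hd0 : ∀ z w : ℂ, 0 ≤ ‖z - w‖ ^ ε := fun z w => by positivity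
  have hbd : ∀ f : ℂ → ℂ, Continuous f → ∃ M, ∀ z ∈ ball (0 : ℂ) R, ‖f z‖ ≤ M := fun f hf => by
    obtain ⟨M, hM⟩ := (isCompact_closedBall (0 : ℂ) R).exists_bound_of_continuousOn hf.continuousOn
    exact ⟨M, fun z hz => hM z (ball_subset_closedBall hz)⟩
  induction m with
  | zero =>
    intro f hf
    have hf1 : ContDiff ℝ 1 f := by simpa using hf
    obtain ⟨M₀, hM₀⟩ := hbd f hf.continuous
    obtain ⟨M₁, hM₁⟩ := (isCompact_closedBall (0 : ℂ) R).exists_bound_of_continuousOn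
      (hf1.continuous_fderiv one_ne_zero).continuousOn
    have h0 : (0 : ℂ) ∈ ball (0 : ℂ) R := mem_ball_self hR
    have hM₁0 : 0 ≤ M₁ := (norm_nonneg _).trans (hM₁ 0 (ball_subset_closedBall h0))
    have hM₀0 : 0 ≤ M₀ := (norm_nonneg _).trans (hM₀ 0 h0)
    refine ⟨M₀ + M₁ * (1 + 2 * R), hf.continuous.continuousOn, fun z hz =>
      (hM₀ z hz).trans (le_add_of_nonneg_right (by positivity)), fun z hz w hw => ?_⟩
    have h1 : ‖f z - f w‖ ≤ M₁ * ‖z - w‖ :=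
      (convex_ball (0 : ℂ) R).norm_image_sub_le_of_norm_fderiv_le (𝕜 := ℝ)
        (fun x _ => hf1.differentiable one_ne_zero x)
        (fun x hx => hM₁ x (ball_subset_closedBall hx)) hw hz
    have h2 := mul_le_mul_of_nonneg_left (norm_sub_le_rpow hε0 hε1 hz hw) hM₁0
    have h3 : 0 ≤ M₀ * ‖z - w‖ ^ ε := by positivity
    linarith
  | succ m ih =>
    intro f hf
    obtain ⟨M₀, hM₀⟩ := hbd f hf.continuous
    have hd : ∀ v : ℂ, ContDiff ℝ (m + 1 : ℕ) fun z => fderiv ℝ f z v := fun v =>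
      (hf.fderiv_right (m := (m + 1 : ℕ)) (by norm_cast)).clm_apply contDiff_const
    obtain ⟨M₁, hM₁⟩ := ih _ (hd 1)
    obtain ⟨M₂, hM₂⟩ := ih _ (hd Complex.I)
    refine ⟨max M₀ (max M₁ M₂), (hf.differentiable (by simp)).differentiableOn,
      fun z hz => (hM₀ z hz).trans (le_max_left _ _), ?_⟩
    rintro v (rfl | rfl)
    · exact hM₁.mono (fun _ _ => le_rfl) hd0 (by simp)
    · exact hM₂.mono (fun _ _ => le_rfl) hd0 (by simp)

/-! ### Lipschitz bounds on domains with a graph boundary -/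

theorem norm_sub_le_of_segment_subset {D : Set ℂ} (hD : IsOpen D) {f : ℂ → ℂ} {M : ℝ}
    (hf : DifferentiableOn ℝ f D) (hM : ∀ z ∈ D, ‖fderiv ℝ f z‖ ≤ M) {z w : ℂ}
    (h : segment ℝ z w ⊆ D) : ‖f z - f w‖ ≤ M * ‖z - w‖ :=
  (convex_segment z w).norm_image_sub_le_of_norm_fderiv_le (𝕜 := ℝ)
    (fun _ hx => hf.differentiableAt (hD.mem_nhds (h hx))) (fun _ hx => hM _ (h hx))
    (right_mem_segment ℝ z w) (left_mem_segment ℝ z w)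

/-- A domain with Lipschitz boundary is locally quasiconvex near a boundary point: two points of
it are joined, inside the domain, by moving up by a multiple of their distance, then straight, and
then down. Therefore a bounded derivative gives a Lipschitz bound. -/
theorem exists_local_lipschitz_of_graph {D : Set ℂ} (hD : IsOpen D) {p u : ℂ} {r : ℝ} {φ : ℝ → ℝ}
    (hu : ‖u‖ = 1) (hr : 0 < r) (hφ : ContDiff ℝ 1 φ)
    (hg : ∀ z ∈ ball p r, z ∈ D ↔ φ (((z - p) / u).re) < ((z - p) / u).im) :
    ∃ r' > 0, ∃ C ≥ 0, ∀ (f : ℂ → ℂ) (M : ℝ), DifferentiableOn ℝ f D →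
      (∀ z ∈ D, ‖fderiv ℝ f z‖ ≤ M) → ∀ z ∈ D ∩ ball p r', ∀ w ∈ D ∩ ball p r',
        ‖f z - f w‖ ≤ C * M * ‖z - w‖ := by
  have hu0 : u ≠ 0 := norm_pos_iff.1 (by rw [hu]; exact one_pos)
  obtain ⟨Λ, hΛ⟩ := (isCompact_Icc (a := -r) (b := r)).exists_bound_of_continuousOn
    (hφ.continuous_deriv le_rfl).continuousOn
  have hΛ0 : 0 ≤ Λ := (norm_nonneg _).trans (hΛ 0 ⟨by linarith, hr.le⟩)
  have hlip : ∀ s ∈ Icc (-r) r, ∀ t ∈ Icc (-r) r, φ s ≤ φ t + Λ * |s - t| := by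
    intro s hs t ht
    have := (convex_Icc (-r) r).norm_image_sub_le_of_norm_deriv_le
      (fun x _ => hφ.differentiable one_ne_zero x) hΛ ht hs
    rw [Real.norm_eq_abs, Real.norm_eq_abs] at this
    linarith [le_abs_self (φ s - φ t)]
  set X : ℂ → ℂ := fun z => (z - p) / u with hX
  have hXn : ∀ z, ‖X z‖ = ‖z - p‖ := fun z => by simp [hX, hu]
  have hXre : ∀ z ∈ ball p r, (X z).re ∈ Icc (-r) r := by
    intro z hz
    have h1 := (Complex.abs_re_le_norm (X z)).trans_lt
      ((hXn z).trans_lt (by simpa [dist_eq_norm] using hz))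
    exact ⟨(abs_lt.1 h1).1.le, (abs_lt.1 h1).2.le⟩
  refine ⟨r / (2 + 2 * Λ), by positivity, 2 * Λ + 1, by positivity, fun f M hf hM z hz w hw => ?_⟩
  set r' := r / (2 + 2 * Λ) with hr'
  have hrr' : r' * (2 + 2 * Λ) = r := by rw [hr']; field_simp
  have hr'0 : 0 < r' := by positivity
  have hM0 : 0 ≤ M := (norm_nonneg _).trans (hM z hz.1)
  have hzp : ‖z - p‖ < r' := by simpa [dist_eq_norm] using hz.2
  have hwp : ‖w - p‖ < r' := by simpa [dist_eq_norm] using hw.2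
  have hr'r : r' ≤ r := by nlinarith
  set H : ℝ := Λ * |(X z).re - (X w).re| with hH
  have hH0 : 0 ≤ H := by positivity
  have hre : |(X z).re - (X w).re| ≤ ‖z - w‖ := by
    rw [← Complex.sub_re]
    refine (Complex.abs_re_le_norm _).trans (le_of_eq ?_)
    rw [hX]; simp only
    rw [← sub_div, norm_div, hu, div_one]; congr 1; ring
  have hzw : ‖z - w‖ < 2 * r' := by
    have : ‖z - w‖ ≤ ‖z - p‖ + ‖w - p‖ := by
      simpa using norm_sub_le (z - p) (w - p)
    linarith
  have hHle : H ≤ Λ * ‖z - w‖ := mul_le_mul_of_nonneg_left hre hΛ0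
  have hHr : r' + H ≤ r := by nlinarith
  set v : ℂ := u * Complex.I * H with hv
  have hvn : ‖v‖ = H := by
    rw [hv, norm_mul, norm_mul, hu, Complex.norm_I, Complex.norm_real, Real.norm_of_nonneg hH0]
    ring
  have hball : ∀ y, ‖y - p‖ < r' → y ∈ ball p r ∧ y + v ∈ ball p r := by
    intro y hy
    rw [mem_ball, mem_ball, dist_eq_norm, dist_eq_norm]
    refine ⟨hy.trans_le hr'r, ?_⟩
    have : ‖y + v - p‖ ≤ ‖y - p‖ + ‖v‖ := by
      rw [show y + v - p = (y - p) + v by ring]; exact norm_add_le _ _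
    linarith
  have hXv : ∀ y (s : ℝ), X (y + s * v) = X y + (s * H : ℝ) * Complex.I := by
    intro y s
    simp only [hX, hv]
    push_cast
    field_simp
    ring
  have hvert : ∀ y ∈ D, ‖y - p‖ < r' → segment ℝ y (y + v) ⊆ D := by
    intro y hy hyp
    rw [segment_eq_image']
    rintro _ ⟨s, hs, rfl⟩
    have hmem : y + s • (y + v - y) ∈ ball p r :=
      (convex_ball p r).segment_subset (hball y hyp).1 (hball y hyp).2
        (by rw [segment_eq_image']; exact ⟨s, hs, rfl⟩)
    refine (hg _ hmem).2 ?_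
    have h1 := (hg y (hball y hyp).1).1 hy
    change φ (X _).re < (X _).im
    rw [add_sub_cancel_left, Complex.real_smul, hXv]
    simp only [Complex.add_re, Complex.add_im, Complex.mul_re, Complex.mul_im, Complex.ofReal_re,
      Complex.ofReal_im, Complex.I_re, Complex.I_im]
    have h2 : 0 ≤ s * H := mul_nonneg hs.1 hH0
    have h3 : φ (X y).re < (X y).im := h1
    simp only [mul_zero, sub_zero, add_zero, mul_one]
    linarith
  -- raised by `H`, the segment clears the graph between the two points
  have hhor : segment ℝ (z + v) (w + v) ⊆ D := by
    rw [segment_eq_image']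
    rintro _ ⟨s, hs, rfl⟩
    have hmem : z + v + s • (w + v - (z + v)) ∈ ball p r :=
      (convex_ball p r).segment_subset (hball z hzp).2 (hball w hwp).2
        (by rw [segment_eq_image']; exact ⟨s, hs, rfl⟩)
    refine (hg _ hmem).2 ?_
    have h1 : φ (X z).re < (X z).im := (hg z (hball z hzp).1).1 hz.1
    have h2 : φ (X w).re < (X w).im := (hg w (hball w hwp).1).1 hw.1
    have hXs : X (z + v + s • (w + v - (z + v))) = X z + s * (X w - X z) + H * Complex.I := by
      simp only [hX, hv, Complex.real_smul]
      field_simp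
      ring
    have hin := hXre _ hmem
    change φ (X _).re < (X _).im
    rw [hXs] at hin ⊢
    simp only [Complex.add_re, Complex.add_im, Complex.mul_re, Complex.mul_im, Complex.ofReal_re,
      Complex.ofReal_im, Complex.I_re, Complex.I_im, Complex.sub_re, Complex.sub_im, mul_zero,
      zero_mul, sub_zero, add_zero, mul_one] at hin ⊢
    set a := (X z).re
    set b := (X w).re
    have h3 := hlip _ hin a (hXre z (hball z hzp).1)
    have h4 := hlip _ hin b (hXre w (hball w hwp).1)
    have e3 : |a + s * (b - a) - a| = s * |a - b| := by
      rw [show a + s * (b - a) - a = s * (b - a) by ring, abs_mul, abs_of_nonneg hs.1, abs_sub_comm]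
    have e4 : |a + s * (b - a) - b| = (1 - s) * |a - b| := by
      rw [show a + s * (b - a) - b = (1 - s) * (a - b) by ring, abs_mul,
        abs_of_nonneg (by linarith [hs.2])]
    rw [e3] at h3
    rw [e4] at h4
    set c := φ (a + s * (b - a))
    have hs0 := hs.1
    have hs1 : 0 ≤ 1 - s := by linarith [hs.2]
    have h5 : (1 - s) * c ≤ (1 - s) * ((X z).im + s * H) := by
      refine mul_le_mul_of_nonneg_left ?_ hs1
      have : Λ * (s * |a - b|) = s * H := by rw [hH]; ring
      linarith
    have h6 : s * c ≤ s * ((X w).im + (1 - s) * H) := by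
      refine mul_le_mul_of_nonneg_left ?_ hs0
      have : Λ * ((1 - s) * |a - b|) = (1 - s) * H := by rw [hH]; ring
      linarith
    -- at least one of the two convexity bounds has a positive weight and so is strict
    rcases hs1.eq_or_lt with h8 | h8
    · have hs1' : s = 1 := by linarith
      rw [← h8] at h4
      rw [hs1']
      linarith
    · have h9 : (1 - s) * c < (1 - s) * ((X z).im + s * H) := by
        refine mul_lt_mul_of_pos_left ?_ h8
        have : Λ * (s * |a - b|) = s * H := by rw [hH]; ring
        linarith
      nlinarith [mul_nonneg (mul_nonneg hs0 hs1) hH0, sq_nonneg (s - 1 / 2)]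
  have b1 := norm_sub_le_of_segment_subset hD hf hM (hvert z hz.1 hzp)
  have b2 := norm_sub_le_of_segment_subset hD hf hM hhor
  have b3 := norm_sub_le_of_segment_subset hD hf hM (hvert w hw.1 hwp)
  have e1 : ‖z - (z + v)‖ = H := by rw [sub_add_cancel_left, norm_neg, hvn]
  have e3 : ‖w - (w + v)‖ = H := by rw [sub_add_cancel_left, norm_neg, hvn]
  rw [e1] at b1
  rw [e3] at b3
  rw [add_sub_add_right_eq_sub] at b2
  have htri : ‖f z - f w‖ ≤ ‖f z - f (z + v)‖ + ‖f (z + v) - f (w + v)‖ + ‖f w - f (w + v)‖ := by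
    rw [show f z - f w = (f z - f (z + v)) + (f (z + v) - f (w + v)) - (f w - f (w + v)) by ring]
    exact (norm_sub_le _ _).trans (add_le_add (norm_add_le _ _) le_rfl)
  have := mul_le_mul_of_nonneg_left hHle hM0
  linarith

/-- Points closer than a Lebesgue number of a cover by graph charts are compared inside one chart;
for the others, the bound for `|f|` is enough. -/
theorem IsBoundedDomainWithHolderBoundary.exists_lipschitz {k : ℕ} {α : ℝ} {D : Set ℂ}
    (hD : IsBoundedDomainWithHolderBoundary (k + 1) α D) :
    ∃ Λ ≥ 0, ∀ (f : ℂ → ℂ) (M : ℝ), DifferentiableOn ℝ f D → (∀ z ∈ D, ‖f z‖ ≤ M) →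
      (∀ z ∈ D, ‖fderiv ℝ f z‖ ≤ M) → ∀ z ∈ D, ∀ w ∈ D, ‖f z - f w‖ ≤ Λ * M * ‖z - w‖ := by
  have hcpt : IsCompact (closure D) := hD.isBounded.isCompact_closure
  have hloc : ∀ p : ℂ, ∃ r' > 0, ∃ C ≥ 0, p ∈ closure D → ∀ (f : ℂ → ℂ) (M : ℝ),
      DifferentiableOn ℝ f D → (∀ z ∈ D, ‖fderiv ℝ f z‖ ≤ M) →
      ∀ z ∈ D ∩ ball p r', ∀ w ∈ D ∩ ball p r', ‖f z - f w‖ ≤ C * M * ‖z - w‖ := by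
    intro p
    by_cases hpD : p ∈ D
    · obtain ⟨r, hr, hrD⟩ := Metric.isOpen_iff.1 hD.isOpen p hpD
      refine ⟨r, hr, 1, zero_le_one, fun _ f M hf hM z hz w hw => ?_⟩
      rw [one_mul]
      exact norm_sub_le_of_segment_subset hD.isOpen hf hM
        (((convex_ball p r).segment_subset hz.2 hw.2).trans hrD)
    · by_cases hp : p ∈ closure D
      · obtain ⟨u, r, φ, K, hu, hr, hφ, -, hg⟩ := hD.boundary p
          (by rw [hD.isOpen.frontier_eq]; exact ⟨hp, hpD⟩)
        obtain ⟨r', hr', C, hC, h⟩ := exists_local_lipschitz_of_graph hD.isOpen hu hr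
          (hφ.of_le (by norm_cast; omega)) hg
        exact ⟨r', hr', C, hC, fun _ => h⟩
      · exact ⟨1, one_pos, 0, le_rfl, fun h => absurd h hp⟩
  choose r' hr' C hC hlip using hloc
  obtain ⟨t, htD, ht⟩ := hcpt.elim_nhds_subcover (fun p => ball p (r' p))
    (fun p _ => ball_mem_nhds p (hr' p))
  obtain ⟨δ, hδ, hleb⟩ := lebesgue_number_lemma_of_metric (ι := t) (c := fun p => ball p.1 (r' p))
    hcpt (fun p => isOpen_ball) (by simpa [iUnion_subtype] using ht)
  have hCs : ∀ p ∈ t, C p ≤ ∑ q ∈ t, C q := fun p hp =>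
    Finset.single_le_sum (f := C) (fun q _ => hC q) hp
  have hCs0 : 0 ≤ ∑ q ∈ t, C q := Finset.sum_nonneg fun q _ => hC q
  refine ⟨∑ q ∈ t, C q + 2 / δ, by positivity, fun f M hf hM hM' z hz w hw => ?_⟩
  have hM0 : 0 ≤ M := (norm_nonneg _).trans (hM z hz)
  rcases lt_or_ge ‖z - w‖ δ with h | h
  · obtain ⟨p, hp⟩ := hleb z (subset_closure hz)
    have h1 := hlip p.1 (htD p.1 p.2) f M hf hM' z ⟨hz, hp (mem_ball_self hδ)⟩ w
      ⟨hw, hp (by rwa [mem_ball, dist_eq_norm, norm_sub_rev])⟩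
    refine h1.trans ?_
    gcongr
    exact (hCs p.1 p.2).trans (le_add_of_nonneg_right (by positivity))
  · have h1 : ‖f z - f w‖ ≤ 2 * M := (norm_sub_le _ _).trans (by linarith [hM z hz, hM w hw])
    have h2 : 2 * M ≤ 2 / δ * M * ‖z - w‖ := by
      rw [div_mul_eq_mul_div, div_mul_eq_mul_div, le_div_iff₀ hδ]
      gcongr
    have h3 : 0 ≤ (∑ q ∈ t, C q) * M * ‖z - w‖ := by positivity
    linarith

/-! ### Tangent fields along the boundary -/

/-- A *tangent chart* at a point `p` of the closure of `D`: a nowhere small complex direction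
field `W` of class `C^k`, with Hölder continuous derivatives of order `k`, which is tangent to the
boundary of `D` inside the disc `ball p r`, in the weak sense that derivatives along `W` of
functions supported in that disc integrate to zero over `D`. The derivative along `W` is
`W (∂ + b ∂̄)` with `b = conj W / W`; the last condition is what turns `∂u + ∂̄(b u)` into the
derivative of `u / W` along `W`. -/
structure IsTangentChart (k : ℕ) (ε : ℝ) (D : Set ℂ) (p : ℂ) (r : ℝ) (W : ℂ → ℂ) : Prop where
  contDiff : ContDiff ℝ k W
  one_le_norm : ∀ ζ, 1 ≤ ‖W ζ‖
  regOn : ∀ R > 0, ∃ M, RegOn coordDirections (fun z w : ℂ => ‖z - w‖ ^ ε) (ball 0 R) k M W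
  integral_eq_zero : ∀ χ : ℂ → ℂ, ContDiff ℝ 1 χ → tsupport χ ⊆ ball p r →
    ∀ (M : ℝ) (v : ℂ → ℂ), IsBddC1On M v D →
      ∫ ζ in D, fderiv ℝ (fun ζ => χ ζ * v ζ) ζ (W ζ) = 0
  antiPart_fderiv : 1 ≤ k → ∀ ζ, antiPart (fderiv ℝ (fun ζ => (starRingEnd ℂ) (W ζ) / W ζ) ζ) =
    -(fderiv ℝ W ζ (W ζ) / W ζ ^ 2)

theorem contDiffAt_mul_of_tsupport {χ v : ℂ → ℂ} (hχ : ContDiff ℝ 1 χ) {ζ : ℂ}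
    (hv : ζ ∈ tsupport χ → ContDiffAt ℝ 1 v ζ) : ContDiffAt ℝ 1 (fun ζ => χ ζ * v ζ) ζ := by
  by_cases h : ζ ∈ tsupport χ
  · exact hχ.contDiffAt.mul (hv h)
  · refine (contDiffAt_const (c := (0 : ℂ))).congr_of_eventuallyEq ?_
    filter_upwards [(isClosed_tsupport χ).isOpen_compl.mem_nhds h] with w hw
    rw [image_eq_zero_of_notMem_tsupport hw, zero_mul]

theorem fderiv_mul_eq_zero_of_notMem_tsupport {χ v : ℂ → ℂ} {ζ : ℂ} (h : ζ ∉ tsupport χ) :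
    fderiv ℝ (fun ζ => χ ζ * v ζ) ζ = 0 :=
  fderiv_cutoff_mul_of_notMem (π := ContinuousLinearMap.id ℝ ℂ) h

theorem IsBddC1On.integrableOn_fderiv_apply {D : Set ℂ} (hD : IsOpen D)
    (hb : Bornology.IsBounded D) {F W : ℂ → ℂ} {M : ℝ} (hF : IsBddC1On M F D) (hW : Continuous W) :
    IntegrableOn (fun ζ => fderiv ℝ F ζ (W ζ)) D := by
  obtain ⟨B, hB⟩ := hb.isCompact_closure.exists_bound_of_continuousOn hW.continuousOn
  refine Integrable.mono' (integrableOn_const (C := M * B) hb.measure_lt_top.ne) ?_ ?_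
  · exact ((hF.contDiffOn.continuousOn_fderiv_of_isOpen hD le_rfl).clm_apply
      hW.continuousOn).aestronglyMeasurable hD.measurableSet
  · filter_upwards [ae_restrict_mem hD.measurableSet] with ζ hζ
    have h1 := hF.norm_fderiv_le ζ hζ
    exact ((fderiv ℝ F ζ).le_opNorm _).trans (mul_le_mul h1 (hB ζ (subset_closure hζ))
      (norm_nonneg _) ((norm_nonneg _).trans h1))

section graph
variable (p u : ℂ) (φ : ℝ → ℝ)

/-- The coordinates `(t, x)` near the graph of `φ`: the height `t` above the graph and the
abscissa `x`, in the frame with origin `p` and rotated by `u`. -/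
def graphCoord (q : ℝ × ℝ) : ℂ := p + u * (q.2 + (φ q.2 + q.1 : ℝ) * Complex.I)

variable {p u φ}

theorem graphCoord_sub_div (hu : u ≠ 0) (q : ℝ × ℝ) :
    (graphCoord p u φ q - p) / u = q.2 + (φ q.2 + q.1 : ℝ) * Complex.I := by
  rw [graphCoord, add_sub_cancel_left, mul_div_cancel_left₀ _ hu]

/-- The graph coordinates are a shear followed by a rigid motion. -/
theorem measurePreserving_graphCoord (hu : ‖u‖ = 1) (hφ : Continuous φ) :
    MeasurePreserving (graphCoord p u φ) (volume.prod volume) volume := by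
  have h1 : MeasurePreserving (Prod.swap : ℝ × ℝ → ℝ × ℝ) (volume.prod volume)
      (volume.prod volume) := Measure.measurePreserving_swap
  have h2 : MeasurePreserving (fun q : ℝ × ℝ => (q.1, φ q.1 + q.2)) (volume.prod volume)
      (volume.prod volume) :=
    (MeasurePreserving.id volume).skew_product (g := fun x y => φ x + y) (by fun_prop)
      (Filter.Eventually.of_forall fun x => map_add_left_eq_self volume (φ x))
  have h3 : MeasurePreserving Complex.measurableEquivRealProd.symm (volume.prod volume) volume :=
    Complex.volume_preserving_equiv_real_prod.symm
  have h4 : MeasurePreserving (rotation (⟨u, by simp [Submonoid.unitSphere, hu]⟩ : Circle))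
      volume volume := (rotation _).measurePreserving
  have h5 : MeasurePreserving (fun z : ℂ => p + z) volume volume := measurePreserving_add_left _ p
  have h := h5.comp (h4.comp (h3.comp (h2.comp h1)))
  convert h using 1
  funext q
  simp only [graphCoord, Function.comp, Prod.swap]
  congr 2
  apply Complex.ext <;> simp [Complex.measurableEquivRealProd]

theorem measurableEmbedding_graphCoord (hu : ‖u‖ = 1) (hφ : Continuous φ) :
    MeasurableEmbedding (graphCoord p u φ) := by
  have hu0 : u ≠ 0 := norm_pos_iff.1 (by rw [hu]; exact one_pos)
  refine Continuous.measurableEmbedding ?_ fun q q' h => ?_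
  · unfold graphCoord; fun_prop
  · have h1 : (graphCoord p u φ q - p) / u = (graphCoord p u φ q' - p) / u := by rw [h]
    rw [graphCoord_sub_div hu0, graphCoord_sub_div hu0] at h1
    have hx : q.2 = q'.2 := by simpa using congrArg Complex.re h1
    have hy : φ q.2 + q.1 = φ q'.2 + q'.1 := by simpa using congrArg Complex.im h1
    rw [hx] at hy
    exact Prod.ext (by linarith) hx

/-- In graph coordinates, the direction field is the derivative in the abscissa, so by Fubini the
integral vanishes on every level set of the height. -/
theorem integral_fderiv_tangent_eq_zero {D : Set ℂ} (hD : IsOpen D) (hb : Bornology.IsBounded D)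
    {r : ℝ} (hu : ‖u‖ = 1) (hφ : ContDiff ℝ 1 φ)
    (hg : ∀ z ∈ ball p r, z ∈ D ↔ φ (((z - p) / u).re) < ((z - p) / u).im)
    {χ : ℂ → ℂ} (hχ : ContDiff ℝ 1 χ) (hχs : tsupport χ ⊆ ball p r) {M : ℝ} {v : ℂ → ℂ}
    (hv : IsBddC1On M v D) :
    ∫ ζ in D, fderiv ℝ (fun ζ => χ ζ * v ζ) ζ
      (u * (1 + deriv φ (((ζ - p) / u).re) * Complex.I)) = 0 := by
  have hu0 : u ≠ 0 := norm_pos_iff.1 (by rw [hu]; exact one_pos)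
  set F : ℂ → ℂ := fun ζ => χ ζ * v ζ with hF
  set W : ℂ → ℂ := fun ζ => u * (1 + deriv φ (((ζ - p) / u).re) * Complex.I) with hW
  set H : ℂ → ℂ := fun ζ => fderiv ℝ F ζ (W ζ) with hH
  set U : Set ℂ := {z | φ (((z - p) / u).re) < ((z - p) / u).im} with hU
  have hφ' : Continuous (deriv φ) := hφ.continuous_deriv le_rfl
  have hWc : Continuous W := by
    have : Continuous fun ζ : ℂ => deriv φ (((ζ - p) / u).re) :=
      hφ'.comp (Complex.continuous_re.comp (by fun_prop))
    rw [hW]; fun_prop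
  have hUo : IsOpen U := isOpen_lt
    (hφ.continuous.comp (Complex.continuous_re.comp (by fun_prop)))
    (Complex.continuous_im.comp (by fun_prop))
  have hF0 : ∀ ζ, ζ ∉ ball p r → fderiv ℝ F ζ = 0 := fun ζ hζ =>
    fderiv_mul_eq_zero_of_notMem_tsupport fun h => hζ (hχs h)
  have hFU : ∀ ζ ∈ U, ContDiffAt ℝ 1 F ζ := fun ζ hζ =>
    contDiffAt_mul_of_tsupport hχ fun h =>
      hv.contDiffOn.contDiffAt (hD.mem_nhds ((hg ζ (hχs h)).2 hζ))
  obtain ⟨M', hM'⟩ := hv.smooth_mul hD hb hχ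
  have hind : D.indicator H = U.indicator H := by
    funext ζ
    by_cases hζ : ζ ∈ ball p r
    · have : ζ ∈ D ↔ ζ ∈ U := hg ζ hζ
      simp [indicator, this]
    · simp [indicator, hH, hF0 ζ hζ]
  have hHD : IntegrableOn H D := hM'.integrableOn_fderiv_apply hD hb hWc
  have hHU : IntegrableOn H U := by
    rw [← integrable_indicator_iff hUo.measurableSet, ← hind,
      integrable_indicator_iff hD.measurableSet]
    exact hHD
  have hmp := measurePreserving_graphCoord (p := p) hu hφ.continuous
  have hme := measurableEmbedding_graphCoord (p := p) hu hφ.continuous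
  have hpre : graphCoord p u φ ⁻¹' U = Ioi 0 ×ˢ univ := by
    ext q
    simp only [hU, mem_preimage, mem_ofPred_eq, graphCoord_sub_div hu0]
    simp
  have hint : IntegrableOn (fun q => H (graphCoord p u φ q)) (Ioi 0 ×ˢ univ)
      (volume.prod volume) := by
    rw [← hpre]
    exact (hmp.integrableOn_comp_preimage hme).2 hHU
  calc ∫ ζ in D, H ζ = ∫ ζ in U, H ζ := by
        rw [← integral_indicator hD.measurableSet, hind, integral_indicator hUo.measurableSet]
    _ = ∫ q in Ioi (0 : ℝ) ×ˢ (univ : Set ℝ), H (graphCoord p u φ q) ∂(volume.prod volume) := by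
        rw [← hpre, hmp.setIntegral_preimage_emb hme]
    _ = ∫ t in Ioi (0 : ℝ), ∫ x in (univ : Set ℝ), H (graphCoord p u φ (t, x)) :=
        setIntegral_prod _ hint
    _ = ∫ t in Ioi (0 : ℝ), (0 : ℂ) := by
        refine setIntegral_congr_fun measurableSet_Ioi fun t ht => ?_
        have hmemU : ∀ x, graphCoord p u φ (t, x) ∈ U := fun x => by
          have : (t, x) ∈ graphCoord p u φ ⁻¹' U := by rw [hpre]; exact ⟨ht, mem_univ x⟩
          exact this
        have hcurve : ∀ x, HasDerivAt (fun x => graphCoord p u φ (t, x))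
            (W (graphCoord p u φ (t, x))) x := by
          intro x
          have h1 : HasDerivAt (fun x : ℝ => ((φ x + t : ℝ) : ℂ)) ((deriv φ x : ℝ) : ℂ) x :=
            (((hφ.differentiable one_ne_zero x).hasDerivAt).add_const t).ofReal_comp
          have h2 := (((hasDerivAt_id x).ofReal_comp.add (h1.mul_const Complex.I)).const_mul
            u).const_add p
          refine h2.congr_deriv ?_
          simp [hW, graphCoord_sub_div hu0]
        have hcont : Continuous fun x => graphCoord p u φ (t, x) :=
          continuous_iff_continuousAt.2 fun x => (hcurve x).continuousAt
        have hout : ∀ x, x ∉ Icc (-r) r → graphCoord p u φ (t, x) ∉ ball p r := by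
          intro x hx hmem
          have h1 : ‖(graphCoord p u φ (t, x) - p) / u‖ < r := by
            rw [norm_div, hu, div_one]; simpa [dist_eq_norm] using hmem
          have h2 := (Complex.abs_re_le_norm _).trans_lt h1
          rw [graphCoord_sub_div hu0] at h2
          have h3 : |x| < r := by simpa using h2
          exact hx ⟨(abs_lt.1 h3).1.le, (abs_lt.1 h3).2.le⟩
        simp only [Measure.restrict_univ]
        refine integral_eq_zero_of_hasDerivAt_of_integrable
          (f := fun x => F (graphCoord p u φ (t, x))) (fun x => ?_) ?_ ?_
        · exact ((hFU _ (hmemU x)).differentiableAt one_ne_zero).hasFDerivAt.comp_hasDerivAt x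
            (hcurve x)
        · refine Continuous.integrable_of_hasCompactSupport ?_
            (HasCompactSupport.intro (isCompact_Icc (a := -r) (b := r)) fun x hx => by
              simp [hH, hF0 _ (hout x hx)])
          refine Continuous.clm_apply (continuous_iff_continuousAt.2 fun x => ?_) (hWc.comp hcont)
          exact ContinuousAt.comp (f := fun x => graphCoord p u φ (t, x))
            ((hFU _ (hmemU x)).fderiv_right (m := 0) (by norm_num)).continuousAt
            hcont.continuousAt
        · refine Continuous.integrable_of_hasCompactSupport ?_
            (HasCompactSupport.intro (isCompact_Icc (a := -r) (b := r)) fun x hx => by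
              simp only [hF]
              rw [image_eq_zero_of_notMem_tsupport fun h => hout x hx (hχs h), zero_mul])
          exact continuous_iff_continuousAt.2 fun x =>
            ContinuousAt.comp (f := fun x => graphCoord p u φ (t, x))
              (hFU _ (hmemU x)).continuousAt hcont.continuousAt
    _ = 0 := by simp
end graph

/-- A function of one real linear coordinate inherits the Hölder regularity of its profile. -/
theorem RegOn.exists_comp_ofReal {α ε R K : ℝ} (hε0 : 0 < ε) (hεα : ε ≤ α) (hR : 0 < R) {p u : ℂ}
    (hu : ‖u‖ = 1) (m : ℕ) : ∀ ψ : ℝ → ℝ, ContDiff ℝ m ψ →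
      (∀ s t, |iteratedDeriv m ψ s - iteratedDeriv m ψ t| ≤ K * |s - t| ^ α) →
      ∃ M, RegOn coordDirections (fun z w : ℂ => ‖z - w‖ ^ ε) (ball 0 R) m M
        (fun ζ => ((ψ (((ζ - p) / u).re) : ℝ) : ℂ)) := by
  have hd0 : ∀ z w : ℂ, 0 ≤ ‖z - w‖ ^ ε := fun z w => by positivity
  set x : ℂ → ℝ := fun ζ => ((ζ - p) / u).re with hx
  have hxc : Continuous x := Complex.continuous_re.comp (by fun_prop)
  have hbd : ∀ ψ : ℝ → ℝ, Continuous ψ → ∃ M, ∀ z ∈ ball (0 : ℂ) R, ‖((ψ (x z) : ℝ) : ℂ)‖ ≤ M := by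
    intro ψ hψ
    obtain ⟨M, hM⟩ := (isCompact_closedBall (0 : ℂ) R).exists_bound_of_continuousOn
      (Complex.continuous_ofReal.comp (hψ.comp hxc)).continuousOn
    exact ⟨M, fun z hz => hM z (ball_subset_closedBall hz)⟩
  have hxx : ∀ z w, |x z - x w| ≤ ‖z - w‖ := by
    intro z w
    rw [hx, ← Complex.sub_re, ← sub_div]
    refine (Complex.abs_re_le_norm _).trans (le_of_eq ?_)
    rw [norm_div, hu, div_one]
    congr 1; ring
  induction m with
  | zero =>
    intro ψ hψ hK
    obtain ⟨M, hM⟩ := hbd ψ hψ.continuous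
    have hM0 : 0 ≤ M := (norm_nonneg _).trans (hM 0 (mem_ball_self hR))
    refine ⟨M + |K| * (2 * R) ^ (α - ε),
      (Complex.continuous_ofReal.comp (hψ.continuous.comp hxc)).continuousOn, fun z hz =>
      (hM z hz).trans (le_add_of_nonneg_right (by positivity)), fun z hz w hw => ?_⟩
    have hzw : ‖z - w‖ ≤ 2 * R := by
      rw [mem_ball_zero_iff] at hz hw
      linarith [norm_sub_le z w]
    have h1 := hK (x z) (x w)
    simp only [iteratedDeriv_zero] at h1
    have h2 : |x z - x w| ^ α ≤ (2 * R) ^ (α - ε) * ‖z - w‖ ^ ε := by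
      rcases (norm_nonneg (z - w)).eq_or_lt with h0 | h0
      · have := hxx z w
        rw [← h0] at this
        rw [le_antisymm this (abs_nonneg _), Real.zero_rpow (by linarith)]
        positivity
      · calc |x z - x w| ^ α ≤ ‖z - w‖ ^ α :=
            Real.rpow_le_rpow (abs_nonneg _) (hxx z w) (by linarith)
          _ = ‖z - w‖ ^ (α - ε) * ‖z - w‖ ^ ε := by
            rw [← Real.rpow_add h0]; congr 1; ring
          _ ≤ _ := by gcongr
    rw [← Complex.ofReal_sub, Complex.norm_real, Real.norm_eq_abs, add_mul]
    have h3 : K * |x z - x w| ^ α ≤ |K| * ((2 * R) ^ (α - ε) * ‖z - w‖ ^ ε) :=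
      (mul_le_mul_of_nonneg_right (le_abs_self K) (by positivity)).trans
        (mul_le_mul_of_nonneg_left h2 (abs_nonneg K))
    have h4 : 0 ≤ M * ‖z - w‖ ^ ε := by positivity
    linarith
  | succ m ih =>
    intro ψ hψ hK
    obtain ⟨M₀, hM₀⟩ := hbd ψ hψ.continuous
    have hψ' : ContDiff ℝ m (deriv ψ) := by
      rw [Nat.cast_succ, contDiff_succ_iff_deriv] at hψ
      exact hψ.2.2
    obtain ⟨M₁, hM₁⟩ := ih (deriv ψ) hψ' fun s t => by
      simpa only [iteratedDeriv_succ'] using hK s t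
    have hfd : ∀ ζ, HasFDerivAt (fun ζ => ((ψ (x ζ) : ℝ) : ℂ))
        (((deriv ψ (x ζ)) • (Complex.ofRealCLM.comp (Complex.reCLM.comp
          ((ContinuousLinearMap.mul ℝ ℂ) (u⁻¹)))))) ζ := by
      intro ζ
      have h1 : HasFDerivAt x (Complex.reCLM.comp ((ContinuousLinearMap.mul ℝ ℂ) (u⁻¹))) ζ := by
        have h2 : HasFDerivAt (fun ζ : ℂ => u⁻¹ * (ζ - p)) ((ContinuousLinearMap.mul ℝ ℂ) (u⁻¹)) ζ :=
          ((ContinuousLinearMap.mul ℝ ℂ) (u⁻¹)).hasFDerivAt.comp ζ ((hasFDerivAt_id ζ).sub_const p)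
        have h3 := Complex.reCLM.hasFDerivAt.comp ζ h2
        refine h3.congr_of_eventuallyEq (Filter.Eventually.of_forall fun ζ => ?_)
        simp [hx, div_eq_inv_mul]
      have h2 := ((hψ.differentiable (by simp) (x ζ)).hasDerivAt.comp_hasFDerivAt ζ h1)
      have h3 := Complex.ofRealCLM.hasFDerivAt.comp ζ h2
      refine h3.congr_fderiv ?_
      ext c; simp
    have hin : ∀ v : ℂ, RegOn coordDirections (fun z w : ℂ => ‖z - w‖ ^ ε) (ball 0 R) m
        (‖v‖ * M₁) (fun z => fderiv ℝ (fun ζ => ((ψ (x ζ) : ℝ) : ℂ)) z v) := by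
      intro v
      have h1 := hM₁.const_mul isOpen_ball (((u⁻¹ * v).re : ℝ) : ℂ)
      refine (h1.congr isOpen_ball (g := fun z => fderiv ℝ (fun ζ => ((ψ (x ζ) : ℝ) : ℂ)) z v)
        fun z _ => ?_).mono (fun _ _ => le_rfl) hd0 ?_
      · change _ = fderiv ℝ (fun ζ => ((ψ (x ζ) : ℝ) : ℂ)) z v
        rw [(hfd z).fderiv]; simp; ring
      · refine mul_le_mul_of_nonneg_right ?_ ((norm_nonneg _).trans
          (hM₁.norm_le 0 (mem_ball_self hR)))
        rw [Complex.norm_real, Real.norm_eq_abs]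
        refine (Complex.abs_re_le_norm _).trans (le_of_eq ?_)
        rw [norm_mul, norm_inv, hu, inv_one, one_mul]
    refine ⟨max M₀ M₁, fun z _ => (hfd z).differentiableAt.differentiableWithinAt, fun z hz =>
      (hM₀ z hz).trans (le_max_left _ _), ?_⟩
    rintro v (rfl | rfl) <;>
    · refine (hin _).mono (fun _ _ => le_rfl) hd0 ?_
      simp

/-- The tangent field of the level sets of the height above the graph of `φ` is a tangent chart.
It is constant in the vertical direction, so that its derivative only involves `φ''`, and the
formula for `∂̄(conj W / W)` can be checked by hand. -/
theorem isTangentChart_of_graph {k : ℕ} {α ε : ℝ} (hε0 : 0 < ε) (hεα : ε ≤ α) {D : Set ℂ}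
    (hD : IsOpen D) (hb : Bornology.IsBounded D) {p u : ℂ} {r K : ℝ} {φ : ℝ → ℝ} (hu : ‖u‖ = 1)
    (hφ : ContDiff ℝ (k + 1 : ℕ) φ)
    (hK : ∀ s t : ℝ, |iteratedDeriv (k + 1) φ s - iteratedDeriv (k + 1) φ t| ≤ K * |s - t| ^ α)
    (hg : ∀ z ∈ ball p r, z ∈ D ↔ φ (((z - p) / u).re) < ((z - p) / u).im) :
    IsTangentChart k ε D p r
      (fun ζ => u * (1 + ((deriv φ (((ζ - p) / u).re) : ℝ) : ℂ) * Complex.I)) := by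
  have hu0 : u ≠ 0 := norm_pos_iff.1 (by rw [hu]; exact one_pos)
  have hφ' : ContDiff ℝ k (deriv φ) := by
    rw [Nat.cast_succ, contDiff_succ_iff_deriv] at hφ
    exact hφ.2.2
  have hd0 : ∀ z w : ℂ, 0 ≤ ‖z - w‖ ^ ε := fun z w => by positivity
  have h1W : ∀ ζ : ℂ, 1 ≤ ‖u * (1 + ((deriv φ (((ζ - p) / u).re) : ℝ) : ℂ) * Complex.I)‖ := by
    intro ζ
    rw [norm_mul, hu, one_mul]
    refine le_trans ?_ (Complex.abs_re_le_norm _)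
    simp
  have hlin : ContDiff ℝ k fun ζ : ℂ => ((ζ - p) / u).re :=
    Complex.reCLM.contDiff.comp ((contDiff_id.sub contDiff_const).div_const u)
  refine ⟨?_, h1W, fun R hR => ?_, fun χ hχ hχs M v hv => ?_, fun hk ζ => ?_⟩
  · exact contDiff_const.mul (contDiff_const.add
      ((Complex.ofRealCLM.contDiff.comp (hφ'.comp hlin)).mul contDiff_const))
  · obtain ⟨M, hM⟩ := RegOn.exists_comp_ofReal (p := p) hε0 hεα hR hu k (deriv φ) hφ' fun s t => by
      simpa only [iteratedDeriv_succ'] using hK s t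
    have h1 := (RegOn.const (𝓥 := coordDirections) (Ω := ball 0 R) hd0 k u le_rfl).add isOpen_ball
      (hM.const_mul isOpen_ball (u * Complex.I))
    refine ⟨_, h1.congr isOpen_ball fun z _ => ?_⟩
    ring
  · exact integral_fderiv_tangent_eq_zero hD hb hu (hφ.of_le (by norm_cast; omega)) hg hχ hχs hv
  · set W : ℂ → ℂ := fun ζ => u * (1 + ((deriv φ (((ζ - p) / u).re) : ℝ) : ℂ) * Complex.I) with hW
    set a : ℝ := deriv (deriv φ) (((ζ - p) / u).re) with ha
    have hW0 : W ζ ≠ 0 := norm_pos_iff.1 (one_pos.trans_le (h1W ζ))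
    set A : ℂ →L[ℝ] ℂ := (u * a * Complex.I) • (Complex.ofRealCLM.comp (Complex.reCLM.comp
          ((ContinuousLinearMap.mul ℝ ℂ) (u⁻¹)))) with hA
    have hAv : ∀ c, A c = u * a * Complex.I * ((u⁻¹ * c).re : ℝ) := fun c => by simp [hA]
    have hWd : HasFDerivAt W A ζ := by
      have h1 : HasFDerivAt (fun ζ : ℂ => ((ζ - p) / u).re)
          (Complex.reCLM.comp ((ContinuousLinearMap.mul ℝ ℂ) (u⁻¹))) ζ := by
        have h2 : HasFDerivAt (fun ζ : ℂ => u⁻¹ * (ζ - p)) ((ContinuousLinearMap.mul ℝ ℂ) (u⁻¹)) ζ :=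
          ((ContinuousLinearMap.mul ℝ ℂ) (u⁻¹)).hasFDerivAt.comp ζ ((hasFDerivAt_id ζ).sub_const p)
        refine (Complex.reCLM.hasFDerivAt.comp ζ h2).congr_of_eventuallyEq
          (Filter.Eventually.of_forall fun ζ => ?_)
        simp [div_eq_inv_mul]
      have h2 := ((hφ'.differentiable (by norm_cast; omega)
        (((ζ - p) / u).re)).hasDerivAt.comp_hasFDerivAt ζ h1)
      have h3 := (((Complex.ofRealCLM.hasFDerivAt.comp ζ h2).mul_const Complex.I).const_add
        1).const_mul u
      refine h3.congr_fderiv ?_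
      ext c
      simp [hA, ha]
      ring
    have hWc : HasFDerivAt (fun ζ => (starRingEnd ℂ) (W ζ))
        ((Complex.conjCLE : ℂ →L[ℝ] ℂ).comp A) ζ :=
      (Complex.conjCLE : ℂ →L[ℝ] ℂ).hasFDerivAt.comp ζ hWd
    have hq : DifferentiableAt ℝ (fun ζ => (starRingEnd ℂ) (W ζ) / W ζ) ζ := by
      simp only [div_eq_mul_inv]
      exact hWc.differentiableAt.mul (((differentiableAt_inv (𝕜 := ℂ) hW0).restrictScalars ℝ).comp
        (f := W) ζ hWd.differentiableAt)
    set Q := fderiv ℝ (fun ζ => (starRingEnd ℂ) (W ζ) / W ζ) ζ with hQ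
    have hQv : ∀ c, Q c * W ζ + (starRingEnd ℂ) (W ζ) / W ζ * A c = (starRingEnd ℂ) (A c) := by
      intro c
      have h1 : HasFDerivAt (fun ζ => (starRingEnd ℂ) (W ζ) / W ζ * W ζ) _ ζ :=
        hq.hasFDerivAt.mul hWd
      have h2 : HasFDerivAt (fun ζ => (starRingEnd ℂ) (W ζ) / W ζ * W ζ)
          ((Complex.conjCLE : ℂ →L[ℝ] ℂ).comp A) ζ :=
        hWc.congr_of_eventuallyEq (Filter.Eventually.of_forall fun ζ => by
          have : W ζ ≠ 0 := norm_pos_iff.1 (one_pos.trans_le (h1W ζ))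
          simp only
          field_simp)
      have h3 := congrArg (fun B : ℂ →L[ℝ] ℂ => B c) (h1.unique h2)
      simp only [add_apply, FunLike.coe_smul, Pi.smul_apply,
        smul_eq_mul, ContinuousLinearMap.comp_apply] at h3
      rw [← hQ] at h3
      rw [show (starRingEnd ℂ) (A c) = (Complex.conjCLE : ℂ →L[ℝ] ℂ) (A c) by simp, ← h3]
      ring
    have huu : (starRingEnd ℂ) u * u = 1 := by
      rw [mul_comm, Complex.mul_conj, Complex.normSq_eq_norm_sq, hu]; simp
    have hui : u⁻¹ = (starRingEnd ℂ) u := inv_eq_of_mul_eq_one_left huu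
    have hre1 : ((u⁻¹ * 1).re : ℝ) = u.re := by rw [hui]; simp
    have hreI : ((u⁻¹ * Complex.I).re : ℝ) = u.im := by rw [hui]; simp
    have hreW : ((u⁻¹ * W ζ).re : ℝ) = 1 := by
      rw [hW]; simp only; rw [inv_mul_cancel_left₀ hu0]; simp
    have hQ' : ∀ c, Q c = -(2 * Complex.I * a * ((u⁻¹ * c).re : ℝ)) / W ζ ^ 2 := by
      intro c
      have h1 := hQv c
      have hcW : (starRingEnd ℂ) (W ζ) = (starRingEnd ℂ) u *
          (1 - ((deriv φ (((ζ - p) / u).re) : ℝ) : ℂ) * Complex.I) := by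
        simp only [hW, map_mul, map_add, map_one, Complex.conj_ofReal, Complex.conj_I]; ring
      rw [hAv] at h1
      simp only [map_mul, Complex.conj_ofReal, Complex.conj_I] at h1
      rw [eq_div_iff (pow_ne_zero 2 hW0)]
      have h2 : Q c * W ζ ^ 2 = W ζ * ((starRingEnd ℂ) u * a * -Complex.I * ((u⁻¹ * c).re : ℝ)) -
          (starRingEnd ℂ) (W ζ) * (u * a * Complex.I * ((u⁻¹ * c).re : ℝ)) := by
        rw [← h1]; field_simp; ring
      rw [h2, hcW, hW]
      simp only
      linear_combination (-2 * Complex.I * a * ((u⁻¹ * c).re : ℝ)) * huu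
    change antiPart Q = -(fderiv ℝ W ζ (W ζ) / W ζ ^ 2)
    rw [hWd.fderiv, hAv, hreW, antiPart, hQ', hQ', hre1, hreI, Complex.ofReal_one]
    generalize W ζ = w
    calc _ = -(Complex.I * a * (u.re + u.im * Complex.I)) / w ^ 2 := by ring
      _ = _ := by rw [Complex.re_add_im]; ring

theorem IsBoundedDomainWithHolderBoundary.exists_isTangentChart {k : ℕ} {α ε : ℝ} (hε0 : 0 < ε)
    (hεα : ε ≤ α) {D : Set ℂ} (hD : IsBoundedDomainWithHolderBoundary (k + 1) α D) {p : ℂ}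
    (hp : p ∈ closure D) : ∃ r > 0, ∃ W, IsTangentChart k ε D p r W := by
  by_cases hpD : p ∈ D
  · obtain ⟨r, hr, hrD⟩ := Metric.isOpen_iff.1 hD.isOpen p hpD
    -- inside `D`, the whole disc lies above a horizontal line
    refine ⟨r, hr, _, isTangentChart_of_graph (u := 1) (φ := fun _ => -r) (K := 0) (α := α)
      hε0 hεα hD.isOpen hD.isBounded norm_one contDiff_const (fun s t => by
        simp [iteratedDeriv_succ']) fun z hz => ?_⟩
    refine iff_of_true (hrD hz) ?_
    have h1 : |((z - p) / 1).im| < r := (Complex.abs_im_le_norm _).trans_lt (by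
      simpa [dist_eq_norm] using hz)
    exact (abs_lt.1 h1).1
  · obtain ⟨u, r, φ, K, hu, hr, hφ, hK, hg⟩ := hD.boundary p (by
      rw [frontier, hD.isOpen.interior_eq]; exact ⟨hp, hpD⟩)
    exact ⟨r, hr, _, isTangentChart_of_graph hε0 hεα hD.isOpen hD.isBounded hu hφ hK hg⟩

open scoped Manifold ContDiff in
/-- Finitely many tangent charts cover the closure of `D`, with a smooth partition of unity there.
-/
theorem IsBoundedDomainWithHolderBoundary.exists_tangentFamily {k : ℕ} {α ε : ℝ} (hε0 : 0 < ε)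
    (hεα : ε ≤ α) {D : Set ℂ} (hD : IsBoundedDomainWithHolderBoundary (k + 1) α D) :
    ∃ (t : Finset ℂ) (r : ℂ → ℝ) (W χ : ℂ → ℂ → ℂ),
      (∀ p ∈ t, IsTangentChart k ε D p (r p) (W p) ∧ ContDiff ℝ ∞ (χ p) ∧
        tsupport (χ p) ⊆ ball p (r p)) ∧ ∀ ζ ∈ D, ∑ p ∈ t, χ p ζ = 1 := by
  have h := fun p (hp : p ∈ closure D) => hD.exists_isTangentChart hε0 hεα hp
  choose! r hr W hW using h
  obtain ⟨t, htD, ht⟩ := hD.isBounded.isCompact_closure.elim_nhds_subcover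
    (fun p => ball p (r p)) fun p hp => ball_mem_nhds p (hr p hp)
  obtain ⟨f, hf⟩ := SmoothPartitionOfUnity.exists_isSubordinate 𝓘(ℝ, ℂ) (isClosed_closure (s := D))
    (fun p : t => ball (p : ℂ) (r p)) (fun _ => isOpen_ball) (by
      simpa [iUnion_subtype] using ht)
  classical
  refine ⟨t, r, W, fun p ζ => if hp : p ∈ t then (f ⟨p, hp⟩ ζ : ℂ) else 0, fun p hp => ?_,
    fun ζ hζ => ?_⟩
  · simp only [hp, dif_pos]
    refine ⟨hW p (htD p hp), Complex.ofRealCLM.contDiff.comp (f ⟨p, hp⟩).contMDiff.contDiff, ?_⟩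
    refine (closure_mono fun ζ hζ => ?_).trans (hf ⟨p, hp⟩)
    simpa using hζ
  · have h1 := f.sum_eq_one (subset_closure hζ)
    rw [finsum_eq_sum_of_fintype] at h1
    rw [← Finset.sum_coe_sort t]
    simp only [Subtype.coe_eta, Finset.coe_mem, dif_pos]
    exact_mod_cast h1

theorem IsTangentChart.ne_zero {k : ℕ} {ε r : ℝ} {D : Set ℂ} {p : ℂ} {W : ℂ → ℂ}
    (h : IsTangentChart k ε D p r W) (ζ : ℂ) : W ζ ≠ 0 :=
  norm_pos_iff.1 (one_pos.trans_le (h.one_le_norm ζ))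

theorem isBddC1On_one (D : Set ℂ) : IsBddC1On 1 (fun _ : ℂ => (1 : ℂ)) D :=
  ⟨contDiffOn_const, by simp, by simp⟩

theorem ContDiff.exists_isBddC1On {D : Set ℂ} (hD : IsOpen D) (hb : Bornology.IsBounded D)
    {q : ℂ → ℂ} (hq : ContDiff ℝ 1 q) : ∃ M, IsBddC1On M q D := by
  simpa using (isBddC1On_one D).smooth_mul hD hb hq

/-- With `b = conj W / W` and `q = u / W`, the tangential divergence `∂(χ u) + ∂̄(b χ u)` is the
derivative of `χ q` along `W`. -/
theorem holPart_add_antiPart_eq_fderiv {q W : ℂ → ℂ} {ζ : ℂ} (hW0 : ∀ ζ, W ζ ≠ 0)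
    (hW : DifferentiableAt ℝ W ζ) (hq : DifferentiableAt ℝ q ζ)
    (hanti : antiPart (fderiv ℝ (fun ζ => (starRingEnd ℂ) (W ζ) / W ζ) ζ) =
      -(fderiv ℝ W ζ (W ζ) / W ζ ^ 2)) :
    holPart (fderiv ℝ q ζ) +
      antiPart (fderiv ℝ (fun ζ => (starRingEnd ℂ) (W ζ) / W ζ * q ζ) ζ) =
      fderiv ℝ (fun ζ => q ζ * (W ζ)⁻¹) ζ (W ζ) := by
  have hB : DifferentiableAt ℝ (fun ζ => (starRingEnd ℂ) (W ζ) / W ζ) ζ := by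
    simp only [div_eq_mul_inv]
    exact ((Complex.conjCLE : ℂ →L[ℝ] ℂ).differentiableAt.comp ζ hW).mul (hW.fun_inv (hW0 ζ))
  have hinv : HasFDerivAt (fun z => (W z)⁻¹) (-((W ζ) ^ 2)⁻¹ • fderiv ℝ W ζ) ζ :=
    (hasDerivAt_inv (hW0 ζ)).comp_hasFDerivAt_of_eq ζ hW.hasFDerivAt rfl
  rw [(show HasFDerivAt (fun ζ => (starRingEnd ℂ) (W ζ) / W ζ * q ζ) _ ζ from
      hB.hasFDerivAt.mul hq.hasFDerivAt).fderiv, (show HasFDerivAt (fun ζ => q ζ * (W ζ)⁻¹) _ ζ from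
      hq.hasFDerivAt.mul hinv).fderiv]
  have h1 : ∀ (A B : ℂ →L[ℝ] ℂ) (a b : ℂ), antiPart (a • A + b • B) =
      a * antiPart A + b * antiPart B := fun A B a b => by
    simp [antiPart]; ring
  rw [h1, hanti]
  have h2 := clm_apply_eq_holPart_add_antiPart (fderiv ℝ q ζ) (W ζ)
  simp only [add_apply, FunLike.coe_smul, Pi.smul_apply, smul_eq_mul, neg_smul,
    FunLike.coe_neg, Pi.neg_apply]
  rw [h2]
  have := hW0 ζ
  field_simp
  ring

/-- For `k ≥ 1`, patching the fields `conj W / W` of the tangent charts gives a tangential field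
of class `C^k`. -/
theorem IsBoundedDomainWithHolderBoundary.exists_isTangentialOn {k : ℕ} (hk : 1 ≤ k) {α ε : ℝ}
    (hε0 : 0 < ε) (hε1 : ε ≤ 1) (hεα : ε ≤ α) {D : Set ℂ}
    (hD : IsBoundedDomainWithHolderBoundary (k + 1) α D) :
    ∃ b : ℂ → ℂ, ContDiff ℝ 1 b ∧ IsTangentialOn b D ∧
      ∀ R > 0, ∃ M, RegOn coordDirections (fun z w : ℂ => ‖z - w‖ ^ ε) (ball 0 R) k M b := by
  obtain ⟨t, r, W, χ, h, hχ1⟩ := hD.exists_tangentFamily hε0 hεα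
  have hb := hD.isBounded
  have hDo := hD.isOpen
  have hW1 : ∀ p ∈ t, ContDiff ℝ 1 (W p) := fun p hp =>
    (h p hp).1.contDiff.of_le (by exact_mod_cast hk)
  have hχC : ∀ p ∈ t, ContDiff ℝ 1 (χ p) := fun p hp => (h p hp).2.1.of_le (by simp)
  have hinv : ∀ p ∈ t, ContDiff ℝ 1 fun ζ => (W p ζ)⁻¹ := fun p hp =>
    (hW1 p hp).inv (h p hp).1.ne_zero
  have hconj : ∀ p ∈ t, ContDiff ℝ 1 fun ζ => (starRingEnd ℂ) (W p ζ) := fun p hp =>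
    (Complex.conjCLE : ℂ →L[ℝ] ℂ).contDiff.comp (hW1 p hp)
  have hB : ∀ p ∈ t, ContDiff ℝ 1 fun ζ => (starRingEnd ℂ) (W p ζ) / W p ζ := fun p hp => by
    simp only [div_eq_mul_inv]
    exact (hconj p hp).mul (hinv p hp)
  set b : ℂ → ℂ := fun ζ => ∑ p ∈ t, χ p ζ * ((starRingEnd ℂ) (W p ζ) / W p ζ) with hbdef
  have hbC : ContDiff ℝ 1 b := ContDiff.sum fun p hp => (hχC p hp).mul (hB p hp)
  refine ⟨b, hbC, fun M u hu => ?_, fun R hR => ?_⟩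
  · have hv : ∀ p ∈ t, ∃ M', IsBddC1On M' (fun ζ => (W p ζ)⁻¹ * u ζ) D := fun p hp =>
      hu.smooth_mul hDo hb (hinv p hp)
    have hint : ∀ p ∈ t, IntegrableOn
        (fun ζ => fderiv ℝ (fun ζ => χ p ζ * ((W p ζ)⁻¹ * u ζ)) ζ (W p ζ)) D := fun p hp => by
      obtain ⟨M', hM'⟩ := hv p hp
      obtain ⟨M'', hM''⟩ := hM'.smooth_mul hDo hb (hχC p hp)
      exact hM''.integrableOn_fderiv_apply hDo hb (hW1 p hp).continuous
    have hpt : ∀ ζ ∈ D, holPart (fderiv ℝ u ζ) + antiPart (fderiv ℝ (fun ζ => b ζ * u ζ) ζ) =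
        ∑ p ∈ t, fderiv ℝ (fun ζ => χ p ζ * ((W p ζ)⁻¹ * u ζ)) ζ (W p ζ) := by
      intro ζ hζ
      have hud := (hu.hasFDerivAt hDo hζ).differentiableAt
      have hχd : ∀ p ∈ t, DifferentiableAt ℝ (χ p) ζ := fun p hp =>
        (hχC p hp).differentiable one_ne_zero ζ
      have hBd : ∀ p ∈ t, DifferentiableAt ℝ (fun ζ => (starRingEnd ℂ) (W p ζ) / W p ζ) ζ :=
        fun p hp => (hB p hp).differentiable one_ne_zero ζ
      have e1 : fderiv ℝ u ζ = ∑ p ∈ t, fderiv ℝ (fun ζ => χ p ζ * u ζ) ζ := by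
        rw [← fderiv_fun_sum fun p hp => (hχd p hp).fun_mul hud]
        refine Filter.EventuallyEq.fderiv_eq ?_
        filter_upwards [hDo.mem_nhds hζ] with w hw
        rw [← Finset.sum_mul, hχ1 w hw, one_mul]
      have e2 : fderiv ℝ (fun ζ => b ζ * u ζ) ζ = ∑ p ∈ t,
          fderiv ℝ (fun ζ => (starRingEnd ℂ) (W p ζ) / W p ζ * (χ p ζ * u ζ)) ζ := by
        rw [← fderiv_fun_sum fun p hp => (hBd p hp).fun_mul ((hχd p hp).fun_mul hud)]
        congr 1
        funext w
        rw [hbdef]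
        simp only
        rw [Finset.sum_mul]
        exact Finset.sum_congr rfl fun p _ => by ring
      have e3 : ∀ A : ℂ → ℂ →L[ℝ] ℂ, holPart (∑ p ∈ t, A p) = ∑ p ∈ t, holPart (A p) := fun A => by
        simp [holPart, Finset.mul_sum, ← Finset.sum_sub_distrib, Finset.sum_div]
      have e4 : ∀ A : ℂ → ℂ →L[ℝ] ℂ, antiPart (∑ p ∈ t, A p) = ∑ p ∈ t, antiPart (A p) := fun A => by
        simp [antiPart, Finset.mul_sum, ← Finset.sum_add_distrib, Finset.sum_div]
      rw [e1, e2, e3, e4, ← Finset.sum_add_distrib]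
      refine Finset.sum_congr rfl fun p hp => ?_
      rw [holPart_add_antiPart_eq_fderiv (q := fun ζ => χ p ζ * u ζ) (h p hp).1.ne_zero
        ((hW1 p hp).differentiable one_ne_zero ζ) ((hχd p hp).mul hud)
        ((h p hp).1.antiPart_fderiv hk ζ)]
      congr 2
      funext w
      ring
    rw [setIntegral_congr_fun hDo.measurableSet hpt, integral_finsetSum t hint]
    refine Finset.sum_eq_zero fun p hp => ?_
    obtain ⟨M', hM'⟩ := hv p hp
    exact (h p hp).1.integral_eq_zero (χ p) (hχC p hp) (h p hp).2.2 M' _ hM'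
  · have hd0 : ∀ z w : ℂ, 0 ≤ ‖z - w‖ ^ ε := fun z w => by positivity
    have hL := lipBound_ball (R := R) hε0.le hε1
    have hΛ : 1 ≤ 2 * (1 + 2 * R) := by linarith
    obtain ⟨C, -, hmul⟩ := RegOn.mul (d := fun z w : ℂ => ‖z - w‖ ^ ε) isOpen_ball hd0 hΛ hL k
    refine RegOn.sum isOpen_ball hd0 t fun p hp => ?_
    obtain ⟨M, hM⟩ := (h p hp).1.regOn R hR
    obtain ⟨M', hM'⟩ := hM.inv isOpen_ball hd0 hΛ hL (fun z _ => (h p hp).1.one_le_norm z)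
    obtain ⟨M'', hM''⟩ := ContDiff.exists_regOn_ball hR hε0.le hε1 k (χ p)
      ((h p hp).2.1.of_le (by exact_mod_cast le_top))
    exact ⟨_, hmul _ _ _ _ hM'' (by
      simp only [div_eq_mul_inv]
      exact hmul _ _ _ _ (hM.conj isOpen_ball) hM')⟩

/-! ### The Cauchy transform of a domain -/

/-- An integrand of size `1 / (d |z - ζ|)` on the disc of radius `d` about `z` has an integral
bounded independently of `d`. -/
theorem norm_setIntegral_le_of_scaled {D : Set ℂ} (hD : MeasurableSet D) {F : ℂ → ℂ} {z : ℂ}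
    {d K : ℝ} (hd : 0 < d) (hK : 0 ≤ K) (hF : ∀ ζ ∈ D, ‖F ζ‖ ≤ K / d * ‖z - ζ‖⁻¹)
    (hF0 : ∀ ζ, ζ ∉ closedBall z d → F ζ = 0) : ‖∫ ζ in D, F ζ‖ ≤ 4 * Real.pi * K := by
  have hGi : IntegrableOn (fun ζ => K / d * ‖z - ζ‖⁻¹) (ball z (2 * d)) :=
    (integrableOn_ball_norm_sub_inv z (2 * d)).const_mul _
  have hGi' := (integrable_indicator_iff (μ := volume) measurableSet_ball).2 hGi
  have h0 : ∀ ζ, 0 ≤ (ball z (2 * d)).indicator (fun ζ => K / d * ‖z - ζ‖⁻¹) ζ := fun ζ =>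
    indicator_nonneg (fun ζ _ => by positivity) ζ
  calc ‖∫ ζ in D, F ζ‖ ≤ ∫ ζ in D, (ball z (2 * d)).indicator (fun ζ => K / d * ‖z - ζ‖⁻¹) ζ := by
        refine norm_integral_le_of_norm_le hGi'.integrableOn ?_
        filter_upwards [ae_restrict_mem hD] with ζ hζ
        by_cases h : ζ ∈ closedBall z d
        · rw [indicator_of_mem (closedBall_subset_ball (by linarith) h)]
          exact hF ζ hζ
        · rw [hF0 ζ h, norm_zero]
          exact h0 ζ
    _ ≤ ∫ ζ, (ball z (2 * d)).indicator (fun ζ => K / d * ‖z - ζ‖⁻¹) ζ :=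
        setIntegral_le_integral hGi' (Filter.Eventually.of_forall h0)
    _ = K / d * (2 * Real.pi * (2 * d)) := by
        rw [integral_indicator measurableSet_ball, integral_const_mul,
          setIntegral_ball_norm_sub_inv z (by positivity)]
    _ = _ := by field_simp; ring

theorem RegOn.exists_of_le {E : Type*} [NormedAddCommGroup E] [NormedSpace ℝ E] {𝓥 : Set E}
    {d : E → E → ℝ} {Ω : Set E} {Λ : ℝ} (hΛ : 1 ≤ Λ) (hL : LipBound 𝓥 d Ω Λ) {f : E → ℂ} {m k : ℕ}
    (hmk : m ≤ k) : ∀ {M : ℝ}, RegOn 𝓥 d Ω k M f → ∃ M', RegOn 𝓥 d Ω m M' f := by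
  induction k, hmk using Nat.le_induction with
  | base => exact fun h => ⟨_, h⟩
  | succ k _ ih => exact fun h => ih (h.of_succ hΛ hL)

/-- A cutoff function of scale `d` at `z`: equal to `1` near `z`, to `0` off the disc of radius
`d`, with derivative at most `B / d`. -/
structure IsCutoffAt (B d : ℝ) (z : ℂ) (η : ℂ → ℂ) : Prop where
  contDiff : ContDiff ℝ 1 η
  eventually_eq_one : ∀ᶠ ζ in nhds z, η ζ = 1
  eq_zero : ∀ ζ, ζ ∉ closedBall z d → η ζ = 0
  norm_one_sub_le : ∀ ζ, ‖1 - η ζ‖ ≤ 1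
  norm_fderiv_le : ∀ ζ, ‖fderiv ℝ η ζ‖ ≤ B / d

theorem IsCutoffAt.fderiv_eq_zero {B d : ℝ} {z : ℂ} {η : ℂ → ℂ} (h : IsCutoffAt B d z η) {ζ : ℂ}
    (hζ : ζ ∉ closedBall z d) : fderiv ℝ η ζ = 0 := by
  have h1 : η =ᶠ[nhds ζ] fun _ => 0 := by
    filter_upwards [isClosed_closedBall.isOpen_compl.mem_nhds hζ] with w hw
    exact h.eq_zero w hw
  rw [h1.fderiv_eq]; simp

/-- The constant `B` does not depend on the scale, since the cutoff functions are rescalings of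
one. -/
theorem exists_isCutoffAt : ∃ B ≥ 0, ∀ (z : ℂ) (d : ℝ), 0 < d → ∃ η, IsCutoffAt B d z η := by
  let f : ContDiffBump (0 : ℂ) := ⟨1 / 2, 1, by positivity, by norm_num⟩
  have hf : ContDiff ℝ 1 fun ζ => (f ζ : ℂ) := Complex.ofRealCLM.contDiff.comp f.contDiff
  have hfc : HasCompactSupport (fderiv ℝ fun ζ => (f ζ : ℂ)) :=
    HasCompactSupport.fderiv (𝕜 := ℝ) (f.hasCompactSupport.mono fun ζ hζ => by simpa using hζ)
  obtain ⟨B, hB⟩ := hfc.exists_bound_of_continuous (hf.continuous_fderiv one_ne_zero)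
  have hB0 : 0 ≤ B := (norm_nonneg _).trans (hB 0)
  refine ⟨B, hB0, fun z d hd => ⟨fun ζ => (f (d⁻¹ • (ζ - z)) : ℂ), ?_, ?_, fun ζ hζ => ?_,
    fun ζ => ?_, fun ζ => ?_⟩⟩
  · exact hf.comp ((contDiff_id.sub contDiff_const).const_smul d⁻¹)
  · have h1 : Filter.Tendsto (fun ζ : ℂ => d⁻¹ • (ζ - z)) (nhds z) (nhds 0) := by
      have : Continuous fun ζ : ℂ => d⁻¹ • (ζ - z) := by fun_prop
      simpa using this.tendsto z
    filter_upwards [h1.eventually f.eventuallyEq_one] with ζ hζ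
    rw [hζ]; simp
  · rw [f.zero_of_le_dist, Complex.ofReal_zero]
    rw [mem_closedBall, not_le, dist_eq_norm] at hζ
    rw [dist_zero_right, norm_smul, norm_inv, Real.norm_of_nonneg hd.le, inv_mul_eq_div,
      le_div_iff₀ hd]
    simpa [f] using hζ.le
  · rw [← Complex.ofReal_one, ← Complex.ofReal_sub, Complex.norm_real, Real.norm_eq_abs, abs_le]
    constructor <;> linarith [f.nonneg (x := d⁻¹ • (ζ - z)), f.le_one (x := d⁻¹ • (ζ - z))]
  · have h1 : HasFDerivAt (fun ζ : ℂ => d⁻¹ • (ζ - z)) (d⁻¹ • ContinuousLinearMap.id ℝ ℂ) ζ :=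
      ((hasFDerivAt_id ζ).sub_const z).const_smul d⁻¹
    have h2 := HasFDerivAt.comp ζ (g := fun ζ => (f ζ : ℂ)) (f := fun ζ : ℂ => d⁻¹ • (ζ - z))
      (hf.differentiable one_ne_zero _).hasFDerivAt h1
    rw [(show HasFDerivAt (fun ζ => (f (d⁻¹ • (ζ - z)) : ℂ)) _ ζ from h2).fderiv]
    refine (ContinuousLinearMap.opNorm_comp_le _ _).trans ?_
    rw [div_eq_mul_inv, norm_smul, norm_inv, Real.norm_of_nonneg hd.le]
    refine mul_le_mul (hB _) ?_ (by positivity) hB0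
    exact mul_le_of_le_one_right (by positivity) ContinuousLinearMap.norm_id_le

/-- In a tangent chart, the truncations of the singular integral of `1 / (z - ζ) ^ 2` are bounded,
uniformly in the point and in the truncation: multiplying by `W z = W ζ + (W z - W ζ)`, the first
term is integrated by parts along `W`, and the second one makes the singularity integrable. -/
theorem IsTangentChart.exists_norm_setIntegral_le {k : ℕ} {ε r : ℝ} (hε0 : 0 < ε) (hε1 : ε ≤ 1)
    {D : Set ℂ} (hD : IsOpen D) (hb : Bornology.IsBounded D) {p : ℂ} {W χ : ℂ → ℂ}
    (h : IsTangentChart k ε D p r W) (hχ : ContDiff ℝ 1 χ) (hχs : tsupport χ ⊆ ball p r)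
    {B : ℝ} (hB : 0 ≤ B) :
    ∃ C, ∀ z ∈ D, ∀ (d : ℝ) (η : ℂ → ℂ), 0 < d → IsCutoffAt B d z η →
      ‖∫ ζ in D, χ ζ * ((1 - η ζ) / (z - ζ) ^ 2)‖ ≤ C := by
  obtain ⟨R, hR, hDR⟩ := hb.subset_ball_lt 0 0
  have hW := h.contDiff.continuous
  obtain ⟨M, hM⟩ : ∃ M, RegOn coordDirections (fun z w : ℂ => ‖z - w‖ ^ ε) (ball 0 R) 0 M W := by
    obtain ⟨M, hM⟩ := h.regOn R hR
    exact hM.exists_of_le (by linarith) (lipBound_ball hε0.le hε1) (Nat.zero_le k)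
  have hM0 : 0 ≤ M := (norm_nonneg _).trans (hM.2.1 0 (mem_ball_self hR))
  obtain ⟨N₁, hN₁⟩ := hχ.exists_isBddC1On hD hb
  set N := max N₁ 0 with hN
  have hN0 : 0 ≤ N := le_max_right _ _
  have hχ0 : ∀ ζ ∈ D, ‖χ ζ‖ ≤ N := fun ζ hζ => (hN₁.norm_le ζ hζ).trans (le_max_left _ _)
  have hχ1 : ∀ ζ ∈ D, ‖fderiv ℝ χ ζ‖ ≤ N := fun ζ hζ =>
    (hN₁.norm_fderiv_le ζ hζ).trans (le_max_left _ _)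
  obtain ⟨C₁, hC₁0, hC₁⟩ := exists_setIntegral_norm_sub_inv_le hb
  obtain ⟨C₂, hC₂0, hC₂⟩ := exists_setIntegral_norm_sub_rpow_le hb (s := 2 - ε) (by linarith)
    (by linarith)
  refine ⟨N * M * C₁ + 4 * Real.pi * (N * M * B) + N * M * C₂, fun z hz d η hd hη => ?_⟩
  have hWM : ∀ ζ ∈ D, ‖W ζ‖ ≤ M := fun ζ hζ => hM.2.1 ζ (hDR hζ)
  have hηc := hη.contDiff
  -- the truncated kernel
  set κ : ℂ → ℂ := fun ζ => (1 - η ζ) / (z - ζ) with hκ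
  have hκ0 : ∀ᶠ ζ in nhds z, κ ζ = 0 := by
    filter_upwards [hη.eventually_eq_one] with ζ hζ
    rw [hκ]; simp [hζ]
  have hκc : ContDiff ℝ 1 κ := by
    rw [contDiff_iff_contDiffAt]
    intro ζ
    by_cases hζ : ζ = z
    · rw [hζ]
      exact contDiffAt_const.congr_of_eventuallyEq hκ0
    · rw [hκ]
      simp only [div_eq_mul_inv]
      exact (contDiffAt_const.sub hηc.contDiffAt).mul ((contDiffAt_const.sub contDiffAt_id).inv
        (sub_ne_zero.2 (Ne.symm hζ)))
  obtain ⟨Mκ, hMκ⟩ := hκc.exists_isBddC1On hD hb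
  have hzero := h.integral_eq_zero χ hχ hχs Mκ κ hMκ
  -- the derivative along `W` falls on `χ` (`F₁`), on `η` (`F₂`) or on the kernel;
  -- in the last case `W ζ` is replaced by `W z`, with the error `F₃`
  set F₁ : ℂ → ℂ := fun ζ => (1 - η ζ) * fderiv ℝ χ ζ (W ζ) / (z - ζ) with hF₁
  set F₂ : ℂ → ℂ := fun ζ => χ ζ * fderiv ℝ η ζ (W ζ) / (z - ζ) with hF₂
  set F₃ : ℂ → ℂ := fun ζ => χ ζ * ((1 - η ζ) / (z - ζ) ^ 2) * (W z - W ζ) with hF₃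
  have hpt : ∀ ζ, χ ζ * ((1 - η ζ) / (z - ζ) ^ 2) * W z =
      fderiv ℝ (fun ζ => χ ζ * κ ζ) ζ (W ζ) - F₁ ζ + F₂ ζ + F₃ ζ := by
    intro ζ
    by_cases hζ : ζ = z
    · have h1 : fderiv ℝ (fun ζ => χ ζ * κ ζ) z = 0 := by
        have : (fun ζ => χ ζ * κ ζ) =ᶠ[nhds z] fun _ => 0 := by
          filter_upwards [hκ0] with w hw
          rw [hw, mul_zero]
        rw [this.fderiv_eq]; simp
      simp [hζ, hF₁, hF₂, hF₃, h1]
    · have hζ' : z - ζ ≠ 0 := sub_ne_zero.2 (Ne.symm hζ)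
      have hq : DifferentiableAt ℝ (fun ζ => χ ζ * (1 - η ζ)) ζ :=
        (hχ.differentiable one_ne_zero ζ).mul
          ((hηc.differentiable one_ne_zero ζ).const_sub 1)
      have hinv : HasFDerivAt (fun ζ : ℂ => (z - ζ)⁻¹)
          (-((z - ζ) ^ 2)⁻¹ • -(ContinuousLinearMap.id ℝ ℂ)) ζ :=
        (hasDerivAt_inv hζ').comp_hasFDerivAt_of_eq ζ ((hasFDerivAt_id ζ).const_sub z) rfl
      have hq' : HasFDerivAt (fun ζ => χ ζ * (1 - η ζ))
          (χ ζ • -fderiv ℝ η ζ + (1 - η ζ) • fderiv ℝ χ ζ) ζ :=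
        (hχ.differentiable one_ne_zero ζ).hasFDerivAt.mul
          ((hηc.differentiable one_ne_zero ζ).hasFDerivAt.const_sub 1)
      have hm : HasFDerivAt (fun ζ => χ ζ * κ ζ) _ ζ :=
        (hq'.mul hinv).congr_of_eventuallyEq (Filter.Eventually.of_forall fun ζ => by
          simp [hκ, div_eq_mul_inv, mul_assoc])
      rw [hm.fderiv]
      simp only [hF₁, hF₂, hF₃, add_apply, FunLike.coe_smul, Pi.smul_apply, smul_eq_mul, neg_smul,
        smul_neg, neg_neg, FunLike.coe_neg, Pi.neg_apply, ContinuousLinearMap.coe_id', id]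
      field_simp
      ring
  have hcfd : ∀ {q : ℂ → ℂ}, ContDiff ℝ 1 q → Continuous fun ζ => fderiv ℝ q ζ (W ζ) :=
    fun hq => (hq.continuous_fderiv one_ne_zero).clm_apply hW
  have hF₁n : ∀ ζ ∈ D, ‖F₁ ζ‖ ≤ N * M * ‖z - ζ‖⁻¹ := by
    intro ζ hζ
    rw [hF₁, norm_div, norm_mul, div_eq_mul_inv]
    refine mul_le_mul_of_nonneg_right ?_ (by positivity)
    have h1 := (fderiv ℝ χ ζ).le_opNorm (W ζ)
    have h2 := mul_le_mul (hχ1 ζ hζ) (hWM ζ hζ) (norm_nonneg _) hN0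
    have h3 := mul_le_mul_of_nonneg_right (hη.norm_one_sub_le ζ)
      (norm_nonneg (fderiv ℝ χ ζ (W ζ)))
    linarith
  have hF₂n : ∀ ζ ∈ D, ‖F₂ ζ‖ ≤ N * M * B / d * ‖z - ζ‖⁻¹ := by
    intro ζ hζ
    rw [hF₂, norm_div, norm_mul, div_eq_mul_inv]
    refine mul_le_mul_of_nonneg_right ?_ (by positivity)
    have h1 := ((fderiv ℝ η ζ).le_opNorm (W ζ)).trans
      (mul_le_mul (hη.norm_fderiv_le ζ) (hWM ζ hζ) (norm_nonneg _) (by positivity))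
    have h2 := mul_le_mul (hχ0 ζ hζ) h1 (norm_nonneg _) hN0
    refine h2.trans (le_of_eq ?_)
    ring
  have hF₃n : ∀ ζ ∈ D, ‖F₃ ζ‖ ≤ N * M * ‖z - ζ‖ ^ (-(2 - ε)) := by
    intro ζ hζ
    by_cases hζz : ζ = z
    · simp only [hF₃, hζz, sub_self, mul_zero, norm_zero]
      positivity
    have hpos : 0 < ‖z - ζ‖ := norm_pos_iff.2 (sub_ne_zero.2 (Ne.symm hζz))
    rw [hF₃, norm_mul, norm_mul, norm_div, norm_pow]
    have h1 := hM.2.2 z (hDR hz) ζ (hDR hζ)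
    have h2 : ‖1 - η ζ‖ / ‖z - ζ‖ ^ 2 ≤ ‖z - ζ‖ ^ (-2 : ℝ) := by
      rw [Real.rpow_neg hpos.le, Real.rpow_two, div_eq_mul_inv]
      exact mul_le_of_le_one_left (by positivity) (hη.norm_one_sub_le ζ)
    have h3 := mul_le_mul (mul_le_mul (hχ0 ζ hζ) h2 (by positivity) hN0) h1 (norm_nonneg _)
      (by positivity)
    refine h3.trans (le_of_eq ?_)
    rw [show -(2 - ε) = -2 + ε by ring, Real.rpow_add hpos]
    ring
  have hm : ∀ {q : ℂ → ℂ}, Continuous q → AEStronglyMeasurable (fun ζ => q ζ / (z - ζ))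
      (volume.restrict D) := fun hq =>
    aestronglyMeasurable_div hq.aestronglyMeasurable (by fun_prop)
  have hF₁i : IntegrableOn F₁ D := by
    refine ((hC₁ z).1.const_mul (N * M)).mono' (hm ?_)
      ((ae_restrict_mem hD.measurableSet).mono hF₁n)
    exact (continuous_const.sub hηc.continuous).mul (hcfd hχ)
  have hF₂i : IntegrableOn F₂ D := by
    refine ((hC₁ z).1.const_mul (N * M * B / d)).mono' (hm ?_)
      ((ae_restrict_mem hD.measurableSet).mono hF₂n)
    exact hχ.continuous.mul (hcfd hηc)
  have hF₃i : IntegrableOn F₃ D := by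
    refine ((hC₂ z).1.const_mul (N * M)).mono' ?_
      ((ae_restrict_mem hD.measurableSet).mono hF₃n)
    refine (hχ.continuous.aestronglyMeasurable.mul (aestronglyMeasurable_div
      (continuous_const.sub hηc.continuous).aestronglyMeasurable (by fun_prop))).mul
      (continuous_const.sub hW).aestronglyMeasurable
  have hF₀i : IntegrableOn (fun ζ => fderiv ℝ (fun ζ => χ ζ * κ ζ) ζ (W ζ)) D := by
    obtain ⟨M', hM'⟩ := hMκ.smooth_mul hD hb hχ
    exact hM'.integrableOn_fderiv_apply hD hb hW
  have hsum : (∫ ζ in D, χ ζ * ((1 - η ζ) / (z - ζ) ^ 2)) * W z =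
      -(∫ ζ in D, F₁ ζ) + (∫ ζ in D, F₂ ζ) + ∫ ζ in D, F₃ ζ := by
    rw [← integral_mul_const, setIntegral_congr_fun hD.measurableSet fun ζ _ => hpt ζ,
      integral_add (f := fun ζ => fderiv ℝ (fun ζ => χ ζ * κ ζ) ζ (W ζ) - F₁ ζ + F₂ ζ)
        ((hF₀i.sub hF₁i).add hF₂i) hF₃i,
      integral_add (f := fun ζ => fderiv ℝ (fun ζ => χ ζ * κ ζ) ζ (W ζ) - F₁ ζ)
        (hF₀i.sub hF₁i) hF₂i, integral_sub hF₀i hF₁i, hzero, zero_sub]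
  have hb₁ : ‖∫ ζ in D, F₁ ζ‖ ≤ N * M * C₁ := by
    refine (norm_integral_le_of_norm_le ((hC₁ z).1.const_mul (N * M))
      ((ae_restrict_mem hD.measurableSet).mono hF₁n)).trans ?_
    rw [integral_const_mul]
    exact mul_le_mul_of_nonneg_left (hC₁ z).2 (by positivity)
  have hb₂ : ‖∫ ζ in D, F₂ ζ‖ ≤ 4 * Real.pi * (N * M * B) := by
    refine norm_setIntegral_le_of_scaled hD.measurableSet hd (by positivity) hF₂n fun ζ hζ => ?_
    simp [hF₂, hη.fderiv_eq_zero hζ]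
  have hb₃ : ‖∫ ζ in D, F₃ ζ‖ ≤ N * M * C₂ := by
    refine (norm_integral_le_of_norm_le ((hC₂ z).1.const_mul (N * M))
      ((ae_restrict_mem hD.measurableSet).mono hF₃n)).trans ?_
    rw [integral_const_mul]
    exact mul_le_mul_of_nonneg_left (hC₂ z).2 (by positivity)
  calc ‖∫ ζ in D, χ ζ * ((1 - η ζ) / (z - ζ) ^ 2)‖
      ≤ ‖∫ ζ in D, χ ζ * ((1 - η ζ) / (z - ζ) ^ 2)‖ * ‖W z‖ :=
        le_mul_of_one_le_right (norm_nonneg _) (h.one_le_norm z)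
    _ = ‖-(∫ ζ in D, F₁ ζ) + (∫ ζ in D, F₂ ζ) + ∫ ζ in D, F₃ ζ‖ := by rw [← norm_mul, hsum]
    _ ≤ ‖∫ ζ in D, F₁ ζ‖ + ‖∫ ζ in D, F₂ ζ‖ + ‖∫ ζ in D, F₃ ζ‖ := by
        refine (norm_add_le _ _).trans (add_le_add_left ((norm_add_le _ _).trans ?_) _)
        rw [norm_neg]
    _ ≤ _ := by linarith

theorem IsCutoffAt.tsupport_subset {B d : ℝ} {z : ℂ} {η : ℂ → ℂ} (h : IsCutoffAt B d z η) :
    tsupport η ⊆ closedBall z d :=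
  closure_minimal (fun ζ hζ => by_contra fun hn => hζ (h.eq_zero ζ hn)) isClosed_closedBall

/-- The Cauchy transform of the characteristic function of `D` is Lipschitz on `D`. -/
theorem IsBoundedDomainWithHolderBoundary.exists_lipschitz_cauchyTransform {k : ℕ} {α : ℝ}
    (hα0 : 0 < α) (hα1 : α ≤ 1) {D : Set ℂ} (hD : IsBoundedDomainWithHolderBoundary (k + 1) α D) :
    ∃ C ≥ 0, ∀ z ∈ D, ∀ w ∈ D,
      ‖(∫ ζ in D, 1 / (z - ζ)) - ∫ ζ in D, 1 / (w - ζ)‖ ≤ C * ‖z - w‖ := by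
  obtain ⟨t, r, W, χ, h, hχ1⟩ := hD.exists_tangentFamily hα0 le_rfl
  have hb := hD.isBounded
  have hDo := hD.isOpen
  obtain ⟨B, hB0, hB⟩ := exists_isCutoffAt
  have hχC : ∀ p ∈ t, ContDiff ℝ 1 (χ p) := fun p hp => (h p hp).2.1.of_le (by simp)
  have hC := fun p (hp : p ∈ t) =>
    (h p hp).1.exists_norm_setIntegral_le hα0 hα1 hDo hb (hχC p hp) (h p hp).2.2 hB0
  choose! C hC using hC
  set G : ℝ := 4 * Real.pi * B + |∑ p ∈ t, C p| with hG
  have hG0 : 0 ≤ G := by positivity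
  have hder : ∀ z ∈ D, ∃ L : ℂ →L[ℝ] ℂ, HasFDerivAt (fun z => ∫ ζ in D, 1 / (z - ζ)) L z ∧
      ‖L‖ ≤ G := by
    intro z hz
    obtain ⟨d, hd, hdD⟩ := Metric.nhds_basis_closedBall.mem_iff.1 (hDo.mem_nhds hz)
    obtain ⟨η, hη⟩ := hB z d hd
    obtain ⟨L, hL, hLv⟩ := (isSlicing_id hDo hb).hasFDerivAt (isBddC1On_one D) hη.contDiff
      (hη.tsupport_subset.trans hdD)
      ((isCompact_closedBall z d).of_isClosed_subset (isClosed_tsupport η) hη.tsupport_subset) hz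
      hη.eventually_eq_one
    refine ⟨L, hL, L.opNorm_le_bound hG0 fun v => ?_⟩
    -- the derivative of the cutoff has size `B / d` on a disc of radius `d`, so that the bound
    -- does not depend on the distance of `z` to the boundary
    have h1 : ‖∫ ζ in D, fderiv ℝ η ζ v / (z - ζ)‖ ≤ 4 * Real.pi * (B * ‖v‖) := by
      refine norm_setIntegral_le_of_scaled (z := z) hDo.measurableSet hd (by positivity) (fun ζ _ => ?_)
        fun ζ hζ => by
          simp [hη.fderiv_eq_zero hζ]
      rw [norm_div, div_eq_mul_inv]
      refine mul_le_mul_of_nonneg_right (((fderiv ℝ η ζ).le_opNorm v).trans ?_) (by positivity)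
      rw [mul_div_right_comm]
      exact mul_le_mul_of_nonneg_right (hη.norm_fderiv_le ζ) (norm_nonneg v)
    have hηz : ∀ ζ, ζ ≠ z → z - ζ ≠ 0 := fun ζ hζ => sub_ne_zero.2 (Ne.symm hζ)
    have hi : ∀ p ∈ t, IntegrableOn (fun ζ => χ p ζ * ((1 - η ζ) / (z - ζ) ^ 2)) D := by
      intro p hp
      have hcont : Continuous fun ζ => χ p ζ * ((1 - η ζ) / (z - ζ) ^ 2) := by
        refine (hχC p hp).continuous.mul (continuous_iff_continuousAt.2 fun ζ => ?_)
        by_cases hζ : ζ = z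
        · rw [hζ]
          refine (continuousAt_const (y := (0 : ℂ))).congr ?_
          filter_upwards [hη.eventually_eq_one] with w hw
          simp [hw]
        · exact (continuousAt_const.sub hη.contDiff.continuous.continuousAt).div
            ((continuousAt_const.sub continuousAt_id).pow 2) (pow_ne_zero 2 (hηz ζ hζ))
      exact (hcont.continuousOn.integrableOn_compact hb.isCompact_closure).mono_set subset_closure
    have h2 : ‖∫ ζ in D, (1 - η ζ) / (z - ζ) ^ 2‖ ≤ ∑ p ∈ t, C p := by
      have e : ∫ ζ in D, (1 - η ζ) / (z - ζ) ^ 2 =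
          ∑ p ∈ t, ∫ ζ in D, χ p ζ * ((1 - η ζ) / (z - ζ) ^ 2) := by
        rw [← integral_finsetSum t hi]
        refine setIntegral_congr_fun hDo.measurableSet fun ζ hζ => ?_
        rw [← Finset.sum_mul, hχ1 ζ hζ, one_mul]
      rw [e]
      exact (norm_sum_le _ _).trans (Finset.sum_le_sum fun p hp => hC p hp z hz d η hd hη)
    have e : L v = (∫ ζ in D, fderiv ℝ η ζ v / (z - ζ)) -
        v * ∫ ζ in D, (1 - η ζ) / (z - ζ) ^ 2 := by
      rw [hLv v, sub_eq_add_neg (∫ ζ in D, fderiv ℝ η ζ v / (z - ζ)), ← integral_const_mul,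
        ← integral_neg]
      congr 1
      · simp
      · refine integral_congr_ae (Filter.Eventually.of_forall fun ζ => ?_)
        simp
        ring
    rw [e]
    refine (norm_sub_le _ _).trans ?_
    rw [norm_mul]
    have h3 := mul_le_mul_of_nonneg_left (h2.trans (le_abs_self _)) (norm_nonneg v)
    rw [hG]
    linarith
  obtain ⟨Λ, hΛ0, hΛ⟩ := hD.exists_lipschitz
  obtain ⟨C₁, hC₁0, hC₁⟩ := exists_setIntegral_norm_sub_inv_le hb
  refine ⟨Λ * max G C₁, by positivity, fun z hz w hw =>
    hΛ (fun z => ∫ ζ in D, 1 / (z - ζ)) (max G C₁) (fun z hz => ?_) (fun z hz => ?_)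
      (fun z hz => ?_) z hz w hw⟩
  · obtain ⟨L, hL, -⟩ := hder z hz
    exact hL.differentiableAt.differentiableWithinAt
  · refine le_trans ?_ (le_max_right _ _)
    refine (norm_integral_le_integral_norm _).trans ?_
    simpa using (hC₁ z).2
  · obtain ⟨L, hL, hLG⟩ := hder z hz
    rw [hL.fderiv]
    exact hLG.trans (le_max_left _ _)

/-! ### Regularity of the slice transform -/

/-- A modulus of continuity which lies, up to the factor `A`, between `min t 1` and `t ^ ε`, and
which is increasing up to that factor. -/
structure IsModulus (A ε : ℝ) (ω : ℝ → ℝ) : Prop where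
  one_le : 1 ≤ A
  nonneg : ∀ t, 0 ≤ ω t
  mono : ∀ s t, 0 ≤ s → s ≤ t → ω s ≤ A * ω t
  le_rpow : ∀ t, 0 ≤ t → ω t ≤ A * t ^ ε
  min_le : ∀ t, 0 ≤ t → min t 1 ≤ A * ω t

section
variable {E : Type*} [NormedAddCommGroup E] [NormedSpace ℝ E] {π : E →L[ℝ] ℂ}
  {ι : ℂ →L[ℝ] E} {V : Set ℂ} {Ω : Set E}

/-- The slicing is orthogonal in the weak sense that the two projections have norm at most one. -/
structure IsSlicing.IsContractive (π : E →L[ℝ] ℂ) (ι : ℂ →L[ℝ] E) : Prop where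
  norm_proj_le : ∀ v, ‖π v‖ ≤ ‖v‖
  norm_incl_le : ∀ c, ‖ι c‖ ≤ ‖c‖
  norm_sub_le : ∀ v, ‖v - ι (π v)‖ ≤ ‖v‖

theorem IsSlicing.norm_sliceTransform_le (h : IsSlicing π ι V Ω) {C M : ℝ}
    (hC : ∀ z : ℂ, IntegrableOn (fun ζ : ℂ => ‖z - ζ‖⁻¹) V ∧ ∫ ζ in V, ‖z - ζ‖⁻¹ ≤ C) (hM0 : 0 ≤ M)
    {g : E → ℂ} (hM : ∀ z ∈ Ω, ‖g z‖ ≤ M) {z : E} (hz : z ∈ Ω) :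
    ‖sliceTransform π ι V g z‖ ≤ C * M := by
  refine (norm_integral_le_of_norm_le ((hC (π z)).1.const_mul M) ?_).trans ?_
  · filter_upwards [ae_restrict_mem h.isOpen_base.measurableSet] with ζ hζ
    rw [norm_div, div_eq_mul_inv]
    exact mul_le_mul_of_nonneg_right (hM _ (h.slice_mem z hz ζ hζ)) (by positivity)
  · rw [integral_const_mul, mul_comm]
    exact mul_le_mul_of_nonneg_right (hC (π z)).2 hM0

/-- Order zero: the slice transform maps functions with modulus of continuity
`ω |z - w| + |π z - π w| ^ ε` to functions with modulus `ω |z - w|`. In the slice direction it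
gains more, since there the transform of a constant is Lipschitz. -/
theorem IsSlicing.exists_regOn_zero_sliceTransform (h : IsSlicing π ι V Ω)
    (hπι : IsSlicing.IsContractive π ι) {A ε : ℝ} {ω : ℝ → ℝ} (hω : IsModulus A ε ω)
    (hε0 : 0 < ε) (hε1 : ε ≤ 1) {Cτ : ℝ} (hCτ0 : 0 ≤ Cτ)
    (hCτ : ∀ z ∈ V, ∀ w ∈ V,
      ‖(∫ ζ in V, 1 / (z - ζ)) - ∫ ζ in V, 1 / (w - ζ)‖ ≤ Cτ * ‖z - w‖) (𝓥 : Set E) :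
    ∃ C ≥ 0, ∀ g M, 0 ≤ M → RegOn 𝓥 (fun z w => ω ‖z - w‖ + ‖π z - π w‖ ^ ε) Ω 0 M g →
      RegOn 𝓥 (fun z w => ω ‖z - w‖) Ω 0 (C * M) (sliceTransform π ι V g) := by
  have hb := h.isBounded_base
  have hA0 : 0 ≤ A := zero_le_one.trans hω.one_le
  obtain ⟨C₁, hC₁0, hC₁⟩ := exists_setIntegral_norm_sub_inv_le hb
  obtain ⟨C₂, hC₂0, hC₂⟩ := exists_setIntegral_norm_sub_rpow_le hb (s := 2 - ε) (by linarith)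
    (by linarith)
  obtain ⟨R, hR, hVR⟩ := hb.subset_ball_lt 0 (0 : ℂ)
  set L : ℝ := 2 * (A + 1) * C₂ + Cτ with hL
  have hL0 : 0 ≤ L := by positivity
  refine ⟨C₁ + (A * C₁ + L * ((1 + 2 * R) * A)), by positivity, fun g M hM0 hg => ?_⟩
  have hVm := h.isOpen_base.measurableSet
  have hmod : ∀ z ∈ Ω, ∀ w ∈ Ω, ‖sliceTransform π ι V g z - sliceTransform π ι V g w‖ ≤
      (A * C₁ + L * ((1 + 2 * R) * A)) * M * ω ‖z - w‖ := by
    intro z hz w hw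
    have hπw := h.proj_mem w hw
    have hπz := h.proj_mem z hz
    have hgi : ∀ y ∈ Ω, ∀ c, IntegrableOn (fun ζ => g (y + ι (ζ - π y)) / (c - ζ)) V :=
      fun y hy c => h.integrableOn hg.1 hg.2.1 hy c
    -- move the density to the slice of `w`, keeping the kernel of `w`
    have h1 : ‖(∫ ζ in V, g (z + ι (ζ - π z)) / (π w - ζ)) - sliceTransform π ι V g w‖ ≤
        A * C₁ * M * ω ‖z - w‖ := by
      rw [sliceTransform, ← integral_sub (hgi z hz _) (hgi w hw _)]
      refine (norm_integral_le_of_norm_le ((hC₁ (π w)).1.const_mul (M * (A * ω ‖z - w‖))) ?_).trans ?_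
      · filter_upwards [ae_restrict_mem hVm] with ζ hζ
        rw [← sub_div, norm_div, div_eq_mul_inv]
        refine mul_le_mul_of_nonneg_right ?_ (by positivity)
        refine (hg.2.2 _ (h.slice_mem z hz ζ hζ) _ (h.slice_mem w hw ζ hζ)).trans ?_
        refine mul_le_mul_of_nonneg_left ?_ hM0
        have e1 : z + ι (ζ - π z) - (w + ι (ζ - π w)) = (z - w) - ι (π (z - w)) := by
          simp only [map_sub]; abel
        have e2 : π (z + ι (ζ - π z)) - π (w + ι (ζ - π w)) = 0 := by
          simp only [map_add, h.proj_incl]; ring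
        beta_reduce
        rw [e1, e2, norm_zero, Real.zero_rpow hε0.ne', add_zero]
        exact hω.mono _ _ (norm_nonneg _) (hπι.norm_sub_le _)
      · rw [integral_const_mul]
        refine (mul_le_mul_of_nonneg_left (hC₁ (π w)).2 (mul_nonneg hM0
          (mul_nonneg hA0 (hω.nonneg _)))).trans (le_of_eq (by ring))
    -- move the singularity from `π z` to `π w`, keeping the slice of `z`
    have hc₁ : IntegrableOn (fun ζ => 1 / (π z - ζ)) V :=
      integrableOn_div_sub hVm hb (q := fun _ => 1) (M := 1) aestronglyMeasurable_const (by simp) _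
    have hc₂ : IntegrableOn (fun ζ => 1 / (π w - ζ)) V :=
      integrableOn_div_sub hVm hb (q := fun _ => 1) (M := 1) aestronglyMeasurable_const (by simp) _
    have hsplit : sliceTransform π ι V g z - ∫ ζ in V, g (z + ι (ζ - π z)) / (π w - ζ) =
        (∫ ζ in V, (g (z + ι (ζ - π z)) - g z) * (1 / (π z - ζ) - 1 / (π w - ζ))) +
        g z * ((∫ ζ in V, 1 / (π z - ζ)) - ∫ ζ in V, 1 / (π w - ζ)) := by
      have e : ∀ ζ, (g (z + ι (ζ - π z)) - g z) * (1 / (π z - ζ) - 1 / (π w - ζ)) =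
          (g (z + ι (ζ - π z)) / (π z - ζ) - g (z + ι (ζ - π z)) / (π w - ζ)) -
          g z * (1 / (π z - ζ) - 1 / (π w - ζ)) := fun ζ => by ring
      rw [integral_congr_ae (Filter.Eventually.of_forall e),
        integral_sub (f := fun ζ => g (z + ι (ζ - π z)) / (π z - ζ) - g (z + ι (ζ - π z)) / (π w - ζ))
          (g := fun ζ => g z * (1 / (π z - ζ) - 1 / (π w - ζ)))
          ((hgi z hz _).sub (hgi z hz _)) ((hc₁.sub hc₂).const_mul _),
        integral_sub (hgi z hz _) (hgi z hz _), integral_const_mul, integral_sub hc₁ hc₂,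
        sliceTransform]
      ring
    have h2 : ‖∫ ζ in V, (g (z + ι (ζ - π z)) - g z) * (1 / (π z - ζ) - 1 / (π w - ζ))‖ ≤
        M * (A + 1) * ‖π z - π w‖ * (C₂ + C₂) := by
      refine (norm_integral_le_of_norm_le (((hC₂ (π z)).1.add (hC₂ (π w)).1).const_mul
        (M * (A + 1) * ‖π z - π w‖)) ?_).trans ?_
      · have hae : ∀ᵐ ζ ∂(volume.restrict V), ζ ≠ π w := by
          refine ae_restrict_of_ae ?_
          exact (measure_eq_zero_iff_ae_notMem.1 (measure_singleton (π w))).mono fun ζ hζ => by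
            simpa using hζ
        filter_upwards [ae_restrict_mem hVm, hae] with ζ hζ hζw
        by_cases hζz : ζ = π z
        · simp only [hζz, sub_self, map_zero, add_zero, zero_mul, norm_zero, Pi.add_apply]
          positivity
        have h3 : ‖g (z + ι (ζ - π z)) - g z‖ ≤ M * (A + 1) * ‖π z - ζ‖ ^ ε := by
          refine (hg.2.2 _ (h.slice_mem z hz ζ hζ) _ hz).trans ?_
          have e1 : z + ι (ζ - π z) - z = ι (ζ - π z) := by abel
          have e2 : π (z + ι (ζ - π z)) - π z = ζ - π z := by
            simp only [map_add, h.proj_incl]; ring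
          beta_reduce
          rw [e1, e2, mul_assoc, norm_sub_rev (π z)]
          refine mul_le_mul_of_nonneg_left ?_ hM0
          have h4 : ω ‖ι (ζ - π z)‖ ≤ A * ‖ζ - π z‖ ^ ε :=
            (hω.le_rpow _ (norm_nonneg _)).trans (mul_le_mul_of_nonneg_left
              (Real.rpow_le_rpow (norm_nonneg _) (hπι.norm_incl_le _) hε0.le) hA0)
          linarith
        rw [norm_mul]
        have h5 := norm_inv_sub_inv_mul_rpow_le hε1 hζz hζw
        have h6 := mul_le_mul_of_nonneg_right h3
          (norm_nonneg (1 / (π z - ζ) - 1 / (π w - ζ)))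
        have h7 := mul_le_mul_of_nonneg_left h5 (by positivity : 0 ≤ M * (A + 1))
        simp only [Pi.add_apply]
        linarith
      · rw [integral_const_mul, integral_add' (hC₂ (π z)).1 (hC₂ (π w)).1]
        exact mul_le_mul_of_nonneg_left (add_le_add (hC₂ (π z)).2 (hC₂ (π w)).2) (by positivity)
    have h3 : ‖g z * ((∫ ζ in V, 1 / (π z - ζ)) - ∫ ζ in V, 1 / (π w - ζ))‖ ≤
        M * (Cτ * ‖π z - π w‖) := by
      rw [norm_mul]
      exact mul_le_mul (hg.2.1 z hz) (hCτ _ hπz _ hπw) (norm_nonneg _) hM0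
    have h4 : ‖π z - π w‖ ≤ (1 + 2 * R) * A * ω ‖z - w‖ := by
      have h5 := hω.min_le ‖z - w‖ (norm_nonneg _)
      have h6 : ‖π z - π w‖ ≤ ‖z - w‖ := by rw [← map_sub]; exact hπι.norm_proj_le _
      have h7 : ‖π z - π w‖ ≤ 2 * R := by
        have hz' := hVR hπz
        have hw' := hVR hπw
        rw [mem_ball_zero_iff] at hz' hw'
        linarith [norm_sub_le (π z) (π w)]
      have h8 : ‖π z - π w‖ ≤ (1 + 2 * R) * min ‖z - w‖ 1 := by
        rcases le_total ‖z - w‖ 1 with h1 | h1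
        · rw [min_eq_left h1]
          nlinarith [norm_nonneg (z - w)]
        · rw [min_eq_right h1]
          linarith
      refine h8.trans ?_
      rw [mul_assoc]
      exact mul_le_mul_of_nonneg_left h5 (by positivity)
    have h5 : ‖sliceTransform π ι V g z - ∫ ζ in V, g (z + ι (ζ - π z)) / (π w - ζ)‖ ≤
        L * M * ‖π z - π w‖ := by
      rw [hsplit]
      refine (norm_add_le _ _).trans ((add_le_add h2 h3).trans (le_of_eq ?_))
      rw [hL]; ring
    have h6 := mul_le_mul_of_nonneg_left h4 (by positivity : 0 ≤ L * M)
    calc _ ≤ _ := norm_sub_le_norm_sub_add_norm_sub _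
            (∫ ζ in V, g (z + ι (ζ - π z)) / (π w - ζ)) _
      _ ≤ L * M * ((1 + 2 * R) * A * ω ‖z - w‖) + A * C₁ * M * ω ‖z - w‖ :=
        add_le_add (h5.trans h6) h1
      _ = _ := by ring
  have hK0 : 0 ≤ A * C₁ + L * ((1 + 2 * R) * A) := by positivity
  refine ⟨fun z hz => ?_, fun z hz => ?_, fun z hz w hw => ?_⟩
  · refine tendsto_iff_norm_sub_tendsto_zero.2 ?_
    refine squeeze_zero' (g := fun w =>
      (A * C₁ + L * ((1 + 2 * R) * A)) * M * (A * ‖w - z‖ ^ ε))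
      (Filter.Eventually.of_forall fun _ => norm_nonneg _) ?_ ?_
    · filter_upwards [self_mem_nhdsWithin] with w hw
      exact (hmod w hw z hz).trans (mul_le_mul_of_nonneg_left (hω.le_rpow _ (norm_nonneg _))
        (by positivity))
    · have hc : Continuous fun w : E => (A * C₁ + L * ((1 + 2 * R) * A)) * M * (A * ‖w - z‖ ^ ε) := by
        have : Continuous fun w : E => ‖w - z‖ ^ ε :=
          (continuous_id.sub continuous_const).norm.rpow_const fun _ => Or.inr hε0.le
        fun_prop
      have := (hc.tendsto z).mono_left (nhdsWithin_le_nhds (s := Ω))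
      simpa [Real.zero_rpow hε0.ne'] using this
  · have h1 := h.norm_sliceTransform_le hC₁ hM0 hg.2.1 hz
    have h2 : 0 ≤ (A * C₁ + L * ((1 + 2 * R) * A)) * M := by positivity
    rw [add_mul]
    linarith
  · have h1 := hmod z hz w hw
    have h2 : 0 ≤ C₁ * M * ω ‖z - w‖ := mul_nonneg (by positivity) (hω.nonneg _)
    simp only
    rw [add_mul, add_mul]
    linarith
end

theorem LipBound.mono {E : Type*} [NormedAddCommGroup E] [NormedSpace ℝ E] {𝓥 : Set E}
    {d d' : E → E → ℝ} {Ω : Set E} {Λ : ℝ} (hΛ : 0 ≤ Λ) (hd : ∀ z w, d z w ≤ d' z w)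
    (h : LipBound 𝓥 d Ω Λ) : LipBound 𝓥 d' Ω Λ := fun f M hf hM hv z hz w hw =>
  (h f M hf hM hv z hz w hw).trans (mul_le_mul_of_nonneg_left (hd z w)
    (mul_nonneg hΛ ((norm_nonneg _).trans (hM z hz))))

section
variable {E : Type*} [NormedAddCommGroup E] [NormedSpace ℝ E] {π : E →L[ℝ] ℂ}
  {ι : ℂ →L[ℝ] E} {V : Set ℂ} {Ω : Set E}

/-- Gain of a modulus in the slice direction at every order `m ≤ k`. By induction on `m`, since
the first derivatives of the slice transform of `g` are slice transforms of first derivatives of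
`g` and of `b g`, up to multiples of `g` and `b g`, for a tangential field `b` of class `C^k`. -/
theorem IsSlicing.exists_regOn_sliceTransform [FiniteDimensional ℝ E] (h : IsSlicing π ι V Ω)
    (hπι : IsSlicing.IsContractive π ι) {A ε : ℝ} {ω : ℝ → ℝ} (hω : IsModulus A ε ω)
    (hε0 : 0 < ε) (hε1 : ε ≤ 1) {Cτ : ℝ} (hCτ0 : 0 ≤ Cτ)
    (hCτ : ∀ z ∈ V, ∀ w ∈ V,
      ‖(∫ ζ in V, 1 / (z - ζ)) - ∫ ζ in V, 1 / (w - ζ)‖ ≤ Cτ * ‖z - w‖) {𝓥 : Set E}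
    (h𝓥 : ∀ v ∈ 𝓥, π v = 0 ∨ v = ι 1 ∨ v = ι Complex.I) (h1 : ι 1 ∈ 𝓥) (hI : ι Complex.I ∈ 𝓥)
    (hspan : Submodule.span ℝ 𝓥 = ⊤) {c𝓥 : ℝ}
    (hc𝓥 : ∀ (L : E →L[ℝ] ℂ) (M : ℝ), (∀ v ∈ 𝓥, ‖L v‖ ≤ M) → ‖L‖ ≤ c𝓥 * M)
    {Λ : ℝ} (hΛ : 1 ≤ Λ) (hL : LipBound 𝓥 (fun z w => ω ‖z - w‖) Ω Λ) (k : ℕ)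
    (hk : 1 ≤ k → ∃ b : ℂ → ℂ, ContDiff ℝ 1 b ∧ IsTangentialOn b V ∧
      ∀ m ≤ k, ∃ M, RegOn coordDirections (fun z w : ℂ => ‖z - w‖ ^ ε) V m M b) :
    ∀ m ≤ k, ∃ C ≥ 0, ∀ g M, 0 ≤ M →
      RegOn 𝓥 (fun z w => ω ‖z - w‖ + ‖π z - π w‖ ^ ε) Ω m M g →
      RegOn 𝓥 (fun z w => ω ‖z - w‖) Ω m (C * M) (sliceTransform π ι V g) := by
  intro m
  have hΩ := h.isOpen_total
  have hd0' : ∀ z w : E, 0 ≤ ω ‖z - w‖ := fun z w => hω.nonneg _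
  have hd0 : ∀ z w : E, 0 ≤ ω ‖z - w‖ + ‖π z - π w‖ ^ ε := fun z w =>
    add_nonneg (hd0' z w) (by positivity)
  have hLd : LipBound 𝓥 (fun z w => ω ‖z - w‖ + ‖π z - π w‖ ^ ε) Ω Λ :=
    hL.mono (by linarith) fun z w => le_add_of_nonneg_right (by positivity)
  induction m with
  | zero =>
    intro _
    exact h.exists_regOn_zero_sliceTransform hπι hω hε0 hε1 hCτ0 hCτ 𝓥
  | succ m ih =>
    intro hmk
    obtain ⟨C, hC0, hC⟩ := ih (by omega)
    obtain ⟨b, hbc, hbt, hbr⟩ := hk (by omega)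
    obtain ⟨Mb₀, hMb₀⟩ := hbr (m + 1) hmk
    -- `Mb₀` is nonnegative unless `V` is empty
    set Mb := max Mb₀ 0 with hMbdef
    have hMb0 : 0 ≤ Mb := le_max_right _ _
    have hMb : RegOn 𝓥 (fun z w => ω ‖z - w‖ + ‖π z - π w‖ ^ ε) Ω (m + 1) Mb fun z => b (π z) := by
      refine RegOn.comp_proj (𝓤 := coordDirections) (δ := fun z w : ℂ => ‖z - w‖ ^ ε)
        h.isOpen_base hΩ h.proj_mem (fun v hv => ?_) (fun z w => ?_) hd0 hMb0
        (hMb₀.mono (fun _ _ => le_rfl) (fun _ _ => by positivity) (le_max_left _ _))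
      · rcases h𝓥 v hv with h2 | rfl | rfl
        · exact Or.inr h2
        · left; simp [h.proj_incl, coordDirections]
        · left; simp [h.proj_incl, coordDirections]
      · exact le_add_of_nonneg_left (hd0' z w)
    obtain ⟨Cm, hCm1, hCm⟩ := RegOn.mul (𝓥 := 𝓥) hΩ hd0 hΛ hLd (m + 1)
    obtain ⟨C₁, hC₁0, hC₁⟩ := exists_setIntegral_norm_sub_inv_le h.isBounded_base
    set N := Cm * Mb with hN
    have hN0 : 0 ≤ N := by positivity
    refine ⟨C₁ + (C * (1 + N) + Real.pi * (Λ * N) + Real.pi * Λ + C), by positivity,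
      fun g M hM0 hg => ?_⟩
    have hF : RegOn 𝓥 (fun z w => ω ‖z - w‖ + ‖π z - π w‖ ^ ε) Ω (m + 1) (N * M)
        fun z => b (π z) * g z := by
      have := hCm _ _ _ _ hMb hg
      rwa [← mul_assoc] at this
    have hgB : IsBddC1On (M + c𝓥 * M) g Ω := by
      have hc0 : ∀ z ∈ Ω, ‖fderiv ℝ g z‖ ≤ c𝓥 * M := fun z hz =>
        hc𝓥 _ _ fun v hv => (hg.2.2 v hv).norm_le z hz
      refine ⟨(hg.contDiffOn hΩ hspan).of_le (by norm_cast; omega), fun z hz => ?_, fun z hz => ?_⟩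
      · exact (hg.norm_le z hz).trans (le_add_of_nonneg_right
          ((norm_nonneg _).trans (hc0 z hz)))
      · exact (hc0 z hz).trans (le_add_of_nonneg_left hM0)
    have hder := fun z (hz : z ∈ Ω) => h.exists_hasFDerivAt hgB hz
    set H : E → ℂ := fun z => holPart ((fderiv ℝ g z).comp ι) +
      antiPart ((fderiv ℝ (fun z => b (π z) * g z) z).comp ι) with hH
    have hHr : RegOn 𝓥 (fun z w => ω ‖z - w‖ + ‖π z - π w‖ ^ ε) Ω m ((1 + N) * M) H := by
      have e1 := ((hg.2.2 _ h1).sub hΩ ((hg.2.2 _ hI).const_mul hΩ Complex.I)).const_mul hΩ (1 / 2)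
      have e2 := ((hF.2.2 _ h1).add hΩ ((hF.2.2 _ hI).const_mul hΩ Complex.I)).const_mul hΩ (1 / 2)
      refine ((e1.add hΩ e2).congr hΩ fun z _ => ?_).mono (fun _ _ => le_rfl) hd0 (le_of_eq ?_)
      · simp [hH, holPart, antiPart]; ring
      · simp; ring
    have hTH := hC H ((1 + N) * M) (by positivity) hHr
    have hg' : RegOn 𝓥 (fun z w => ω ‖z - w‖) Ω m (Real.pi * (Λ * M)) fun z => (Real.pi : ℂ) * g z := by
      have := (hg.of_succ hΛ hL).const_mul hΩ (Real.pi : ℂ)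
      rwa [Complex.norm_real, Real.norm_of_nonneg Real.pi_pos.le] at this
    have hF' : RegOn 𝓥 (fun z w => ω ‖z - w‖) Ω m (Real.pi * (Λ * (N * M)))
        fun z => (Real.pi : ℂ) * (b (π z) * g z) := by
      have := (hF.of_succ hΛ hL).const_mul hΩ (Real.pi : ℂ)
      rwa [Complex.norm_real, Real.norm_of_nonneg Real.pi_pos.le] at this
    -- `∂ T g = T H - π b g`
    have hhol := hTH.sub hΩ hF'
    have hbig : ∀ x, x ≤ (C * (1 + N) + Real.pi * (Λ * N) + Real.pi * Λ + C) * M →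
        x ≤ (C₁ + (C * (1 + N) + Real.pi * (Λ * N) + Real.pi * Λ + C)) * M := fun x hx => by
      rw [add_mul]
      exact hx.trans (le_add_of_nonneg_left (by positivity))
    refine ⟨fun z hz => ?_, fun z hz => ?_, fun v hv => ?_⟩
    · obtain ⟨L, hL, -⟩ := hder z hz
      exact hL.differentiableAt.differentiableWithinAt
    · refine (h.norm_sliceTransform_le hC₁ hM0 hg.norm_le hz).trans ?_
      exact mul_le_mul_of_nonneg_right (le_add_of_nonneg_right (by positivity)) hM0
    · rcases h𝓥 v hv with h2 | rfl | rfl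
      · refine ((hC _ _ hM0 (hg.2.2 v hv)).congr hΩ fun z hz => ?_).mono (fun _ _ => le_rfl) hd0'
          (hbig _ ?_)
        · obtain ⟨L, hL, hL0, -⟩ := hder z hz
          rw [hL.fderiv, hL0 v h2]
        · have : 0 ≤ (C * (1 + N) + Real.pi * (Λ * N) + Real.pi * Λ) * M := by positivity
          linarith
      · refine ((hhol.add hΩ hg').congr hΩ fun z hz => ?_).mono (fun _ _ => le_rfl) hd0'
          (hbig _ ?_)
        · obtain ⟨L, hL, -, hanti, hhol'⟩ := hder z hz
          have e := clm_apply_eq_holPart_add_antiPart (L.comp ι) 1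
          rw [hanti, hhol' b hbc hbt] at e
          rw [hL.fderiv, show L (ι 1) = (L.comp ι) 1 from rfl, e]
          simp only [map_one]
          ring
        · have : 0 ≤ C * M := by positivity
          linarith
      · refine (((hhol.sub hΩ hg').const_mul hΩ Complex.I).congr hΩ fun z hz => ?_).mono
          (fun _ _ => le_rfl) hd0' (hbig _ ?_)
        · obtain ⟨L, hL, -, hanti, hhol'⟩ := hder z hz
          have e := clm_apply_eq_holPart_add_antiPart (L.comp ι) Complex.I
          rw [hanti, hhol' b hbc hbt] at e
          rw [hL.fderiv, show L (ι Complex.I) = (L.comp ι) Complex.I from rfl, e]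
          simp only [Complex.conj_I]
          ring
        · have : 0 ≤ C * M := by positivity
          rw [Complex.norm_I]
          linarith
end

/-! ### The Log-Hölder modulus of continuity -/

/-- The modulus of continuity of the Log-Hölder space. Distances above `1/2` do not enter the
seminorm; for them, the bound for the supremum is used. -/
def logHolderModulus (α ν t : ℝ) : ℝ := if t ≤ 1 / 2 then |t| ^ α * |Real.log t| ^ ν else 1

/-- A power of `t` dominates every power of the logarithm, uniformly on `(0, 1/2]`. -/
theorem exists_rpow_mul_abs_log_rpow_le {a : ℝ} (ha : 0 < a) (ν : ℝ) :
    ∃ B ≥ 0, ∀ t, 0 < t → t ≤ 1 / 2 → t ^ a * |Real.log t| ^ ν ≤ B := by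
  have hlog2 : 0 < Real.log 2 := Real.log_pos one_lt_two
  have hL : ∀ t : ℝ, 0 < t → t ≤ 1 / 2 → Real.log 2 ≤ |Real.log t| := fun t h0 ht => by
    have h1 : Real.log t ≤ -Real.log 2 := by
      rw [← Real.log_inv]
      exact Real.log_le_log h0 (by linarith)
    rw [abs_of_nonpos (by linarith)]
    linarith
  rcases le_or_gt ν 0 with hν | hν
  · refine ⟨Real.log 2 ^ ν, by positivity, fun t h0 ht => ?_⟩
    have h1 : t ^ a ≤ 1 := Real.rpow_le_one h0.le (by linarith) ha.le
    have h2 : |Real.log t| ^ ν ≤ Real.log 2 ^ ν :=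
      Real.rpow_le_rpow_of_nonpos hlog2 (hL t h0 ht) hν
    calc t ^ a * |Real.log t| ^ ν ≤ 1 * Real.log 2 ^ ν := by gcongr
      _ = _ := one_mul _
  · -- `L ≤ (ν / a) * exp (a L / ν)` for `L = |log t|`
    refine ⟨(ν / a) ^ ν, by positivity, fun t h0 ht => ?_⟩
    set L := |Real.log t| with hLdef
    have hL0 : 0 ≤ L := abs_nonneg _
    have htL : t = Real.exp (-L) := by
      rw [hLdef, abs_of_nonpos (Real.log_nonpos h0.le (by linarith)), neg_neg, Real.exp_log h0]
    have h1 : L ≤ ν / a * Real.exp (a * L / ν) := by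
      have := Real.add_one_le_exp (a * L / ν)
      calc L = ν / a * (a * L / ν) := by field_simp
        _ ≤ _ := by gcongr; linarith
    have h2 : L ^ ν ≤ (ν / a) ^ ν * Real.exp (a * L) := by
      refine (Real.rpow_le_rpow hL0 h1 hν.le).trans (le_of_eq ?_)
      rw [Real.mul_rpow (by positivity) (by positivity), ← Real.exp_mul]
      congr 2
      field_simp
    calc t ^ a * L ^ ν ≤ Real.exp (-L * a) * ((ν / a) ^ ν * Real.exp (a * L)) := by
          rw [htL, ← Real.exp_mul]
          gcongr
      _ = (ν / a) ^ ν * (Real.exp (-L * a) * Real.exp (a * L)) := by ring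
      _ = (ν / a) ^ ν := by
          rw [← Real.exp_add, show -L * a + a * L = 0 by ring, Real.exp_zero, mul_one]

/-- For `α = 1` the lower bound by `min t 1` needs that `|log t| ^ ν` stays away from `0` as
`t → 0`, that is, `0 ≤ ν`. -/
theorem exists_isModulus_logHolderModulus {α ν : ℝ} (hα0 : 0 < α) (hα1 : α ≤ 1)
    (hν : α = 1 → 0 ≤ ν) : ∃ A, IsModulus A (α / 2) (logHolderModulus α ν) := by
  have hlog2 : 0 < Real.log 2 := Real.log_pos one_lt_two
  have hlog : ∀ t : ℝ, 0 < t → t ≤ 1 / 2 →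
      |Real.log t| = -Real.log t ∧ Real.log 2 ≤ -Real.log t := fun t h0 ht => by
    have h1 : Real.log t ≤ -Real.log 2 := by
      rw [← Real.log_inv]
      exact Real.log_le_log h0 (by linarith)
    exact ⟨abs_of_nonpos (by linarith), by linarith⟩
  obtain ⟨B₁, hB₁0, hB₁⟩ := exists_rpow_mul_abs_log_rpow_le (half_pos hα0) ν
  -- for the lower bound `t ≤ B₂ * t ^ α * |log t| ^ ν`
  obtain ⟨B₂, hB₂0, hB₂⟩ : ∃ B ≥ 0, ∀ t, 0 < t → t ≤ 1 / 2 →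
      t ^ (1 - α) * |Real.log t| ^ (-ν) ≤ B := by
    rcases hα1.eq_or_lt with h1 | h1
    · refine ⟨Real.log 2 ^ (-ν), by positivity, fun t h0 ht => ?_⟩
      obtain ⟨e1, e2⟩ := hlog t h0 ht
      rw [h1, sub_self, Real.rpow_zero, one_mul, e1]
      exact Real.rpow_le_rpow_of_nonpos hlog2 e2 (by linarith [hν h1])
    · exact exists_rpow_mul_abs_log_rpow_le (by linarith) _
  obtain ⟨B₃, hB₃0, hB₃⟩ := exists_rpow_mul_abs_log_rpow_le hα0 ν
  set K : ℝ := 2 ^ α * B₃ * Real.log 2 ^ (-ν) with hK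
  have hK0 : 0 ≤ K := by positivity
  have hsmall : ∀ t, 0 ≤ t → t ≤ 1 / 2 → logHolderModulus α ν t = t ^ α * |Real.log t| ^ ν :=
    fun t h0 ht => by rw [logHolderModulus, if_pos ht, abs_of_nonneg h0]
  have hbig : ∀ t, ¬t ≤ 1 / 2 → logHolderModulus α ν t = 1 := fun t ht => if_neg ht
  have hzero : logHolderModulus α ν 0 = 0 := by
    rw [hsmall 0 le_rfl (by norm_num), Real.zero_rpow hα0.ne', zero_mul]
  have hnonneg : ∀ t, 0 ≤ logHolderModulus α ν t := fun t => by
    unfold logHolderModulus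
    split_ifs <;> positivity
  refine ⟨2 + B₁ + B₂ + B₃ + K, by linarith, hnonneg, fun s t hs hst => ?_, fun t ht => ?_,
    fun t ht => ?_⟩
  · rcases hs.eq_or_lt with rfl | hs0
    · rw [hzero]
      exact mul_nonneg (by linarith) (hnonneg t)
    have ht0 : 0 < t := hs0.trans_le hst
    -- past `1/2` the modulus is `1`, and `B₃` bounds its earlier values
    by_cases ht : t ≤ 1 / 2
    swap
    · rw [hbig t ht, mul_one]
      by_cases hs' : s ≤ 1 / 2
      · rw [hsmall s hs hs']
        linarith [hB₃ s hs0 hs']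
      · rw [hbig s hs']
        linarith
    rw [hsmall s hs (hst.trans ht), hsmall t ht0.le ht]
    obtain ⟨es, es'⟩ := hlog s hs0 (hst.trans ht)
    obtain ⟨et, et'⟩ := hlog t ht0 ht
    have hpt : 0 ≤ t ^ α * |Real.log t| ^ ν := by positivity
    rcases le_or_gt ν 0 with hν0 | hν0
    · have h1 : |Real.log s| ^ ν ≤ |Real.log t| ^ ν := by
        rw [es, et]
        exact Real.rpow_le_rpow_of_nonpos (by linarith)
          (neg_le_neg (Real.log_le_log hs0 hst)) hν0
      have h2 : s ^ α ≤ t ^ α := Real.rpow_le_rpow hs hst hα0.le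
      have h3 : s ^ α * |Real.log s| ^ ν ≤ t ^ α * |Real.log t| ^ ν := by gcongr
      nlinarith
    · -- compare with the value at `s / (2 t) ≤ 1 / 2`
      set q := s / (2 * t) with hq
      have hq0 : 0 < q := by positivity
      have hq1 : q ≤ 1 / 2 := by rw [hq, div_le_iff₀ (by positivity)]; linarith
      obtain ⟨eq, eq'⟩ := hlog q hq0 hq1
      have hlq : -Real.log q = Real.log 2 + Real.log t - Real.log s := by
        rw [hq, Real.log_div hs0.ne' (by positivity), Real.log_mul (by norm_num) ht0.ne']
        ring
      have h1 : |Real.log s| ≤ |Real.log t| * |Real.log q| * (Real.log 2)⁻¹ := by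
        rw [es, et, eq, ← div_eq_mul_inv, le_div_iff₀ hlog2, hlq]
        have h2 : Real.log s ≤ Real.log t := Real.log_le_log hs0 hst
        nlinarith
      have h2 : |Real.log s| ^ ν ≤ |Real.log t| ^ ν * |Real.log q| ^ ν * Real.log 2 ^ (-ν) := by
        refine (Real.rpow_le_rpow (abs_nonneg _) h1 hν0.le).trans (le_of_eq ?_)
        rw [Real.mul_rpow (by positivity) (by positivity), Real.mul_rpow (abs_nonneg _)
          (abs_nonneg _), Real.inv_rpow hlog2.le, Real.rpow_neg hlog2.le]
      have h3 : s ^ α = 2 ^ α * t ^ α * q ^ α := by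
        rw [← Real.mul_rpow (by norm_num) ht0.le, ← Real.mul_rpow (by positivity) hq0.le, hq]
        congr 1
        field_simp
      have h4 := hB₃ q hq0 hq1
      calc s ^ α * |Real.log s| ^ ν
          ≤ 2 ^ α * t ^ α * q ^ α * (|Real.log t| ^ ν * |Real.log q| ^ ν * Real.log 2 ^ (-ν)) := by
            rw [h3]; gcongr
        _ = 2 ^ α * (q ^ α * |Real.log q| ^ ν) * Real.log 2 ^ (-ν) *
            (t ^ α * |Real.log t| ^ ν) := by ring
        _ ≤ K * (t ^ α * |Real.log t| ^ ν) := by rw [hK]; gcongr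
        _ ≤ _ := by gcongr; linarith
  · by_cases ht' : t ≤ 1 / 2
    · rcases ht.eq_or_lt with rfl | ht0
      · rw [hzero]
        have : (0 : ℝ) ≤ 0 ^ (α / 2) := by positivity
        nlinarith
      · rw [hsmall t ht ht']
        have h1 := hB₁ t ht0 ht'
        have h2 : t ^ α = t ^ (α / 2) * t ^ (α / 2) := by
          rw [← Real.rpow_add ht0]; congr 1; ring
        calc t ^ α * |Real.log t| ^ ν = (t ^ (α / 2) * |Real.log t| ^ ν) * t ^ (α / 2) := by
              rw [h2]; ring
          _ ≤ B₁ * t ^ (α / 2) := by gcongr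
          _ ≤ _ := by gcongr; linarith
    · rw [hbig t ht']
      have h1 : (1 / 2 : ℝ) ≤ t ^ (α / 2) := by
        rcases le_total t 1 with h | h
        · refine le_trans (not_le.1 ht').le ?_
          simpa using Real.rpow_le_rpow_of_exponent_ge (by linarith [not_le.1 ht']) h
            (by linarith : α / 2 ≤ 1)
        · linarith [Real.one_le_rpow h (half_pos hα0).le]
      nlinarith
  · by_cases ht' : t ≤ 1 / 2
    · rcases ht.eq_or_lt with rfl | ht0
      · rw [hzero]; simp
      · rw [hsmall t ht ht', min_eq_left (by linarith)]
        have h1 := hB₂ t ht0 ht'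
        obtain ⟨e1, e2⟩ := hlog t ht0 ht'
        have hLpos : 0 < |Real.log t| := by rw [e1]; linarith
        have h2 : t = (t ^ (1 - α) * |Real.log t| ^ (-ν)) * (t ^ α * |Real.log t| ^ ν) := by
          have h3 : t ^ (1 - α) * t ^ α = t := by
            rw [← Real.rpow_add ht0]; simp
          have h4 : |Real.log t| ^ (-ν) * |Real.log t| ^ ν = 1 := by
            rw [← Real.rpow_add hLpos]; simp
          calc t = (t ^ (1 - α) * t ^ α) * (|Real.log t| ^ (-ν) * |Real.log t| ^ ν) := by
                rw [h3, h4, mul_one]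
            _ = _ := by ring
        calc t = _ := h2
          _ ≤ B₂ * (t ^ α * |Real.log t| ^ ν) := by gcongr
          _ ≤ _ := by gcongr; linarith
    · rw [hbig t ht', mul_one]
      exact (min_le_right _ _).trans (by linarith)

/-! ### Product domains -/

/-- The real coordinate directions `e_j`, `i e_j` of `ℂ^n = ℝ^{2n}`. -/
def realBasisDir {n : ℕ} (q : Fin n × Fin 2) : EuclideanSpace ℂ (Fin n) :=
  EuclideanSpace.single q.1 (![1, Complex.I] q.2)

/-- The `j`-th coordinate of `ℂ^n`, as a real-linear map. -/
def coordProj {n : ℕ} (j : Fin n) : EuclideanSpace ℂ (Fin n) →L[ℝ] ℂ :=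
  PiLp.proj (𝕜 := ℝ) 2 (fun _ : Fin n => ℂ) j

/-- The inclusion of the `j`-th coordinate axis in `ℂ^n`, as a real-linear map. -/
def coordIncl {n : ℕ} (j : Fin n) : ℂ →L[ℝ] EuclideanSpace ℂ (Fin n) :=
  LinearMap.toContinuousLinearMap
    { toFun := fun c => EuclideanSpace.single j c
      map_add' := fun a b => by ext i; by_cases h : i = j <;> simp [h]
      map_smul' := fun a b => by ext i; by_cases h : i = j <;> simp [h] }

section
variable {n : ℕ}

@[simp] theorem coordProj_apply (j : Fin n) (z : EuclideanSpace ℂ (Fin n)) :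
    coordProj j z = z j := rfl

@[simp] theorem coordIncl_apply (j : Fin n) (c : ℂ) :
    coordIncl j c = EuclideanSpace.single j c := rfl

theorem isSlicing_productDomain {D : Fin n → Set ℂ} (hD : ∀ j, IsOpen (D j)) (j : Fin n)
    (hb : Bornology.IsBounded (D j)) :
    IsSlicing (coordProj j) (coordIncl j) (D j) (productDomain D) where
  proj_incl c := by simp
  isOpen_base := hD j
  isBounded_base := hb
  isOpen_total := by
    have : productDomain D = ⋂ i, coordProj i ⁻¹' D i := by
      ext z; simp [productDomain]
    rw [this]
    exact isOpen_iInter_of_finite fun i => (hD i).preimage (coordProj i).continuous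
  proj_mem z hz := hz j
  slice_mem z hz ζ hζ i := by
    by_cases h : i = j
    · subst h; simpa using hζ
    · simpa [h] using hz i

theorem isContractive_coord (j : Fin n) : IsSlicing.IsContractive (coordProj j) (coordIncl j) where
  norm_proj_le v := PiLp.norm_apply_le v j
  norm_incl_le c := by simp
  norm_sub_le v := by
    rw [EuclideanSpace.norm_eq, EuclideanSpace.norm_eq]
    refine Real.sqrt_le_sqrt (Finset.sum_le_sum fun i _ => ?_)
    by_cases h : i = j
    · subst h; simp
    · simp [h]

theorem eq_sum_realBasisDir (v : EuclideanSpace ℂ (Fin n)) :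
    v = ∑ i, ((v i).re • realBasisDir (i, 0) + (v i).im • realBasisDir (i, 1)) := by
  ext k
  simp [realBasisDir, Finset.sum_add_distrib, Complex.re_add_im, Pi.single_apply]

theorem span_realBasisDir : Submodule.span ℝ (range (realBasisDir (n := n))) = ⊤ := by
  refine eq_top_iff.2 fun v _ => ?_
  rw [eq_sum_realBasisDir v]
  exact Submodule.sum_mem _ fun i _ => Submodule.add_mem _
    (Submodule.smul_mem _ _ (Submodule.subset_span (mem_range_self _)))
    (Submodule.smul_mem _ _ (Submodule.subset_span (mem_range_self _)))

theorem norm_le_of_realBasisDir (L : EuclideanSpace ℂ (Fin n) →L[ℝ] ℂ) {M : ℝ} (hM0 : 0 ≤ M)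
    (hM : ∀ v ∈ range (realBasisDir (n := n)), ‖L v‖ ≤ M) : ‖L‖ ≤ 2 * n * M := by
  refine L.opNorm_le_bound (by positivity) fun v => ?_
  conv_lhs => rw [eq_sum_realBasisDir v, map_sum]
  refine (norm_sum_le _ _).trans ?_
  have h : ∀ i ∈ Finset.univ, ‖L ((v i).re • realBasisDir (i, 0) + (v i).im • realBasisDir (i, 1))‖ ≤
      2 * M * ‖v‖ := fun i _ => by
    rw [map_add, map_smul, map_smul]
    refine (norm_add_le _ _).trans ?_
    rw [norm_smul, norm_smul, Real.norm_eq_abs, Real.norm_eq_abs]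
    have h0 : ‖v i‖ ≤ ‖v‖ := PiLp.norm_apply_le v i
    have h1 := mul_le_mul ((Complex.abs_re_le_norm (v i)).trans h0) (hM _ (mem_range_self (i, 0)))
      (norm_nonneg _) (norm_nonneg v)
    have h2 := mul_le_mul ((Complex.abs_im_le_norm (v i)).trans h0) (hM _ (mem_range_self (i, 1)))
      (norm_nonneg _) (norm_nonneg v)
    linarith
  refine (Finset.sum_le_sum h).trans (le_of_eq ?_)
  simp
  ring

/-- On a product of domains, a bounded derivative gives a Lipschitz bound: pass from `z` to `w`
one coordinate at a time. -/
theorem exists_lipschitz_productDomain {D : Fin n → Set ℂ} {k : ℕ} {α : ℝ}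
    (hD : ∀ j, IsBoundedDomainWithHolderBoundary (k + 1) α (D j)) :
    ∃ S ≥ 0, ∀ (f : EuclideanSpace ℂ (Fin n) → ℂ) (M : ℝ), DifferentiableOn ℝ f (productDomain D) →
      (∀ z ∈ productDomain D, ‖f z‖ ≤ M) →
      (∀ v ∈ range (realBasisDir (n := n)), ∀ z ∈ productDomain D, ‖fderiv ℝ f z v‖ ≤ M) →
      ∀ z ∈ productDomain D, ∀ w ∈ productDomain D, ‖f z - f w‖ ≤ S * M * ‖z - w‖ := by
  choose Λ hΛ0 hΛ using fun j => (hD j).exists_lipschitz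
  refine ⟨∑ j, Λ j * 2, Finset.sum_nonneg fun j _ => mul_nonneg (hΛ0 j) zero_le_two,
    fun f M hf hM hv z hz w hw => ?_⟩
  have hM0 : 0 ≤ M := (norm_nonneg _).trans (hM z hz)
  classical
  -- the point with the coordinates of `w` in `s` and those of `z` elsewhere
  let P : Finset (Fin n) → EuclideanSpace ℂ (Fin n) := fun s =>
    WithLp.toLp 2 fun i => if i ∈ s then w i else z i
  have hPmem : ∀ s, P s ∈ productDomain D := fun s i => by
    by_cases h : i ∈ s
    · simpa [P, h] using hw i
    · simpa [P, h] using hz i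
  have key : ∀ s : Finset (Fin n), ‖f z - f (P s)‖ ≤ ∑ j ∈ s, Λ j * 2 * M * ‖z - w‖ := by
    intro s
    induction s using Finset.induction_on with
    | empty => simp [P]
    | insert j s hj ih =>
      rw [Finset.sum_insert hj]
      have hsl := isSlicing_productDomain (fun j => (hD j).isOpen) j (hD j).isBounded
      have hline : ∀ ζ, HasFDerivAt (fun ζ : ℂ => P s + coordIncl j (ζ - coordProj j (P s)))
          (coordIncl j) ζ := fun ζ =>
        ((coordIncl j).hasFDerivAt.comp ζ ((hasFDerivAt_id ζ).sub_const _)).const_add _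
      have hd : ∀ ζ ∈ D j, HasFDerivAt
          (fun ζ => f (P s + coordIncl j (ζ - coordProj j (P s))))
          ((fderiv ℝ f (P s + coordIncl j (ζ - coordProj j (P s)))).comp (coordIncl j)) ζ := by
        intro ζ hζ
        exact HasFDerivAt.comp (f := fun ζ => P s + coordIncl j (ζ - coordProj j (P s))) ζ
          (hf.differentiableAt (hsl.isOpen_total.mem_nhds
            (hsl.slice_mem _ (hPmem s) ζ hζ))).hasFDerivAt (hline ζ)
      have h1 := hΛ j (fun ζ => f (P s + coordIncl j (ζ - coordProj j (P s)))) (2 * M)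
        (fun ζ hζ => (hd ζ hζ).differentiableAt.differentiableWithinAt)
        (fun ζ hζ => (hM _ (hsl.slice_mem _ (hPmem s) ζ hζ)).trans (by linarith))
        (fun ζ hζ => by
          rw [(hd ζ hζ).fderiv]
          refine norm_clm_le_of_coordDirections ?_
          rintro v (rfl | rfl)
          · exact hv _ ⟨(j, 0), by simp [realBasisDir]⟩ _ (hsl.slice_mem _ (hPmem s) ζ hζ)
          · exact hv _ ⟨(j, 1), by simp [realBasisDir]⟩ _ (hsl.slice_mem _ (hPmem s) ζ hζ))
        (z j) (hz j) (w j) (hw j)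
      have e1 : P s + coordIncl j (z j - coordProj j (P s)) = P s := by
        simp [P, hj]
      have e2 : P s + coordIncl j (w j - coordProj j (P s)) = P (insert j s) := by
        ext i
        by_cases h : i = j
        · subst h; simp [P]
        · simp [P, h]
      rw [e1, e2] at h1
      have h2 : ‖z j - w j‖ ≤ ‖z - w‖ := PiLp.norm_apply_le (z - w) j
      have h3 := mul_le_mul_of_nonneg_left h2 (mul_nonneg (hΛ0 j) (by positivity : 0 ≤ 2 * M))
      have h4 := norm_sub_le_norm_sub_add_norm_sub (f z) (f (P s)) (f (P (insert j s)))
      linarith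
  have hPw : P Finset.univ = w := by ext i; simp [P]
  have := key Finset.univ
  rw [hPw] at this
  refine this.trans (le_of_eq ?_)
  rw [Finset.sum_mul, Finset.sum_mul]

theorem exists_lipBound_productDomain {D : Fin n → Set ℂ} {k : ℕ} {α : ℝ}
    (hD : ∀ j, IsBoundedDomainWithHolderBoundary (k + 1) α (D j)) {A ε : ℝ} {ω : ℝ → ℝ}
    (hω : IsModulus A ε ω) :
    ∃ Λ ≥ 1, LipBound (range (realBasisDir (n := n))) (fun z w => ω ‖z - w‖) (productDomain D) Λ := by
  obtain ⟨S, hS0, hS⟩ := exists_lipschitz_productDomain hD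
  have hA := hω.one_le
  refine ⟨1 + (S + 2) * A, by nlinarith, fun f M hf hM hv z hz w hw => ?_⟩
  have hM0 : 0 ≤ M := (norm_nonneg _).trans (hM z hz)
  have h1 : ‖f z - f w‖ ≤ (S + 2) * M * min ‖z - w‖ 1 := by
    rcases le_total ‖z - w‖ 1 with h | h
    · rw [min_eq_left h]
      refine (hS f M hf hM hv z hz w hw).trans ?_
      gcongr
      linarith
    · rw [min_eq_right h, mul_one]
      refine (norm_sub_le _ _).trans ?_
      nlinarith [hM z hz, hM w hw]
  have h2 := mul_le_mul_of_nonneg_left (hω.min_le ‖z - w‖ (norm_nonneg _))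
    (by positivity : 0 ≤ (S + 2) * M)
  have h3 : 0 ≤ M * ω ‖z - w‖ := mul_nonneg hM0 (hω.nonneg _)
  linarith
end

/-! ### Iterated derivatives and multi-indices -/

section
variable {E : Type*} [NormedAddCommGroup E] [NormedSpace ℝ E]

/-- The iterated derivative of `f` in the directions of a list, the head of the list first. -/
def dirDeriv : List E → (E → ℂ) → E → ℂ
  | [], f => f
  | v :: l, f => dirDeriv l fun z => fderiv ℝ f z v

theorem dirDeriv_append (l l' : List E) (f : E → ℂ) :
    dirDeriv (l ++ l') f = dirDeriv l' (dirDeriv l f) := by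
  induction l generalizing f with
  | nil => rfl
  | cons v l ih => exact ih _

theorem dirDeriv_eqOn {Ω : Set E} (hΩ : IsOpen Ω) {f g : E → ℂ} (hfg : EqOn f g Ω) (l : List E) :
    EqOn (dirDeriv l f) (dirDeriv l g) Ω := by
  induction l generalizing f g with
  | nil => exact hfg
  | cons v l ih =>
    refine ih fun z hz => ?_
    rw [(hfg.eventuallyEq_of_mem (hΩ.mem_nhds hz)).fderiv_eq]

theorem ContDiffOn.fderiv_apply_of_isOpen {Ω : Set E} (hΩ : IsOpen Ω) {f : E → ℂ} {m : ℕ}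
    (hf : ContDiffOn ℝ (m + 1 : ℕ) f Ω) (v : E) :
    ContDiffOn ℝ m (fun z => fderiv ℝ f z v) Ω := by
  have h1 : ContDiffOn ℝ m (fderiv ℝ f) Ω := hf.fderiv_of_isOpen hΩ (by norm_cast)
  exact h1.clm_apply contDiffOn_const

/-- Derivatives in several directions do not depend on the order of the directions. -/
theorem List.Perm.dirDeriv_eqOn {Ω : Set E} (hΩ : IsOpen Ω) {l l' : List E} (h : l.Perm l')
    {f : E → ℂ} (hf : ContDiffOn ℝ l.length f Ω) : EqOn (dirDeriv l f) (dirDeriv l' f) Ω := by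
  induction h generalizing f with
  | nil => exact fun _ _ => rfl
  | cons v h ih => exact ih (hf.fderiv_apply_of_isOpen hΩ v)
  | swap u v l =>
    refine _root_.dirDeriv_eqOn hΩ (fun z hz => ?_) l
    have h2 : ContDiffAt ℝ 2 f z :=
      (hf.contDiffAt (hΩ.mem_nhds hz)).of_le (by simp only [List.length_cons]; norm_cast; omega)
    have hd : DifferentiableAt ℝ (fderiv ℝ f) z :=
      (h2.fderiv_right (m := 1) (by norm_num)).differentiableAt one_ne_zero
    have hs := (h2.isSymmSndFDerivAt (by simp)).eq u v
    rw [(hd.hasFDerivAt.clm_apply (hasFDerivAt_const v z)).fderiv,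
      (hd.hasFDerivAt.clm_apply (hasFDerivAt_const u z)).fderiv]
    simpa using hs
  | trans h1 h2 ih1 ih2 =>
    exact (ih1 hf).trans (ih2 (by rwa [← h1.length_eq]))

/-- Mathlib's iterated derivative applies the head of the list last, `dirDeriv` first; the order
does not matter by symmetry. -/
theorem iteratedFDeriv_get_eq_dirDeriv {Ω : Set E} (hΩ : IsOpen Ω) {f : E → ℂ} (l : List E)
    (hf : ContDiffOn ℝ l.length f Ω) :
    EqOn (fun z => iteratedFDeriv ℝ l.length f z l.get) (dirDeriv l f) Ω := by
  have key : ∀ l : List E, ContDiffOn ℝ l.length f Ω →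
      EqOn (fun z => iteratedFDeriv ℝ l.length f z l.get) (dirDeriv l.reverse f) Ω := by
    intro l
    induction l with
    | nil => intro _ z _; simp [dirDeriv]
    | cons v l ih =>
      intro hf z hz
      have hf' : ContDiffOn ℝ l.length f Ω := hf.of_le (by simp)
      have hd : DifferentiableAt ℝ (iteratedFDeriv ℝ l.length f) z := by
        have h1 := (hf.differentiableOn_iteratedFDerivWithin (m := l.length)
          (by simp only [List.length_cons]; norm_cast; omega)
          hΩ.uniqueDiffOn).differentiableAt (hΩ.mem_nhds hz)
        refine h1.congr_of_eventuallyEq ?_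
        filter_upwards [hΩ.mem_nhds hz] with w hw
        rw [iteratedFDerivWithin_of_isOpen _ hΩ hw]
      rw [List.reverse_cons, dirDeriv_append]
      simp only [dirDeriv]
      rw [← ((ih hf').eventuallyEq_of_mem (hΩ.mem_nhds hz)).fderiv_eq]
      change iteratedFDeriv ℝ (l.length + 1) f z (v :: l).get = _
      rw [iteratedFDeriv_succ_apply_left]
      have h2 : HasFDerivAt (fun z => iteratedFDeriv ℝ l.length f z l.get)
          ((ContinuousMultilinearMap.apply ℝ (fun _ : Fin l.length => E) ℂ l.get).comp
            (fderiv ℝ (iteratedFDeriv ℝ l.length f) z)) z :=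
        (ContinuousMultilinearMap.apply ℝ (fun _ : Fin l.length => E) ℂ
          l.get).hasFDerivAt.comp z hd.hasFDerivAt
      rw [h2.fderiv]
      rfl
  exact (key l hf).trans
    (List.Perm.dirDeriv_eqOn hΩ (List.reverse_perm l) (by simpa using hf))

/-- Unfolding of the recursion in `RegOn`. -/
theorem regOn_iff_dirDeriv {𝓥 : Set E} {d : E → E → ℝ} {Ω : Set E} (hΩ : IsOpen Ω) {M : ℝ} (m : ℕ) :
    ∀ f : E → ℂ, ContDiffOn ℝ m f Ω → (RegOn 𝓥 d Ω m M f ↔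
      (∀ l : List E, (∀ v ∈ l, v ∈ 𝓥) → l.length ≤ m → ∀ z ∈ Ω, ‖dirDeriv l f z‖ ≤ M) ∧
      ∀ l : List E, (∀ v ∈ l, v ∈ 𝓥) → l.length = m →
        ∀ z ∈ Ω, ∀ w ∈ Ω, ‖dirDeriv l f z - dirDeriv l f w‖ ≤ M * d z w) := by
  induction m with
  | zero =>
    refine fun f hf => ⟨fun h => ⟨fun l _ hl => ?_, fun l _ hl => ?_⟩, fun h => ⟨hf.continuousOn,
      h.1 [] (by simp) le_rfl, h.2 [] (by simp) rfl⟩⟩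
    · rw [List.length_eq_zero_iff.1 (Nat.le_zero.1 hl)]
      exact h.2.1
    · rw [List.length_eq_zero_iff.1 hl]
      exact h.2.2
  | succ m ih =>
    intro f hf
    have hf' := fun v => hf.fderiv_apply_of_isOpen hΩ v
    constructor
    · refine fun h => ⟨fun l hl hlm => ?_, fun l hl hlm => ?_⟩
      · cases l with
        | nil => exact h.2.1
        | cons v l =>
          exact ((ih _ (hf' v)).1 (h.2.2 v (hl v (by simp)))).1 l
            (fun u hu => hl u (by simp [hu])) (by simpa using hlm)
      · cases l with
        | nil => simp at hlm
        | cons v l =>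
          exact ((ih _ (hf' v)).1 (h.2.2 v (hl v (by simp)))).2 l
            (fun u hu => hl u (by simp [hu])) (by simpa using hlm)
    · refine fun h => ⟨hf.differentiableOn (by simp), h.1 [] (by simp) (by simp), fun v hv =>
        (ih _ (hf' v)).2 ⟨fun l hl hlm => ?_, fun l hl hlm => ?_⟩⟩
      · exact h.1 (v :: l) (by simpa using ⟨hv, hl⟩) (by simpa using hlm)
      · exact h.2 (v :: l) (by simpa using ⟨hv, hl⟩) (by simpa using hlm)
end

section
variable {n : ℕ}

theorem directions_eq_map (γ : Fin n × Fin 2 → ℕ) : directions γ =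
    ((List.finRange n).flatMap fun j => List.replicate (γ (j, 0)) (j, (0 : Fin 2)) ++
      List.replicate (γ (j, 1)) (j, (1 : Fin 2))).map realBasisDir := by
  simp [directions, List.map_flatMap, realBasisDir]

theorem length_directions (γ : Fin n × Fin 2 → ℕ) : (directions γ).length = ∑ q, γ q := by
  rw [Fintype.sum_prod_type, Fin.sum_univ_def]
  simp [directions, List.length_flatMap]

theorem mem_range_of_mem_directions {γ : Fin n × Fin 2 → ℕ} {v : EuclideanSpace ℂ (Fin n)}
    (hv : v ∈ directions γ) : v ∈ range (realBasisDir (n := n)) := by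
  rw [directions_eq_map, List.mem_map] at hv
  obtain ⟨q, -, rfl⟩ := hv
  exact mem_range_self q

/-- Up to the order, a list of coordinate directions comes from a multi-index. -/
theorem exists_perm_directions {l : List (EuclideanSpace ℂ (Fin n))}
    (hl : ∀ v ∈ l, v ∈ range (realBasisDir (n := n))) :
    ∃ γ : Fin n × Fin 2 → ℕ, l.Perm (directions γ) := by
  obtain ⟨l', rfl⟩ : ∃ l' : List (Fin n × Fin 2), l'.map realBasisDir = l := by
    have h : l ∈ range (List.map (realBasisDir (n := n))) := by
      rw [range_list_map]; exact hl
    exact h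
  refine ⟨fun q => l'.count q, ?_⟩
  rw [directions_eq_map]
  refine List.Perm.map _ (List.perm_iff_count.2 fun q => ?_)
  rw [List.count_flatMap]
  obtain ⟨j, i⟩ := q
  simp only [Function.comp_def, List.count_append, List.count_replicate]
  rw [← Fin.sum_univ_def]
  fin_cases i <;> simp
end

/-! ### The Log-Hölder norm and the slice operator -/

section
variable {n : ℕ} {Ω : Set (EuclideanSpace ℂ (Fin n))} {f : EuclideanSpace ℂ (Fin n) → ℂ} {k : ℕ}
  {α ν : ℝ}

theorem multiDeriv_eqOn_dirDeriv (hΩ : IsOpen Ω) {γ : Fin n × Fin 2 → ℕ} {m : ℕ}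
    (hγ : γ ∈ multiIndices n m) (hf : ContDiffOn ℝ m f Ω) :
    EqOn (multiDeriv γ f) (dirDeriv (directions γ) f) Ω := by
  refine iteratedFDeriv_get_eq_dirDeriv hΩ (directions γ) ?_
  rwa [length_directions, (Finset.mem_piAntidiag.1 hγ).1]

/-- Every iterated derivative in coordinate directions is one of the derivatives `D^γ`. -/
theorem exists_dirDeriv_eqOn_multiDeriv (hΩ : IsOpen Ω) {l : List (EuclideanSpace ℂ (Fin n))}
    (hl : ∀ v ∈ l, v ∈ range (realBasisDir (n := n))) (hf : ContDiffOn ℝ l.length f Ω) :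
    ∃ γ ∈ multiIndices n l.length, EqOn (dirDeriv l f) (multiDeriv γ f) Ω := by
  obtain ⟨γ, hγ⟩ := exists_perm_directions hl
  have hmem : γ ∈ multiIndices n l.length := by
    refine Finset.mem_piAntidiag.2 ⟨?_, fun _ _ => Finset.mem_univ _⟩
    rw [hγ.length_eq, length_directions]
  exact ⟨γ, hmem, (hγ.dirDeriv_eqOn hΩ hf).trans (multiDeriv_eqOn_dirDeriv hΩ hmem hf).symm⟩

theorem logHolderWeight_pos {t : ℝ} (h0 : 0 < t) (h1 : t ≤ 1 / 2) :
    0 < t ^ α * |Real.log t| ^ ν := by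
  have : Real.log t < 0 := Real.log_neg h0 (by linarith)
  have : 0 < |Real.log t| := abs_pos.2 this.ne
  positivity

theorem logHolderModulus_eq {t : ℝ} (h0 : 0 ≤ t) (h1 : t ≤ 1 / 2) :
    logHolderModulus α ν t = t ^ α * |Real.log t| ^ ν := by
  rw [logHolderModulus, if_pos h1, abs_of_nonneg h0]

/-- The factor `2` comes from pairs of points at distance more than `1/2`, which the seminorm does
not compare: there, twice the bound for the supremum is used. -/
theorem MemLogHolder.regOn (hΩ : IsOpen Ω) (h : MemLogHolder k α ν Ω f) :
    RegOn (range (realBasisDir (n := n))) (fun z w => logHolderModulus α ν ‖z - w‖) Ω k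
      (2 * (logHolderNorm k α ν Ω f).toReal) f := by
  obtain ⟨hf, hfin⟩ := h
  set N := logHolderNorm k α ν Ω f with hN
  have hN0 : 0 ≤ N.toReal := ENNReal.toReal_nonneg
  have hsup : ∀ m ≤ k, ∀ γ ∈ multiIndices n m, ∀ z ∈ Ω, ‖multiDeriv γ f z‖ ≤ N.toReal := by
    intro m hm γ hγ z hz
    refine (ENNReal.ofReal_le_iff_le_toReal hfin.ne).1 ?_
    have h1 : ENNReal.ofReal ‖multiDeriv γ f z‖ ≤ supNormOn Ω (multiDeriv γ f) :=
      le_iSup₂ (f := fun w (_ : w ∈ Ω) => ENNReal.ofReal ‖multiDeriv γ f w‖) z hz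
    have h2 : supNormOn Ω (multiDeriv γ f) ≤
        ∑ γ ∈ multiIndices n m, supNormOn Ω (multiDeriv γ f) :=
      Finset.single_le_sum (f := fun γ => supNormOn Ω (multiDeriv γ f)) (fun _ _ => zero_le) hγ
    have h3 : ∑ γ ∈ multiIndices n m, supNormOn Ω (multiDeriv γ f) ≤
        ∑ m ∈ Finset.range (k + 1), ∑ γ ∈ multiIndices n m, supNormOn Ω (multiDeriv γ f) :=
      Finset.single_le_sum
        (f := fun m => ∑ γ ∈ multiIndices n m, supNormOn Ω (multiDeriv γ f))
        (fun _ _ => zero_le) (Finset.mem_range.2 (by omega))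
    exact h1.trans (h2.trans (h3.trans le_self_add))
  have hhol : ∀ γ ∈ multiIndices n k, ∀ z ∈ Ω, ∀ w ∈ Ω, 0 < ‖z - w‖ → ‖z - w‖ ≤ 1 / 2 →
      ‖multiDeriv γ f z - multiDeriv γ f w‖ ≤
        N.toReal * (‖z - w‖ ^ α * |Real.log ‖z - w‖| ^ ν) := by
    intro γ hγ z hz w hw h0 h1
    rw [← div_le_iff₀ (logHolderWeight_pos h0 h1)]
    refine (ENNReal.ofReal_le_iff_le_toReal hfin.ne).1 ?_
    have h2 : ENNReal.ofReal (‖multiDeriv γ f z - multiDeriv γ f w‖ /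
        (‖z - w‖ ^ α * |Real.log ‖z - w‖| ^ ν)) ≤ logHolderSeminorm α ν Ω (multiDeriv γ f) := by
      have hz' : w + (z - w) ∈ Ω := by simpa using hz
      refine le_trans ?_ (le_iSup_of_le w (le_iSup_of_le (z - w) (le_iSup_of_le hw
        (le_iSup_of_le hz' (le_iSup_of_le h0 (le_iSup_of_le h1 le_rfl))))))
      rw [add_sub_cancel]
    have h3 : logHolderSeminorm α ν Ω (multiDeriv γ f) ≤
        ∑ γ ∈ multiIndices n k, logHolderSeminorm α ν Ω (multiDeriv γ f) :=
      Finset.single_le_sum (f := fun γ => logHolderSeminorm α ν Ω (multiDeriv γ f))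
        (fun _ _ => zero_le) hγ
    exact h2.trans (h3.trans le_add_self)
  refine (regOn_iff_dirDeriv hΩ k f hf).2 ⟨fun l hl hlk z hz => ?_, fun l hl hlk z hz w hw => ?_⟩
  · obtain ⟨γ, hγ, he⟩ := exists_dirDeriv_eqOn_multiDeriv hΩ hl
      (hf.of_le (by exact_mod_cast hlk))
    rw [he hz]
    linarith [hsup _ hlk γ hγ z hz]
  · obtain ⟨γ, hγ, he⟩ := exists_dirDeriv_eqOn_multiDeriv hΩ hl (by rwa [hlk])
    rw [he hz, he hw]
    rw [hlk] at hγ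
    rcases (norm_nonneg (z - w)).eq_or_lt with h0 | h0
    · have : z = w := sub_eq_zero.1 (norm_eq_zero.1 h0.symm)
      subst this
      rw [sub_self, norm_zero, logHolderModulus_eq (norm_nonneg _) (by simp)]
      positivity
    by_cases h1 : ‖z - w‖ ≤ 1 / 2
    · rw [logHolderModulus_eq h0.le h1]
      refine (hhol γ hγ z hz w hw h0 h1).trans ?_
      exact mul_le_mul_of_nonneg_right (by linarith) (logHolderWeight_pos h0 h1).le
    · rw [logHolderModulus, if_neg h1, mul_one]
      have h2 := norm_sub_le (multiDeriv γ f z) (multiDeriv γ f w)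
      linarith [hsup k le_rfl γ hγ z hz, hsup k le_rfl γ hγ w hw]

/-- Each of the finitely many suprema that make up the norm is at most `M`. -/
theorem RegOn.memLogHolder (hΩ : IsOpen Ω) {M : ℝ}
    (h : RegOn (range (realBasisDir (n := n))) (fun z w => logHolderModulus α ν ‖z - w‖) Ω k M f) :
    MemLogHolder k α ν Ω f ∧ logHolderNorm k α ν Ω f ≤
      (((∑ m ∈ Finset.range (k + 1), (multiIndices n m).card) + (multiIndices n k).card : ℕ) : ℝ≥0∞) *
        ENNReal.ofReal M := by
  have hf : ContDiffOn ℝ k f Ω := h.contDiffOn hΩ span_realBasisDir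
  obtain ⟨h1, h2⟩ := (regOn_iff_dirDeriv hΩ k f hf).1 h
  have hsup : ∀ m ∈ Finset.range (k + 1), ∀ γ ∈ multiIndices n m,
      supNormOn Ω (multiDeriv γ f) ≤ ENNReal.ofReal M := by
    intro m hm γ hγ
    have hm' : m ≤ k := by simpa [Nat.lt_succ_iff] using hm
    refine iSup₂_le fun z hz => ENNReal.ofReal_le_ofReal ?_
    rw [multiDeriv_eqOn_dirDeriv hΩ hγ (hf.of_le (by exact_mod_cast hm')) hz]
    refine h1 _ (fun v hv => mem_range_of_mem_directions hv) ?_ z hz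
    rwa [length_directions, (Finset.mem_piAntidiag.1 hγ).1]
  have hhol : ∀ γ ∈ multiIndices n k,
      logHolderSeminorm α ν Ω (multiDeriv γ f) ≤ ENNReal.ofReal M := by
    intro γ hγ
    refine iSup_le fun w => iSup_le fun v => iSup_le fun hw => iSup_le fun hwv => iSup_le fun h0 =>
      iSup_le fun hv => ENNReal.ofReal_le_ofReal ?_
    rw [multiDeriv_eqOn_dirDeriv hΩ hγ hf hwv, multiDeriv_eqOn_dirDeriv hΩ hγ hf hw,
      div_le_iff₀ (logHolderWeight_pos h0 hv), ← logHolderModulus_eq h0.le hv]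
    have h3 := h2 _ (fun v hv => mem_range_of_mem_directions hv) (by
      rw [length_directions, (Finset.mem_piAntidiag.1 hγ).1]) (w + v) hwv w hw
    rwa [add_sub_cancel_left] at h3
  have hle : logHolderNorm k α ν Ω f ≤
      (((∑ m ∈ Finset.range (k + 1), (multiIndices n m).card) + (multiIndices n k).card : ℕ) : ℝ≥0∞) *
        ENNReal.ofReal M := by
    rw [logHolderNorm, Nat.cast_add, Nat.cast_sum, add_mul, Finset.sum_mul]
    refine add_le_add (Finset.sum_le_sum fun m hm => ?_) ?_
    · rw [← nsmul_eq_mul]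
      exact Finset.sum_le_card_nsmul _ _ _ (hsup m hm)
    · rw [← nsmul_eq_mul]
      exact Finset.sum_le_card_nsmul _ _ _ hhol
  exact ⟨⟨hf, hle.trans_lt (ENNReal.mul_lt_top (ENNReal.natCast_lt_top _) ENNReal.ofReal_lt_top)⟩,
    hle⟩

theorem sliceCauchyIntegrand_eq (j : Fin n) (z : EuclideanSpace ℂ (Fin n)) (ζ : ℂ) :
    sliceCauchyIntegrand j f z ζ =
      -(f (z + coordIncl j (ζ - coordProj j z)) / (coordProj j z - ζ)) := by
  have h : replaceCoord z j ζ = z + coordIncl j (ζ - coordProj j z) := by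
    ext i
    by_cases h : i = j
    · subst h; simp [replaceCoord]
    · simp [replaceCoord, h]
  rw [sliceCauchyIntegrand, h, coordProj_apply, ← div_neg, neg_sub]

/-- The constants `-1 / (2πi)` and `2i` multiply to `-1 / π`, and `ζ - z` is replaced by `z - ζ`.
-/
theorem sliceCauchyGreen_eq (D : Fin n → Set ℂ) (j : Fin n) (z : EuclideanSpace ℂ (Fin n)) :
    sliceCauchyGreen D j f z =
      (Real.pi : ℂ)⁻¹ * sliceTransform (coordProj j) (coordIncl j) (D j) f z := by
  rw [sliceCauchyGreen, sliceTransform]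
  simp only [sliceCauchyIntegrand_eq]
  rw [integral_neg]
  have := Complex.I_ne_zero
  have : (Real.pi : ℂ) ≠ 0 := by exact_mod_cast Real.pi_ne_zero
  field_simp
end

/-- The slice Cauchy–Green operator in one coordinate is bounded on the Log-Hölder space. -/
theorem exists_logHolderNorm_sliceCauchyGreen_le {n : ℕ} {D : Fin n → Set ℂ} {k : ℕ} {α ν : ℝ}
    (hα0 : 0 < α) (hα1 : α ≤ 1) (hν : α = 1 → 0 ≤ ν)
    (hD : ∀ j, IsBoundedDomainWithHolderBoundary (k + 1) α (D j)) (j : Fin n) :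
    ∃ C : ℝ≥0, ∀ f, MemLogHolder k α ν (productDomain D) f →
      MemLogHolder k α ν (productDomain D) (sliceCauchyGreen D j f) ∧
      logHolderNorm k α ν (productDomain D) (sliceCauchyGreen D j f) ≤
        C * logHolderNorm k α ν (productDomain D) f := by
  have hsl := isSlicing_productDomain (fun j => (hD j).isOpen) j (hD j).isBounded
  have hΩ := hsl.isOpen_total
  have hε0 : 0 < α / 2 := by positivity
  have hε1 : α / 2 ≤ 1 := by linarith
  obtain ⟨A, hω⟩ := exists_isModulus_logHolderModulus hα0 hα1 hν
  obtain ⟨Λ, hΛ1, hΛ⟩ := exists_lipBound_productDomain hD hω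
  obtain ⟨Cτ, hCτ0, hCτ⟩ := (hD j).exists_lipschitz_cauchyTransform hα0 hα1
  have hb : 1 ≤ k → ∃ b : ℂ → ℂ, ContDiff ℝ 1 b ∧ IsTangentialOn b (D j) ∧ ∀ m ≤ k, ∃ M,
      RegOn coordDirections (fun z w : ℂ => ‖z - w‖ ^ (α / 2)) (D j) m M b := by
    intro hk
    obtain ⟨b, hb1, hbt, hbr⟩ :=
      (hD j).exists_isTangentialOn hk hε0 hε1 (by linarith : α / 2 ≤ α)
    obtain ⟨R, hR, hDR⟩ := (hD j).isBounded.subset_ball_lt 0 (0 : ℂ)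
    refine ⟨b, hb1, hbt, fun m hm => ?_⟩
    obtain ⟨M, hM⟩ := hbr R hR
    obtain ⟨M', hM'⟩ := hM.exists_of_le (by linarith) (lipBound_ball hε0.le hε1) hm
    exact ⟨M', hM'.subset hDR⟩
  obtain ⟨C, hC0, hC⟩ := hsl.exists_regOn_sliceTransform (isContractive_coord j) hω hε0 hε1 hCτ0 hCτ
    (𝓥 := range realBasisDir) (c𝓥 := 2 * n) (by
      rintro v ⟨⟨i, e⟩, rfl⟩
      by_cases h : i = j
      · subst h
        fin_cases e <;> simp [realBasisDir]
      · left
        simp [realBasisDir, Ne.symm h])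
    ⟨(j, 0), by simp [realBasisDir]⟩ ⟨(j, 1), by simp [realBasisDir]⟩ span_realBasisDir
    (fun L M hM => norm_le_of_realBasisDir L
      ((norm_nonneg _).trans (hM _ (mem_range_self (j, 0)))) hM) hΛ1 hΛ k hb k le_rfl
  set c : ℕ := (∑ m ∈ Finset.range (k + 1), (multiIndices n m).card) + (multiIndices n k).card
  refine ⟨c * Real.toNNReal (‖(Real.pi : ℂ)⁻¹‖ * (C * 2)), fun f hf => ?_⟩
  set N := logHolderNorm k α ν (productDomain D) f with hN
  have hN0 : 0 ≤ N.toReal := ENNReal.toReal_nonneg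
  have hreg := (hf.regOn hΩ).mono
    (d' := fun z w => logHolderModulus α ν ‖z - w‖ + ‖coordProj j z - coordProj j w‖ ^ (α / 2))
    (fun z w => le_add_of_nonneg_right (by positivity)) (fun z w => hω.nonneg _) le_rfl
  have hT := ((hC f _ (by positivity) hreg).const_mul hΩ (Real.pi : ℂ)⁻¹).congr hΩ
    (g := sliceCauchyGreen D j f) fun z _ => (sliceCauchyGreen_eq D j z).symm
  obtain ⟨h1, h2⟩ := hT.memLogHolder hΩ
  refine ⟨h1, h2.trans (le_of_eq ?_)⟩
  rw [← hN, show ‖(Real.pi : ℂ)⁻¹‖ * (C * (2 * N.toReal)) =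
    ‖(Real.pi : ℂ)⁻¹‖ * (C * 2) * N.toReal by ring, ENNReal.ofReal_mul (by positivity),
    ENNReal.ofReal_toReal hf.2.ne, ← mul_assoc]
  rw [ENNReal.coe_mul, ENNReal.coe_natCast]
  rfl

end

theorem proposition6p1 {n : ℕ} (D : Fin n → Set ℂ) (k : ℕ) (α ν : ℝ)
    (hα0 : 0 < α) (hα1 : α ≤ 1) (hν : α = 1 → 0 ≤ ν)
    (hD : ∀ j, IsBoundedDomainWithHolderBoundary (k + 1) α (D j)) :
    ∃ C : ℝ≥0, ∀ j : Fin n,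
      (∀ f : EuclideanSpace ℂ (Fin n) → ℂ, MemLogHolder k α ν (productDomain D) f →
        (∀ z ∈ productDomain D,
          MeasureTheory.IntegrableOn (sliceCauchyIntegrand j f z) (D j)) ∧
        MemLogHolder k α ν (productDomain D) (sliceCauchyGreen D j f) ∧
        logHolderNorm k α ν (productDomain D) (sliceCauchyGreen D j f) ≤
          C * logHolderNorm k α ν (productDomain D) f) ∧
      (∀ f g : EuclideanSpace ℂ (Fin n) → ℂ, MemLogHolder k α ν (productDomain D) f →
        MemLogHolder k α ν (productDomain D) g → ∀ a b : ℂ, ∀ z ∈ productDomain D,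
          sliceCauchyGreen D j (fun w => a * f w + b * g w) z =
            a * sliceCauchyGreen D j f z + b * sliceCauchyGreen D j g z) := by
  choose C hC using fun j => exists_logHolderNorm_sliceCauchyGreen_le hα0 hα1 hν hD j
  have hint : ∀ j, ∀ f, MemLogHolder k α ν (productDomain D) f → ∀ z ∈ productDomain D,
      MeasureTheory.IntegrableOn (sliceCauchyIntegrand j f z) (D j) := by
    intro j f hf z hz
    have hsl := isSlicing_productDomain (fun j => (hD j).isOpen) j (hD j).isBounded
    have hreg := hf.regOn hsl.isOpen_total
    have h1 := (hsl.integrableOn hreg.continuousOn hreg.norm_le hz (coordProj j z)).neg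
    exact h1.congr (Filter.Eventually.of_forall fun ζ => (sliceCauchyIntegrand_eq j z ζ).symm)
  refine ⟨∑ j, C j, fun j => ⟨fun f hf => ⟨hint j f hf, (hC j f hf).1, (hC j f hf).2.trans ?_⟩,
    fun f g hf hg a b z hz => ?_⟩⟩
  · gcongr
    exact Finset.single_le_sum (f := C) (fun _ _ => zero_le) (Finset.mem_univ j)
  · have e : ∀ ζ, sliceCauchyIntegrand j (fun w => a * f w + b * g w) z ζ =
        a * sliceCauchyIntegrand j f z ζ + b * sliceCauchyIntegrand j g z ζ := fun ζ => by
      simp only [sliceCauchyIntegrand]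
      ring
    simp only [sliceCauchyGreen, e]
    rw [MeasureTheory.integral_add ((hint j f hf z hz).const_mul a)
      ((hint j g hg z hz).const_mul b), MeasureTheory.integral_const_mul,
      MeasureTheory.integral_const_mul]
    ring
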